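/- **Theorem 1.4 (Quantified Wiener–Ikehara theorem with simple pole).** Let $M:[0,\infty)\to(0,\infty)$ and $K:[0,\infty)\to[0,\infty)$ be continuous non-decreasing functions, $K\not\equiv 0$. Put $$\Omega_M=\{s\in\mathbb C: |\operatorname{Re}s|\le 1/M(|\operatorname{Im}s|)\},\qquad M_K(t)=M(t)(\log t+\log K(t)),\qquad M_{K,\log}(t)=M(t)(\log t+\log\log t+\log K(t)),$$ and let $M_K^{-1}$ and $M_{K,\log}^{-1}$ denote the inverse functions of $M_K$ and $M_{K,\log}$, which are well defined for all sufficiently large arguments. Let $\tau:[0,\infty)\to\mathbb R$ be a non-decreasing function whose Laplace transform $\mathcal L\{\tau;s\}=\int_0^\infty \tau(x)e^{-sx}\,dx$ converges for $\operatorname{Re}s>1$, and suppose that for some $\mathfrak A>0$ the function $\mathcal L\{\tau;s+1\}-\mathfrak A/s$ ($\operatorname{Re}s>0$) admits an analytic extension $g$ to $\Omega_M$, i.e. there is a continuous function $g$ on $\Omega_M$, analytic in the interior of $\Omega_M$, with $g(s)=\mathcal L\{\tau;s+1\}-\mathfrak A/s$ for $s\in\Omega_M$, $\operatorname{Re}s>0$.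 Suppose moreover that $g(s)\ll K(|s|)/|s|$ as $|s|\to\infty$, $s\in\Omega_M$. A function $V$ is said to be of $\eta$-regular growth if there are $C',t_0>0$ such that $V(C't)/V(t)\ge 1+1/\eta(t)$ for all $t\ge t_0$. The function $K$ is of positive increase if there are $a,t_0>0$ such that $t^{-a}K(t)\ll R^{-a}K(R)$ uniformly for $t_0\le t\le R$. 1. For every $0<c<1$, $$\tau(x)=\mathfrak A e^x+O_{\tau,M,K,c}\!\left(\frac{e^x}{M_{K,\log}^{-1}(cx)}\right),\qquad x\to\infty.$$ 2. If $M_{K,\log}$ is of $tM(t)/675$-regular growth, then the estimate in 1 also holds with $c=1$. 3. Suppose that either $M_{K,\log}$ is of $tM(t)/675$-regular growth and $K$ is of positive increase, or $M(t)/\log^{\beta}t$ is eventually non-decreasing for some $\beta>0$ and $M_{K,\log}$ is of $tM(t)/1350$-regular growth. Then $$\tau(x)=\mathfrak A e^x+O_{\tau,M,K}\!\left(\frac{e^x}{M_{K}^{-1}(x)}\right),\qquad x\to\infty.$$ -/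

import Mathlib

open Filter Topology Asymptotics

noncomputable section

/-- The Laplace integral `∫₀^∞ e^{-su} f(u) du` converges (as an improper integral) with value `l`. -/
def HasLaplace (f : ℝ → ℝ) (s l : ℂ) : Prop :=
  Tendsto (fun T : ℝ => ∫ u in (0 : ℝ)..T, Complex.exp (-s * u) * (f u : ℂ)) atTop (𝓝 l)

/-- The closed region `{s : |Re s| ≤ 1 / M(|Im s|)}` around the imaginary axis. -/
def Omega (M : ℝ → ℝ) : Set ℂ :=
  {s : ℂ | |s.re| ≤ 1 / M |s.im|}

/-- Analytic on a closed domain: holomorphic on the interior, continuous up to the boundary. -/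
def AnalyticOnClosedDomain (g : ℂ → ℂ) (D : Set ℂ) : Prop :=
  DifferentiableOn ℂ g (interior D) ∧ ContinuousOn g D

/-- `M_K(t) = M(t) (log t + log K(t))`. -/
def MK (M K : ℝ → ℝ) (t : ℝ) : ℝ :=
  M t * (Real.log t + Real.log (K t))

/-- `M_{K,log}(t) = M(t) (log t + log log t + log K(t))`. -/
def MKlog (M K : ℝ → ℝ) (t : ℝ) : ℝ :=
  M t * (Real.log t + Real.log (Real.log t) + Real.log (K t))

/-- The inverse function of `M_K` on `(0, ∞)`. When `M` and `K` are positive, continuous and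
non-decreasing, every `x > 0` has exactly one preimage in `(0, ∞)`, since `M_K` is strictly
increasing where it is positive, and unbounded. -/
def MKInv (M K : ℝ → ℝ) (x : ℝ) : ℝ :=
  Function.invFunOn (MK M K) (Set.Ioi 0) x

/-- The inverse function of `M_{K,log}` on `(1, ∞)`, where `log log t` is defined. When `M` and `K`
are positive, continuous and non-decreasing, every `x > 0` has exactly one preimage in
`(1, ∞)`. -/
def MKlogInv (M K : ℝ → ℝ) (x : ℝ) : ℝ :=
  Function.invFunOn (MKlog M K) (Set.Ioi 1) x

/-- `V` is of `η`-regular growth. -/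
def IsOfRegularGrowth (η V : ℝ → ℝ) : Prop :=
  ∃ C : ℝ, 0 < C ∧ ∃ t₀ : ℝ, 0 < t₀ ∧ ∀ t : ℝ, t₀ ≤ t → 1 + 1 / η t ≤ V (C * t) / V t

/-- `K` is of positive increase: `t^{-a} K(t) ≪ R^{-a} K(R)` for `t₀ ≤ t ≤ R`. -/
def IsOfPositiveIncrease (K : ℝ → ℝ) : Prop :=
  ∃ a : ℝ, 0 < a ∧ ∃ t₀ : ℝ, 0 < t₀ ∧ ∃ B : ℝ, ∀ R t : ℝ, t₀ ≤ t → t ≤ R →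
    t ^ (-a) * K t ≤ B * (R ^ (-a) * K R)

/-- `M(t) / log^β t` is eventually non-decreasing for some `β > 0`. -/
def EventuallyMonotoneOverLogPow (M : ℝ → ℝ) : Prop :=
  ∃ β : ℝ, 0 < β ∧ ∃ t₁ : ℝ, 1 < t₁ ∧ MonotoneOn (fun t : ℝ => M t / Real.log t ^ β) (Set.Ici t₁)

end

/-! Put Δ(u) = e^{-u} τ(u) - A (`deviation`). Its Laplace transform on Re s > 0 is g. Because τ is
monotone, Δ cannot drop quickly, so a bound O(1/R) for the convolution of Δ with a non-negative
kernel of width about 1/R already gives Δ(x) = O(1/R) (`exists_abs_deviation_le_of_kernel`). The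
Fourier transform φ of the kernel vanishes for |t| ≥ R/2, so the convolution at x is a constant
times ∫ φ(t) g(it) e^{itx} dt, which sees g only on a bounded piece of the imaginary axis.

Decay comes from moving the contour left to Re s = -d(Im s) inside Ω_M, with d about δ = 1/M(R).
Since φ is not analytic, it is replaced by an almost analytic extension, its Taylor polynomial of
degree N - 1 in the imaginary direction. Stokes' formula (`integral_deform_contour`) then gives the
integral over the moved contour plus an area integral containing only the N-th derivative of φ.
Averaging makes the j-th derivative at most w^{-j} with w = R/(8N). For N about xδ the area term is
exponentially small in N, while the extension costs only e^{d/w}, which replaces x by about x(1 -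
8δ/R). This is `exists_deviation_le_of_contour`.

If M(R)ℓ ≤ x(1 - 9δ/R), the exponential on the moved contour is about e^{-ℓ} or smaller, and e^{-ℓ}
∫ |g| has to be O(1/R). From g ≪ K(R)/(1 + |t|) the integral is ≪ K(R) log R, so ℓ = log R + log log
R + log K(R) suffices; this is M_{K,log}. The factor log R can be saved in two ways. If K is of
positive increase, then g ≪ K(R) R^{-a} (1 + |t|)^{a-1}, whose integral is O(K(R)). If M/log^β is
non-decreasing, the contour can lie farther left at small heights, which gains a factor of order ((1
+ |t|)/R)^{β/2}.

Finally R is chosen in terms of x. For c < 1 the inverse function at cx leaves room for the factor 1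
- 9δ/R. Under regular growth a constant multiple of the inverse function at x is enough
(`isBigO_of_hasGrowth`). -/

noncomputable section

open MeasureTheory

/-! ### Compactly supported cutoffs built by repeated averaging. -/

/-- A bounded measurable function with bound `C` that vanishes outside `[-P, P]`. -/
structure IsCutoff (f : ℝ → ℝ) (P C : ℝ) : Prop where
  meas : Measurable f
  bound : ∀ t, |f t| ≤ C
  supp : ∀ t, P < |t| → f t = 0

/-- The average of `f` over `[t - w, t + w]`. -/
def boxAvg (w : ℝ) (f : ℝ → ℝ) (t : ℝ) : ℝ := (2 * w)⁻¹ * ∫ u in (t - w)..(t + w), f u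

/-- The symmetric difference quotient of `f` with step `w`. -/
def boxDiff (w : ℝ) (f : ℝ → ℝ) (t : ℝ) : ℝ := (2 * w)⁻¹ * (f (t + w) - f (t - w))

namespace IsCutoff

variable {f : ℝ → ℝ} {P C w : ℝ}

theorem integrable (h : IsCutoff f P C) : Integrable f := by
  have : IntegrableOn f (Set.Icc (-P) P) := by
    refine Measure.integrableOn_of_bounded (M := C) (by simp) h.meas.aestronglyMeasurable ?_
    exact Eventually.of_forall fun t => by simpa using h.bound t
  rw [← integrableOn_univ]
  refine this.of_forall_sdiff_eq_zero MeasurableSet.univ fun t ht => h.supp t ?_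
  by_contra hc
  exact ht.2 (abs_le.1 (not_lt.1 hc))

theorem continuous_boxAvg (h : IsCutoff f P C) : Continuous (boxAvg w f) := by
  have hi : ∀ a b : ℝ, IntervalIntegrable f volume a b := fun a b =>
    h.integrable.intervalIntegrable
  have : boxAvg w f = fun t => (2 * w)⁻¹ *
      ((∫ u in (0 : ℝ)..(t + w), f u) - ∫ u in (0 : ℝ)..(t - w), f u) := by
    funext t
    rw [boxAvg, intervalIntegral.integral_interval_sub_left (hi _ _) (hi _ _)]
  rw [this]
  have hc : Continuous fun b => ∫ u in (0 : ℝ)..b, f u :=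
    intervalIntegral.continuous_primitive hi 0
  fun_prop

/-- The fundamental theorem of calculus. Trading one average for one difference quotient per
derivative is what gives the j-th derivative the bound `w⁻¹ ^ j`, with no factorial loss. -/
theorem hasDerivAt_boxAvg (hf : Continuous f) (t : ℝ) :
    HasDerivAt (boxAvg w f) (boxDiff w f t) t := by
  have hi : ∀ a b : ℝ, IntervalIntegrable f volume a b := fun a b => hf.intervalIntegrable a b
  have : boxAvg w f = fun t => (2 * w)⁻¹ *
      ((∫ u in (0 : ℝ)..(t + w), f u) - ∫ u in (0 : ℝ)..(t - w), f u) := by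
    funext t
    rw [boxAvg, intervalIntegral.integral_interval_sub_left (hi _ _) (hi _ _)]
  rw [this]
  have hd : ∀ b, HasDerivAt (fun b => ∫ u in (0 : ℝ)..b, f u) (f b) b := fun b =>
    intervalIntegral.integral_hasDerivAt_right (hi _ _)
      (hf.stronglyMeasurableAtFilter _ _) hf.continuousAt
  exact (((hd (t + w)).comp_add_const t w).sub ((hd (t - w)).comp_sub_const t w)).const_mul _

theorem boxAvg (h : IsCutoff f P C) (hw : 0 < w) : IsCutoff (boxAvg w f) (P + w) C where
  meas := h.continuous_boxAvg.measurable
  bound t := by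
    have h1 : ‖∫ u in (t - w)..(t + w), f u‖ ≤ C * |t + w - (t - w)| :=
      intervalIntegral.norm_integral_le_of_norm_le_const fun u _ => by simpa using h.bound u
    rw [show t + w - (t - w) = 2 * w by ring, abs_of_pos (by positivity), Real.norm_eq_abs] at h1
    rw [_root_.boxAvg, abs_mul, abs_of_pos (by positivity), inv_mul_le_iff₀ (by positivity)]
    linarith
  supp t ht := by
    have : ∫ u in (t - w)..(t + w), f u = 0 := by
      refine intervalIntegral.integral_zero_ae (Eventually.of_forall fun u hu => h.supp u ?_)
      rw [Set.uIoc_of_le (by linarith)] at hu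
      rcases lt_abs.1 ht with h1 | h1
      · exact lt_abs.2 (Or.inl (by linarith [hu.1]))
      · exact lt_abs.2 (Or.inr (by linarith [hu.2]))
    rw [_root_.boxAvg, this, mul_zero]

theorem boxDiff (h : IsCutoff f P C) (hw : 0 < w) : IsCutoff (boxDiff w f) (P + w) (w⁻¹ * C) where
  meas := by
    have := h.meas
    unfold _root_.boxDiff
    fun_prop
  bound t := by
    rw [_root_.boxDiff, abs_mul, abs_of_pos (by positivity), mul_inv]
    have := abs_sub (f (t + w)) (f (t - w))
    have h1 := h.bound (t + w)
    have h2 := h.bound (t - w)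
    have : |f (t + w) - f (t - w)| ≤ 2 * C := by linarith
    calc (2 : ℝ)⁻¹ * w⁻¹ * |f (t + w) - f (t - w)| ≤ (2 : ℝ)⁻¹ * w⁻¹ * (2 * C) := by gcongr
      _ = w⁻¹ * C := by ring
  supp t ht := by
    have h1 : f (t + w) = 0 := h.supp _ <| by
      rcases lt_abs.1 ht with h1 | h1
      · exact lt_abs.2 (Or.inl (by linarith))
      · exact lt_abs.2 (Or.inr (by linarith))
    have h2 : f (t - w) = 0 := h.supp _ <| by
      rcases lt_abs.1 ht with h1 | h1
      · exact lt_abs.2 (Or.inl (by linarith))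
      · exact lt_abs.2 (Or.inr (by linarith))
    simp [_root_.boxDiff, h1, h2]

theorem iterate_boxAvg (h : IsCutoff f P C) (hw : 0 < w) (n : ℕ) :
    IsCutoff ((_root_.boxAvg w)^[n] f) (P + n * w) C := by
  induction n with
  | zero => simpa using h
  | succ n ih =>
    rw [Function.iterate_succ_apply']
    convert ih.boxAvg hw using 1
    push_cast
    ring

theorem iterate_boxDiff (h : IsCutoff f P C) (hw : 0 < w) (n : ℕ) :
    IsCutoff ((_root_.boxDiff w)^[n] f) (P + n * w) (w⁻¹ ^ n * C) := by
  induction n with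
  | zero => simpa using h
  | succ n ih =>
    rw [Function.iterate_succ_apply']
    convert ih.boxDiff hw using 1
    · push_cast
      ring
    · ring

theorem continuous_iterate_boxAvg (h : IsCutoff f P C) (hw : 0 < w) (hf : Continuous f) (n : ℕ) :
    Continuous ((_root_.boxAvg w)^[n] f) := by
  cases n with
  | zero => simpa using hf
  | succ n =>
    rw [Function.iterate_succ_apply']
    exact (h.iterate_boxAvg hw n).continuous_boxAvg

end IsCutoff

theorem continuous_iterate_boxDiff {f : ℝ → ℝ} (hf : Continuous f) (w : ℝ) (n : ℕ) :
    Continuous ((boxDiff w)^[n] f) := by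
  induction n with
  | zero => simpa using hf
  | succ n ih =>
    rw [Function.iterate_succ_apply']
    unfold boxDiff at ih ⊢
    fun_prop

theorem hasDerivAt_iterate_boxDiff {f f' : ℝ → ℝ} (hf : ∀ t, HasDerivAt f (f' t) t) (w : ℝ)
    (n : ℕ) (t : ℝ) : HasDerivAt ((boxDiff w)^[n] f) ((boxDiff w)^[n] f' t) t := by
  induction n generalizing t with
  | zero => simpa using hf t
  | succ n ih =>
    rw [Function.iterate_succ_apply', Function.iterate_succ_apply']
    exact (((ih (t + w)).comp_add_const t w).sub ((ih (t - w)).comp_sub_const t w)).const_mul _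

/-! ### Fourier transforms of the cutoffs. -/

/-- The Fourier integral `∫ f(t) e^{ity} dt`. -/
def fourierInt (f : ℝ → ℝ) (y : ℝ) : ℂ := ∫ t : ℝ, (f t : ℂ) * Complex.exp (t * y * Complex.I)

theorem integral_exp_mul_I_symm (w y : ℝ) :
    ∫ u in (-w)..w, Complex.exp (-(u * y * Complex.I)) = 2 * w * (Real.sinc (w * y) : ℂ) := by
  rcases eq_or_ne w 0 with rfl | hw
  · simp
  rcases eq_or_ne y 0 with rfl | hy
  · simp
    ring
  have hc : (-(y : ℂ) * Complex.I) ≠ 0 := by simp [hy]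
  have h1 : ∀ u : ℝ, Complex.exp (-(u * y * Complex.I)) = Complex.exp ((-(y : ℂ) * Complex.I) * u) :=
    fun u => by congr 1; ring
  simp only [h1]
  rw [integral_exp_mul_complex hc, Real.sinc_of_ne_zero (by positivity)]
  push_cast
  rw [Complex.sin]
  have hy' : (y : ℂ) ≠ 0 := by exact_mod_cast hy
  have hw' : (w : ℂ) ≠ 0 := by exact_mod_cast hw
  have e1 : -(y : ℂ) * Complex.I * w = -(w * y) * Complex.I := by ring
  have e2 : -(y : ℂ) * Complex.I * -w = (w * y) * Complex.I := by ring
  rw [e1, e2]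
  field_simp
  rw [Complex.I_sq]
  ring

/-- Averaging is convolution with the normalised indicator of [-w, w], whose transform is `sinc (w
y)`; the proof is Fubini and translation invariance. -/
theorem IsCutoff.fourierInt_boxAvg {f : ℝ → ℝ} {P C w : ℝ} (h : IsCutoff f P C) (hw : 0 < w)
    (y : ℝ) : fourierInt (_root_.boxAvg w f) y = (Real.sinc (w * y) : ℂ) * fourierInt f y := by
  have hmf := h.meas
  have hi : Integrable (fun p : ℝ × ℝ => (f (p.1 + p.2) : ℂ) * Complex.exp (p.1 * y * Complex.I))
      (volume.prod (volume.restrict (Set.Ioc (-w) w))) := by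
    have hm : Measurable fun p : ℝ × ℝ => (f (p.1 + p.2) : ℂ) * Complex.exp (p.1 * y * Complex.I) := by
      fun_prop
    rw [integrable_prod_iff' hm.aestronglyMeasurable]
    have hn : ∀ x u : ℝ, ‖(f (x + u) : ℂ) * Complex.exp (x * y * Complex.I)‖ = ‖f (x + u)‖ := by
      intro x u
      rw [norm_mul, show (x : ℂ) * y = ((x * y : ℝ) : ℂ) by push_cast; ring,
        Complex.norm_exp_ofReal_mul_I, mul_one, Complex.norm_real]
    constructor
    · refine Eventually.of_forall fun u => ?_
      refine (h.integrable.comp_add_right u).norm.mono' (by fun_prop) ?_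
      exact Eventually.of_forall fun x => (hn x u).le
    · simp only [hn]
      have : ∀ u : ℝ, ∫ x, ‖f (x + u)‖ = ∫ x, ‖f x‖ := fun u =>
        integral_add_right_eq_self (fun x => ‖f x‖) u
      simp only [this]
      exact integrable_const _
  have h1 : ∀ t : ℝ, (_root_.boxAvg w f t : ℂ) * Complex.exp (t * y * Complex.I) =
      (2 * w : ℂ)⁻¹ * ∫ u in Set.Ioc (-w) w, (f (t + u) : ℂ) * Complex.exp (t * y * Complex.I) := by
    intro t
    have : ∫ u in (t - w)..(t + w), f u = ∫ u in (-w)..w, f (t + u) := by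
      rw [intervalIntegral.integral_comp_add_left]
      rfl
    rw [_root_.boxAvg, this, integral_mul_const, ← intervalIntegral.integral_of_le (by linarith)]
    push_cast
    rw [← intervalIntegral.integral_ofReal, mul_assoc]
  have h2 : ∀ u : ℝ, ∫ t, (f (t + u) : ℂ) * Complex.exp (t * y * Complex.I) =
      Complex.exp (-(u * y * Complex.I)) * fourierInt f y := by
    intro u
    rw [fourierInt, ← integral_const_mul, ← integral_add_right_eq_self
      (fun t : ℝ => Complex.exp (-(u * y * Complex.I)) * ((f t : ℂ) * Complex.exp (t * y * Complex.I))) u]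
    congr 1
    funext t
    rw [mul_left_comm, ← Complex.exp_add]
    congr 2
    push_cast
    ring
  rw [fourierInt]
  simp only [h1]
  rw [integral_const_mul, integral_integral_swap hi]
  simp only [h2]
  rw [integral_mul_const, ← intervalIntegral.integral_of_le (by linarith), integral_exp_mul_I_symm]
  have hw' : (w : ℂ) ≠ 0 := by exact_mod_cast hw.ne'
  field_simp

theorem isCutoff_indicator (v : ℝ) : IsCutoff (Set.indicator (Set.Icc (-v) v) 1) v 1 where
  meas := measurable_one.indicator measurableSet_Icc
  bound t := by
    by_cases ht : t ∈ Set.Icc (-v) v <;> simp [ht]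
  supp t ht := by
    refine Set.indicator_of_notMem (fun h => ?_) _
    exact absurd (abs_le.2 h) (not_le.2 ht)

theorem fourierInt_indicator {v : ℝ} (hv : 0 < v) (y : ℝ) :
    fourierInt (Set.indicator (Set.Icc (-v) v) 1) y = 2 * v * (Real.sinc (v * y) : ℂ) := by
  have h1 : ∀ t : ℝ, ((Set.indicator (Set.Icc (-v) v) 1 t : ℝ) : ℂ) * Complex.exp (t * y * Complex.I)
      = Set.indicator (Set.Icc (-v) v) (fun t : ℝ => Complex.exp (t * y * Complex.I)) t := by
    intro t
    by_cases ht : t ∈ Set.Icc (-v) v <;> simp [ht]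
  rw [fourierInt]
  simp only [h1]
  rw [integral_indicator measurableSet_Icc, integral_Icc_eq_integral_Ioc,
    ← intervalIntegral.integral_of_le (by linarith)]
  have := integral_exp_mul_I_symm v (-y)
  rw [mul_neg, Real.sinc_neg] at this
  rw [← this]
  congr 1
  funext t
  congr 1
  push_cast
  ring

/-- The `j`-th derivative (for `j ≤ N`) of the cutoff obtained from the indicator function of
`[-v, v]` by averaging three times at scale `v` and `N` times at scale `w`. -/
def cutoff (v w : ℝ) (N j : ℕ) : ℝ → ℝ :=
  (boxDiff w)^[j] ((boxAvg w)^[N - j] ((boxAvg v)^[3] (Set.indicator (Set.Icc (-v) v) 1)))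

theorem isCutoff_base {v : ℝ} (hv : 0 < v) :
    IsCutoff ((boxAvg v)^[3] (Set.indicator (Set.Icc (-v) v) 1)) (4 * v) 1 := by
  convert (isCutoff_indicator v).iterate_boxAvg hv 3 using 1
  push_cast
  ring

theorem continuous_base {v : ℝ} (hv : 0 < v) :
    Continuous ((boxAvg v)^[3] (Set.indicator (Set.Icc (-v) v) 1)) := by
  rw [Function.iterate_succ_apply']
  exact ((isCutoff_indicator v).iterate_boxAvg hv 2).continuous_boxAvg

/-- Averages and difference quotients both widen the support by `w`, so the support radius is the
same for every derivative order `j`. -/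
theorem isCutoff_cutoff {v w : ℝ} (hv : 0 < v) (hw : 0 < w) (N : ℕ) {j : ℕ} (hj : j ≤ N) :
    IsCutoff (cutoff v w N j) (4 * v + N * w) (w⁻¹ ^ j) := by
  have h := ((isCutoff_base hv).iterate_boxAvg hw (N - j)).iterate_boxDiff hw j
  rw [Nat.cast_sub hj, mul_one, show 4 * v + ((N : ℝ) - j) * w + j * w = 4 * v + N * w by ring] at h
  exact h

theorem continuous_cutoff {v w : ℝ} (hv : 0 < v) (hw : 0 < w) (N : ℕ) (j : ℕ) : Continuous (cutoff v w N j) :=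
  continuous_iterate_boxDiff
    ((isCutoff_base hv).continuous_iterate_boxAvg hw (continuous_base hv) _) w j

theorem hasDerivAt_cutoff {v w : ℝ} (hv : 0 < v) (hw : 0 < w) (N : ℕ) {j : ℕ} (hj : j < N) (t : ℝ) :
    HasDerivAt (cutoff v w N j) (cutoff v w N (j + 1) t) t := by
  obtain ⟨k, rfl⟩ : ∃ k, N = j + 1 + k := ⟨N - (j + 1), by omega⟩
  have h1 : j + 1 + k - j = k + 1 := by omega
  have h2 : j + 1 + k - (j + 1) = k := by omega
  rw [cutoff, cutoff, h1, h2, Function.iterate_succ_apply (boxDiff w)]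
  refine hasDerivAt_iterate_boxDiff (fun t => ?_) w j t
  rw [Function.iterate_succ_apply' (boxAvg w)]
  exact IsCutoff.hasDerivAt_boxAvg
    ((isCutoff_base hv).continuous_iterate_boxAvg hw (continuous_base hv) _) t

theorem IsCutoff.fourierInt_iterate_boxAvg {f : ℝ → ℝ} {P C w : ℝ} (h : IsCutoff f P C)
    (hw : 0 < w) (n : ℕ) (y : ℝ) :
    fourierInt ((_root_.boxAvg w)^[n] f) y = (Real.sinc (w * y) : ℂ) ^ n * fourierInt f y := by
  induction n with
  | zero => simp
  | succ n ih =>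
    rw [Function.iterate_succ_apply', (h.iterate_boxAvg hw n).fourierInt_boxAvg hw, ih]
    ring

theorem fourierInt_cutoff {v w : ℝ} (hv : 0 < v) (hw : 0 < w) (N : ℕ) (y : ℝ) :
    fourierInt (cutoff v w N 0) y =
      ((2 * v * (Real.sinc (v * y) ^ 4 * Real.sinc (w * y) ^ N) : ℝ) : ℂ) := by
  have h3 := (isCutoff_indicator v).fourierInt_iterate_boxAvg hv 3 y
  have h4 := (isCutoff_base hv).fourierInt_iterate_boxAvg hw N y
  rw [h3, fourierInt_indicator hv] at h4
  change fourierInt ((boxAvg w)^[N] _) y = _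
  rw [h4]
  push_cast
  ring

theorem one_add_sq_mul_sinc_sq_le (z : ℝ) : (1 + z ^ 2) * Real.sinc z ^ 2 ≤ 2 := by
  have h1 : Real.sinc z ^ 2 ≤ 1 := by
    rw [← sq_abs]
    exact pow_le_one₀ (abs_nonneg _) (Real.abs_sinc_le_one z)
  have h2 : z ^ 2 * Real.sinc z ^ 2 ≤ 1 := by
    rcases eq_or_ne z 0 with rfl | hz
    · simp
    · rw [Real.sinc_of_ne_zero hz, ← mul_pow, mul_div_cancel₀ _ hz]
      exact Real.sin_sq_le_one z
  linarith

theorem sinc_four_le (z : ℝ) : Real.sinc z ^ 4 ≤ 4 * ((1 + z ^ 2) ^ 2)⁻¹ := by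
  have h := one_add_sq_mul_sinc_sq_le z
  rw [← div_eq_mul_inv, le_div_iff₀ (by positivity)]
  calc Real.sinc z ^ 4 * (1 + z ^ 2) ^ 2 = ((1 + z ^ 2) * Real.sinc z ^ 2) ^ 2 := by ring
    _ ≤ 2 ^ 2 := by gcongr
    _ = 4 := by norm_num

theorem one_sub_sq_div_four_le_sinc {z : ℝ} (hz : |z| ≤ 1) : 1 - z ^ 2 / 4 ≤ Real.sinc z := by
  wlog h : 0 ≤ z generalizing z
  · have := this (z := -z) (by simpa using hz) (by linarith)
    simpa using this
  rcases h.eq_or_lt with rfl | h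
  · simp
  rw [Real.sinc_of_ne_zero h.ne', le_div_iff₀ h]
  have := Real.sin_gt_sub_cube h
  nlinarith [pow_pos h 3]

/-! ### The smoothing kernel: mass, first moment and lower bound near 0. -/

/-- The non-negative kernel whose Fourier transform is the compactly supported `cutoff v w N 0`. -/
def kernel (v w : ℝ) (N : ℕ) (y : ℝ) : ℝ :=
  v / Real.pi * (Real.sinc (v * y) ^ 4 * Real.sinc (w * y) ^ N)

theorem fourierInt_cutoff_eq_kernel {v w : ℝ} (hv : 0 < v) (hw : 0 < w) (N : ℕ) (y : ℝ) :
    fourierInt (cutoff v w N 0) y = ((2 * Real.pi * kernel v w N y : ℝ) : ℂ) := by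
  rw [fourierInt_cutoff hv hw, kernel]
  congr 1
  have := Real.pi_pos
  field_simp

theorem continuous_kernel (v w : ℝ) (N : ℕ) : Continuous (kernel v w N) := by
  have := Real.continuous_sinc
  unfold kernel
  fun_prop

theorem integral_inv_one_add_mul_sq {v : ℝ} (hv : 0 < v) :
    ∫ y : ℝ, (1 + (v * y) ^ 2)⁻¹ = v⁻¹ * Real.pi := by
  rw [Measure.integral_comp_mul_left (fun y : ℝ => (1 + y ^ 2)⁻¹) v, integral_univ_inv_one_add_sq,
    abs_of_pos (by positivity), smul_eq_mul]

theorem integrable_inv_one_add_mul_sq {v : ℝ} (hv : 0 < v) :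
    Integrable fun y : ℝ => (1 + (v * y) ^ 2)⁻¹ :=
  integrable_inv_one_add_sq.comp_mul_left' hv.ne'

section

variable {v w : ℝ} {N : ℕ}

theorem kernel_nonneg (hv : 0 < v) (hN : Even N) (y : ℝ) : 0 ≤ kernel v w N y := by
  have h1 : 0 ≤ Real.sinc (v * y) ^ 4 := by positivity
  have h2 : 0 ≤ Real.sinc (w * y) ^ N := hN.pow_nonneg _
  have := Real.pi_pos
  unfold kernel
  positivity

/-- The N factors `sinc (w y)` are only bounded by 1. The four factors `sinc (v y)` supply decay of
order y^{-4}, enough for a finite first moment; this is why `cutoff` averages an indicator three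
times at scale `v`. -/
theorem kernel_le (hv : 0 < v) (y : ℝ) :
    kernel v w N y ≤ v / Real.pi * (4 * ((1 + (v * y) ^ 2) ^ 2)⁻¹) := by
  have hpi := Real.pi_pos
  have h1 : Real.sinc (w * y) ^ N ≤ 1 := (le_abs_self _).trans <| by
    rw [abs_pow]
    exact pow_le_one₀ (abs_nonneg _) (Real.abs_sinc_le_one _)
  have h2 : Real.sinc (v * y) ^ 4 * Real.sinc (w * y) ^ N ≤ Real.sinc (v * y) ^ 4 :=
    mul_le_of_le_one_right (by positivity) h1
  exact mul_le_mul_of_nonneg_left (h2.trans (sinc_four_le _)) (by positivity)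

theorem kernel_le' (hv : 0 < v) (y : ℝ) :
    kernel v w N y ≤ v / Real.pi * (4 * (1 + (v * y) ^ 2)⁻¹) := by
  have hpi := Real.pi_pos
  refine (kernel_le hv y).trans ?_
  gcongr
  exact le_self_pow₀ (by nlinarith [sq_nonneg (v * y)]) two_ne_zero

theorem abs_mul_kernel_le (hv : 0 < v) (y : ℝ) :
    |y| * kernel v w N y ≤ 2 / Real.pi * (1 + (v * y) ^ 2)⁻¹ := by
  have hpi := Real.pi_pos
  have h0 : 2 * (v * |y|) ≤ 1 + (v * y) ^ 2 := by
    have : (v * y) ^ 2 = (v * |y|) ^ 2 := by rw [mul_pow, mul_pow, sq_abs]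
    nlinarith [sq_nonneg (v * |y| - 1)]
  calc |y| * kernel v w N y ≤ |y| * (v / Real.pi * (4 * ((1 + (v * y) ^ 2) ^ 2)⁻¹)) := by
        gcongr
        exact kernel_le hv y
    _ = 2 / Real.pi * (2 * (v * |y|)) * ((1 + (v * y) ^ 2) ^ 2)⁻¹ := by ring
    _ ≤ 2 / Real.pi * (1 + (v * y) ^ 2) * ((1 + (v * y) ^ 2) ^ 2)⁻¹ := by gcongr
    _ = 2 / Real.pi * (1 + (v * y) ^ 2)⁻¹ := by
      have : 0 < 1 + (v * y) ^ 2 := by positivity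
      field_simp

theorem integrable_kernel (hv : 0 < v) (hN : Even N) : Integrable (kernel v w N) := by
  refine (((integrable_inv_one_add_mul_sq hv).const_mul 4).const_mul (v / Real.pi)).mono'
    (continuous_kernel v w N).aestronglyMeasurable (Eventually.of_forall fun y => ?_)
  rw [Real.norm_of_nonneg (kernel_nonneg hv hN y)]
  exact kernel_le' hv y

theorem integral_kernel_le (hv : 0 < v) (hN : Even N) : ∫ y, kernel v w N y ≤ 4 := by
  have hpi := Real.pi_pos
  calc ∫ y, kernel v w N y ≤ ∫ y, v / Real.pi * (4 * (1 + (v * y) ^ 2)⁻¹) :=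
        integral_mono (integrable_kernel hv hN)
          (((integrable_inv_one_add_mul_sq hv).const_mul 4).const_mul (v / Real.pi))
          fun y => kernel_le' hv y
    _ = 4 := by
      rw [integral_const_mul, integral_const_mul, integral_inv_one_add_mul_sq hv]
      field_simp

theorem integrable_abs_mul_kernel (hv : 0 < v) (hN : Even N) :
    Integrable fun y => |y| * kernel v w N y := by
  refine ((integrable_inv_one_add_mul_sq hv).const_mul (2 / Real.pi)).mono'
    (continuous_abs.mul (continuous_kernel v w N)).aestronglyMeasurable
    (Eventually.of_forall fun y => ?_)
  rw [Real.norm_of_nonneg (mul_nonneg (abs_nonneg _) (kernel_nonneg hv hN y))]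
  exact abs_mul_kernel_le hv y

theorem integral_abs_mul_kernel_le (hv : 0 < v) (hN : Even N) :
    ∫ y, |y| * kernel v w N y ≤ 2 / v := by
  have hpi := Real.pi_pos
  calc ∫ y, |y| * kernel v w N y ≤ ∫ y, 2 / Real.pi * (1 + (v * y) ^ 2)⁻¹ :=
        integral_mono (integrable_abs_mul_kernel hv hN)
          ((integrable_inv_one_add_mul_sq hv).const_mul (2 / Real.pi))
          fun y => abs_mul_kernel_le hv y
    _ = 2 / v := by
      rw [integral_const_mul, integral_inv_one_add_mul_sq hv]
      field_simp

/-- For |y| ≤ 1/v the relation w N = 2v forces |w y| ≤ 2/N, hence `sinc (w y)` ≥ 1 - 1/N², and by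
Bernoulli its N-th power is at least 1 - 1/N ≥ 7/8. So a large number of averages does not destroy
the size of the kernel near 0. -/
theorem le_kernel (hv : 0 < v) (hw : 0 < w) (hwv : w * N = 2 * v) (hN : 8 ≤ N) {y : ℝ}
    (hy : v * |y| ≤ 1) : v / 32 ≤ kernel v w N y := by
  have hN' : (8 : ℝ) ≤ N := by exact_mod_cast hN
  have hpi := Real.pi_pos
  have hv1 : |v * y| ≤ 1 := by rwa [abs_mul, abs_of_pos hv]
  have hwy : N * |w * y| ≤ 2 := by
    rw [abs_mul, abs_of_pos hw]
    calc N * (w * |y|) = 2 * (v * |y|) := by rw [← mul_assoc, mul_comm (N : ℝ) w, hwv]; ring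
      _ ≤ 2 := by linarith
  have hw1 : |w * y| ≤ 2 / N := by
    rw [le_div_iff₀ (by positivity)]
    linarith
  have hw2 : (w * y) ^ 2 ≤ (2 / N) ^ 2 := by
    rw [← sq_abs]
    gcongr
  have h1 : (3 / 4 : ℝ) ≤ Real.sinc (v * y) := by
    have := one_sub_sq_div_four_le_sinc hv1
    have : (v * y) ^ 2 ≤ 1 := by
      rw [← sq_abs]
      exact pow_le_one₀ (abs_nonneg _) hv1
    linarith
  have hNi : (N : ℝ)⁻¹ ≤ 1 / 8 := by
    rw [inv_le_comm₀ (by positivity) (by norm_num)]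
    linarith
  have h2 : 1 - ((N : ℝ)⁻¹) ^ 2 ≤ Real.sinc (w * y) := by
    have hw3 : |w * y| ≤ 1 := hw1.trans (by rw [div_le_one (by positivity)]; linarith)
    have := one_sub_sq_div_four_le_sinc hw3
    have h3 : (2 / (N : ℝ)) ^ 2 = 4 * ((N : ℝ)⁻¹) ^ 2 := by ring
    linarith
  have h3 : (7 / 8 : ℝ) ≤ Real.sinc (w * y) ^ N := by
    have hb : (0 : ℝ) ≤ 1 - ((N : ℝ)⁻¹) ^ 2 := by nlinarith [inv_pos.2 (by linarith : (0 : ℝ) < N)]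
    have h4 := one_add_mul_le_pow (a := -((N : ℝ)⁻¹) ^ 2) (by linarith) N
    have h5 : (N : ℝ) * -((N : ℝ)⁻¹) ^ 2 = -(N : ℝ)⁻¹ := by field_simp
    calc (7 / 8 : ℝ) ≤ (1 + -((N : ℝ)⁻¹) ^ 2) ^ N := by linarith
      _ = (1 - ((N : ℝ)⁻¹) ^ 2) ^ N := by rw [← sub_eq_add_neg]
      _ ≤ _ := by gcongr
  have h4 : (3 / 4 : ℝ) ^ 4 ≤ Real.sinc (v * y) ^ 4 := by gcongr
  have hpi4 := Real.pi_le_four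
  calc v / 32 = v / 4 * (1 / 8) := by ring
    _ ≤ v / Real.pi * ((3 / 4) ^ 4 * (7 / 8)) := by
      gcongr
      norm_num
    _ ≤ kernel v w N y := by
      unfold kernel
      gcongr

end

/-! ### Almost analytic extension and deformation of the contour. -/

/-- The real-linear map `ℝ × ℝ → ℂ` with `(1, 0) ↦ a` and `(0, 1) ↦ b`. -/
def linComb (a b : ℂ) : ℝ × ℝ →L[ℝ] ℂ :=
  (ContinuousLinearMap.fst ℝ ℝ ℝ).smulRight a + (ContinuousLinearMap.snd ℝ ℝ ℝ).smulRight b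

theorem linComb_apply (a b : ℂ) (p : ℝ × ℝ) : linComb a b p = p.1 * a + p.2 * b := by
  simp [linComb]

/-- `X` is differentiable at `p` with partial derivatives `a` and `b`. -/
def HasPartials (X : ℝ × ℝ → ℂ) (a b : ℂ) (p : ℝ × ℝ) : Prop := HasFDerivAt X (linComb a b) p

namespace HasPartials

variable {X Y : ℝ × ℝ → ℂ} {a b a' b' : ℂ} {p : ℝ × ℝ}

theorem of_fst {f : ℝ → ℝ} {f' : ℝ} (h : HasDerivAt f f' p.1) :
    HasPartials (fun p => (f p.1 : ℂ)) f' 0 p := by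
  have h1 : HasFDerivAt (fun p : ℝ × ℝ => (f p.1 : ℂ)) _ p :=
    h.ofReal_comp.hasFDerivAt.comp p hasFDerivAt_fst
  refine h1.congr_fderiv ?_
  ext <;> simp [linComb_apply]

theorem fst : HasPartials (fun p => (p.1 : ℂ)) 1 0 p := by
  simpa using of_fst (hasDerivAt_id p.1)

theorem snd : HasPartials (fun p => (p.2 : ℂ)) 0 1 p := by
  have h1 : HasFDerivAt (fun p : ℝ × ℝ => (p.2 : ℂ)) _ p :=
    (hasDerivAt_id p.2).ofReal_comp.hasFDerivAt.comp p hasFDerivAt_snd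
  refine h1.congr_fderiv ?_
  ext <;> simp [linComb_apply]

theorem const (c : ℂ) : HasPartials (fun _ => c) 0 0 p := by
  refine (hasFDerivAt_const c p).congr_fderiv ?_
  ext <;> simp [linComb_apply]

theorem mul (hX : HasPartials X a b p) (hY : HasPartials Y a' b' p) :
    HasPartials (fun p => X p * Y p) (a * Y p + X p * a') (b * Y p + X p * b') p := by
  refine (HasFDerivAt.mul hX hY).congr_fderiv ?_
  ext <;> simp [linComb_apply] <;> ring

theorem sub (hX : HasPartials X a b p) (hY : HasPartials Y a' b' p) :
    HasPartials (fun p => X p - Y p) (a - a') (b - b') p := by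
  refine (HasFDerivAt.fun_sub hX hY).congr_fderiv ?_
  ext <;> simp [linComb_apply]

theorem sum {n : ℕ} {X : ℕ → ℝ × ℝ → ℂ} {a b : ℕ → ℂ}
    (h : ∀ j < n, HasPartials (X j) (a j) (b j) p) :
    HasPartials (fun p => ∑ j ∈ Finset.range n, X j p) (∑ j ∈ Finset.range n, a j)
      (∑ j ∈ Finset.range n, b j) p := by
  refine (HasFDerivAt.fun_sum fun j hj => h j (Finset.mem_range.1 hj)).congr_fderiv ?_
  ext <;> simp [linComb_apply]

theorem comp {F : ℂ → ℂ} {F' : ℂ} (hF : HasDerivAt F F' (X p)) (hX : HasPartials X a b p) :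
    HasPartials (fun p => F (X p)) (F' * a) (F' * b) p := by
  have h1 : HasFDerivAt (fun p => F (X p)) _ p :=
    (hF.hasFDerivAt.restrictScalars ℝ).comp p (show HasFDerivAt X _ p from hX)
  refine h1.congr_fderiv ?_
  ext <;> simp [linComb_apply, mul_comm]

end HasPartials

/-- The almost analytic extension `∑_{j < N} φ_j(t) (iy)^j / j!`. -/
def almostAnalytic (φ : ℕ → ℝ → ℝ) (N : ℕ) (t : ℝ) (y : ℂ) : ℂ :=
  ∑ j ∈ Finset.range N, (φ j t : ℂ) * ((Complex.I * y) ^ j / (j.factorial : ℂ))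

/-- The ∂̄-derivative telescopes: differentiating the j-th term in `t` cancels the vertical
derivative of the (j+1)-st, and only the top derivative survives. The truncated `j - 1` at `j = 0`
is harmless because of the factor `j`. -/
theorem almostAnalytic_dbar (a : ℕ → ℂ) (z : ℂ) (n : ℕ) :
    (∑ j ∈ Finset.range (n + 1), a (j + 1) * (z ^ j / (j.factorial : ℂ))) +
      Complex.I * ∑ j ∈ Finset.range (n + 1),
        a j * (j * z ^ (j - 1) * Complex.I / (j.factorial : ℂ)) =
      a (n + 1) * (z ^ n / (n.factorial : ℂ)) := by
  induction n with
  | zero => simp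
  | succ n ih =>
    rw [Finset.sum_range_succ, Finset.sum_range_succ _ (n + 1), mul_add]
    have hf : ((n + 1).factorial : ℂ) = (n + 1) * (n.factorial : ℂ) := by
      rw [Nat.factorial_succ]
      push_cast
      ring
    have h0 : (n.factorial : ℂ) ≠ 0 := by exact_mod_cast n.factorial_ne_zero
    have h1 : (n + 1 : ℂ) ≠ 0 := by exact_mod_cast n.succ_ne_zero
    have h2 : Complex.I * (a (n + 1) * (((n + 1 : ℕ) : ℂ) * z ^ (n + 1 - 1) * Complex.I /
        ((n + 1).factorial : ℂ))) = -(a (n + 1) * (z ^ n / (n.factorial : ℂ))) := by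
      rw [hf, Nat.add_sub_cancel]
      push_cast
      field_simp
      rw [Complex.I_sq]
      ring
    rw [h2]
    linear_combination ih

/-- Stokes' formula for F Φ dz, with Φ the almost analytic extension, pulled back to [-P, P] × [0,
1] by (t, θ) ↦ it - θ d(t). The derivatives of F cancel by holomorphy and leave ∂̄Φ alone; the
lateral edges vanish since φ_j(±P) = 0. -/
theorem integral_deform_contour {F : ℂ → ℂ} {U : Set ℂ} (hU : IsOpen U)
    (hF : DifferentiableOn ℂ F U) {d d' d'' : ℝ → ℝ} (hd : ∀ t, HasDerivAt d (d' t) t)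
    (hd' : ∀ t, HasDerivAt d' (d'' t) t) {n : ℕ} {φ : ℕ → ℝ → ℝ}
    (hφ : ∀ j < n + 1, ∀ t, HasDerivAt (φ j) (φ (j + 1) t) t) (hφc : ∀ j, Continuous (φ j))
    {P : ℝ} (hP : 0 ≤ P) (hφ0 : ∀ j < n + 1, φ j P = 0 ∧ φ j (-P) = 0)
    (hpath : ∀ t ∈ Set.Icc (-P) P, ∀ θ ∈ Set.Icc (0 : ℝ) 1,
      (Complex.I * t - θ * d t : ℂ) ∈ U) :
    (∫ t in (-P)..P, ∫ θ in (0 : ℝ)..1, (d t : ℂ) * F (Complex.I * t - θ * d t) *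
      (φ (n + 1) t * ((Complex.I * (θ * d t)) ^ n / (n.factorial : ℂ)))) =
    (∫ t in (-P)..P, F (Complex.I * t - d t) * almostAnalytic φ (n + 1) t (d t) *
      (Complex.I - d' t)) - ∫ t in (-P)..P, F (Complex.I * t) * φ 0 t * Complex.I := by
  have hdc : Continuous d := continuous_iff_continuousAt.2 fun t => (hd t).continuousAt
  have hdc' : Continuous d' := continuous_iff_continuousAt.2 fun t => (hd' t).continuousAt
  set Z : ℝ × ℝ → ℂ := fun p => Complex.I * p.1 - p.2 * d p.1 with hZ
  set Φ : ℝ × ℝ → ℂ := fun p => almostAnalytic φ (n + 1) p.1 (p.2 * d p.1) with hΦ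
  -- `W` is the partial derivative of `Z` in t, the one in θ being -d. It contains `d'`, which is
  -- why `d` has to be twice differentiable.
  set W : ℝ × ℝ → ℂ := fun p => Complex.I - p.2 * d' p.1 with hW
  have hm : (Set.uIcc (-P) P ×ˢ Set.uIcc (0 : ℝ) 1) = Set.Icc (-P) P ×ˢ Set.Icc (0 : ℝ) 1 := by
    rw [Set.uIcc_of_le (by linarith), Set.uIcc_of_le zero_le_one]
  have hZc : Continuous Z := by fun_prop
  have hΦc : Continuous Φ := by
    simp only [hΦ, almostAnalytic]
    refine continuous_finsetSum _ fun j _ => ?_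
    have := hφc j
    fun_prop
  have hWc : Continuous W := by fun_prop
  have hmaps : Set.MapsTo Z (Set.Icc (-P) P ×ˢ Set.Icc (0 : ℝ) 1) U := fun p hp =>
    hpath p.1 hp.1 p.2 hp.2
  have hFc : ContinuousOn (fun p => F (Z p)) (Set.Icc (-P) P ×ˢ Set.Icc (0 : ℝ) 1) :=
    hF.continuousOn.comp hZc.continuousOn hmaps
  have hdcc : Continuous fun p : ℝ × ℝ => (d p.1 : ℂ) := by fun_prop
  let Et : ℝ × ℝ → ℂ := fun p => ∑ j ∈ Finset.range (n + 1),
    (φ (j + 1) p.1 : ℂ) * ((Complex.I * (p.2 * d p.1)) ^ j / (j.factorial : ℂ))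
  let Ey : ℝ × ℝ → ℂ := fun p => ∑ j ∈ Finset.range (n + 1),
    (φ j p.1 : ℂ) * (j * (Complex.I * (p.2 * d p.1)) ^ (j - 1) * Complex.I / (j.factorial : ℂ))
  have hΦd : ∀ p : ℝ × ℝ, HasPartials Φ (Et p + Ey p * (p.2 * d' p.1)) (Ey p * d p.1) p := by
    intro p
    have hY : HasPartials (fun p : ℝ × ℝ => (p.2 : ℂ) * d p.1) (p.2 * d' p.1) (d p.1) p := by
      simpa using HasPartials.snd.mul (HasPartials.of_fst (hd p.1))
    have hterm : ∀ j < n + 1, HasPartials (fun p : ℝ × ℝ => (φ j p.1 : ℂ) *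
        ((Complex.I * (p.2 * d p.1)) ^ j / (j.factorial : ℂ)))
        ((φ (j + 1) p.1 : ℂ) * ((Complex.I * (p.2 * d p.1)) ^ j / (j.factorial : ℂ)) +
          (φ j p.1 : ℂ) * (j * (Complex.I * (p.2 * d p.1)) ^ (j - 1) * Complex.I /
            (j.factorial : ℂ)) * (p.2 * d' p.1))
        ((φ j p.1 : ℂ) * (j * (Complex.I * (p.2 * d p.1)) ^ (j - 1) * Complex.I /
            (j.factorial : ℂ)) * d p.1) p := by
      intro j hj
      have hpow : HasDerivAt (fun y : ℂ => (Complex.I * y) ^ j / (j.factorial : ℂ))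
          (j * (Complex.I * (p.2 * d p.1)) ^ (j - 1) * Complex.I / (j.factorial : ℂ))
          (p.2 * d p.1) := by
        have := (((hasDerivAt_id ((p.2 : ℂ) * d p.1)).const_mul Complex.I).fun_pow j).div_const
          (j.factorial : ℂ)
        simpa using this
      have h2 := HasPartials.comp (F := fun y : ℂ => (Complex.I * y) ^ j / (j.factorial : ℂ)) hpow hY
      have h3 := (HasPartials.of_fst (hφ j hj p.1)).mul h2
      convert h3 using 1 <;> ring
    have hs := HasPartials.sum hterm
    rw [Finset.sum_add_distrib, ← Finset.sum_mul, ← Finset.sum_mul] at hs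
    exact hs
  have hZd : ∀ p : ℝ × ℝ, HasPartials Z (Complex.I - p.2 * d' p.1) (-d p.1) p := by
    intro p
    have := ((HasPartials.const Complex.I).mul (HasPartials.fst (p := p))).sub
      (HasPartials.snd.mul (HasPartials.of_fst (hd p.1)))
    simpa using this
  have hWd : ∀ p : ℝ × ℝ, HasPartials W (-(p.2 * d'' p.1)) (-d' p.1) p := by
    intro p
    have := (HasPartials.const (p := p) Complex.I).sub
      (HasPartials.snd.mul (HasPartials.of_fst (hd' p.1)))
    simpa using this
  have hFd : ∀ p ∈ Set.Icc (-P) P ×ˢ Set.Icc (0 : ℝ) 1,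
      HasPartials (fun p => F (Z p)) (deriv F (Z p) * (Complex.I - p.2 * d' p.1))
        (deriv F (Z p) * (-d p.1)) p := fun p hp =>
    HasPartials.comp (hF.differentiableAt (hU.mem_nhds (hmaps hp))).hasDerivAt (hZd p)
  have hsub : Set.Ioo (min (-P) P) (max (-P) P) ×ˢ Set.Ioo (min (0 : ℝ) 1) (max 0 1) ⊆
      Set.Icc (-P) P ×ˢ Set.Icc (0 : ℝ) 1 := by
    rw [min_eq_left (by linarith), max_eq_right (by linarith), min_eq_left zero_le_one,
      max_eq_right zero_le_one]
    exact Set.prod_mono Set.Ioo_subset_Icc_self Set.Ioo_subset_Icc_self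
  have hdiv : ∀ p : ℝ × ℝ, Et p + Complex.I * Ey p =
      φ (n + 1) p.1 * ((Complex.I * (p.2 * d p.1)) ^ n / (n.factorial : ℂ)) := fun p =>
    almostAnalytic_dbar (fun j => (φ j p.1 : ℂ)) (Complex.I * (p.2 * d p.1)) n
  have key := integral2_divergence_prod_of_hasFDerivAt
    (fun p => F (Z p) * Φ p * d p.1) (fun p => F (Z p) * Φ p * W p)
    (fun p => linComb
      ((deriv F (Z p) * (Complex.I - p.2 * d' p.1) * Φ p +
        F (Z p) * (Et p + Ey p * (p.2 * d' p.1))) * d p.1 + F (Z p) * Φ p * d' p.1)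
      ((deriv F (Z p) * (-d p.1) * Φ p + F (Z p) * (Ey p * d p.1)) * d p.1 + F (Z p) * Φ p * 0))
    (fun p => linComb
      ((deriv F (Z p) * (Complex.I - p.2 * d' p.1) * Φ p +
        F (Z p) * (Et p + Ey p * (p.2 * d' p.1))) * W p + F (Z p) * Φ p * (-(p.2 * d'' p.1)))
      ((deriv F (Z p) * (-d p.1) * Φ p + F (Z p) * (Ey p * d p.1)) * W p +
        F (Z p) * Φ p * (-d' p.1)))
    (-P) 0 P 1
    (by rw [hm]; exact (hFc.mul hΦc.continuousOn).mul hdcc.continuousOn)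
    (by rw [hm]; exact (hFc.mul hΦc.continuousOn).mul hWc.continuousOn)
    (fun p hp => ((hFd p (hsub hp)).mul (hΦd p)).mul (HasPartials.of_fst (hd p.1)))
    (fun p hp => ((hFd p (hsub hp)).mul (hΦd p)).mul (hWd p))
  have hsimp : ∀ p : ℝ × ℝ,
      linComb
      ((deriv F (Z p) * (Complex.I - p.2 * d' p.1) * Φ p +
        F (Z p) * (Et p + Ey p * (p.2 * d' p.1))) * d p.1 + F (Z p) * Φ p * d' p.1)
      ((deriv F (Z p) * (-d p.1) * Φ p + F (Z p) * (Ey p * d p.1)) * d p.1 + F (Z p) * Φ p * 0)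
        (1, 0) +
      linComb
      ((deriv F (Z p) * (Complex.I - p.2 * d' p.1) * Φ p +
        F (Z p) * (Et p + Ey p * (p.2 * d' p.1))) * W p + F (Z p) * Φ p * (-(p.2 * d'' p.1)))
      ((deriv F (Z p) * (-d p.1) * Φ p + F (Z p) * (Ey p * d p.1)) * W p +
        F (Z p) * Φ p * (-d' p.1)) (0, 1) =
      d p.1 * F (Z p) * (φ (n + 1) p.1 * ((Complex.I * (p.2 * d p.1)) ^ n / (n.factorial : ℂ))) := by
    intro p
    rw [← hdiv p]
    simp only [linComb_apply, hW]
    push_cast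
    ring
  simp only [hsimp] at key
  have hint : IntegrableOn (fun p : ℝ × ℝ => (d p.1 : ℂ) * F (Z p) *
      (φ (n + 1) p.1 * ((Complex.I * (p.2 * d p.1)) ^ n / (n.factorial : ℂ))))
      (Set.uIcc (-P) P ×ˢ Set.uIcc (0 : ℝ) 1) := by
    rw [hm]
    have := hφc (n + 1)
    refine ContinuousOn.integrableOn_compact (isCompact_Icc.prod isCompact_Icc) ?_
    refine (hdcc.continuousOn.mul hFc).mul (Continuous.continuousOn ?_)
    fun_prop
  have key := key hint
  have hΦP : ∀ y, almostAnalytic φ (n + 1) P y = 0 := fun y =>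
    Finset.sum_eq_zero fun j hj => by simp [(hφ0 j (Finset.mem_range.1 hj)).1]
  have hΦP' : ∀ y, almostAnalytic φ (n + 1) (-P) y = 0 := fun y =>
    Finset.sum_eq_zero fun j hj => by simp [(hφ0 j (Finset.mem_range.1 hj)).2]
  have h00 : ∀ t, almostAnalytic φ (n + 1) t 0 = φ 0 t := by
    intro t
    rw [almostAnalytic, Finset.sum_range_succ']
    simp
  simpa [hΦ, hW, hZ, hΦP, hΦP', h00] using key

theorem norm_almostAnalytic_le {φ : ℕ → ℝ → ℝ} {N : ℕ} {D t y : ℝ} (hD : 0 ≤ D) (hy : 0 ≤ y)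
    (hφ : ∀ j < N, |φ j t| ≤ D ^ j) : ‖almostAnalytic φ N t y‖ ≤ Real.exp (D * y) := by
  refine (norm_sum_le _ _).trans (le_trans ?_ (Real.sum_le_exp_of_nonneg (by positivity) N))
  refine Finset.sum_le_sum fun j hj => ?_
  have h1 := hφ j (Finset.mem_range.1 hj)
  have h2 : ‖((φ j t : ℝ) : ℂ) * ((Complex.I * y) ^ j / (j.factorial : ℂ))‖ =
      |φ j t| * (y ^ j / j.factorial) := by
    rw [norm_mul, norm_div, norm_pow, norm_mul, Complex.norm_I, one_mul, Complex.norm_real,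
      Complex.norm_real, Complex.norm_natCast, Real.norm_eq_abs, Real.norm_of_nonneg hy]
  rw [h2, mul_pow, mul_div_assoc]
  gcongr

/-- From (xy)^n / n! ≤ e^{xy}. It lets the exponential decay pay for the Taylor factor of the area
term, uniformly in y. -/
theorem pow_mul_exp_neg_le {x y : ℝ} (hx : 0 < x) (hy : 0 ≤ y) (n : ℕ) :
    y ^ n / n.factorial * Real.exp (-(x * y)) ≤ (x ^ n)⁻¹ := by
  have h := Real.pow_div_factorial_le_exp (x * y) (by positivity) n
  rw [Real.exp_neg, ← div_eq_mul_inv, div_le_iff₀ (Real.exp_pos _)]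
  rw [mul_pow, mul_div_assoc] at h
  rw [inv_mul_eq_div, le_div_iff₀ (by positivity)]
  linarith

/-- On the moved contour the almost analytic extension is at most e^{d/w}, which lowers x to x -
1/w, and |i - d'| ≤ 2. In the area term y^n/n! is absorbed by e^{-xy}, leaving w^{-(n+1)} x^{-n}. -/
theorem norm_integral_cutoff_le {g : ℂ → ℂ} {U : Set ℂ} (hU : IsOpen U)
    (hg : DifferentiableOn ℂ g U) {d d' d'' : ℝ → ℝ} (hd : ∀ t, HasDerivAt d (d' t) t)
    (hd' : ∀ t, HasDerivAt d' (d'' t) t) {v w P x G d₀ E : ℝ} (hv : 0 < v) (hw : 0 < w) {n : ℕ}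
    (hP : 4 * v + (n + 1 : ℕ) * w < P) (hx : 0 < x) (hG : 0 ≤ G)
    (hd0 : ∀ t ∈ Set.Icc (-P) P, 0 ≤ d t ∧ d t ≤ d₀)
    (hd1 : ∀ t ∈ Set.Icc (-P) P, |d' t| ≤ 1)
    (hpath : ∀ t ∈ Set.Icc (-P) P, ∀ θ ∈ Set.Icc (0 : ℝ) 1,
      (Complex.I * t - θ * d t : ℂ) ∈ U ∧ ‖g (Complex.I * t - θ * d t)‖ ≤ G)
    {ω : ℝ → ℝ} (hω : IntervalIntegrable ω volume (-P) P)
    (hgω : ∀ t ∈ Set.Icc (-P) P,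
      ‖g (Complex.I * t - d t)‖ * Real.exp (-((x - w⁻¹) * d t)) ≤ ω t)
    (hE : ∫ t in (-P)..P, ω t ≤ E) :
    ‖∫ t in (-P)..P, (cutoff v w (n + 1) 0 t : ℂ) * (g (Complex.I * t) *
      Complex.exp (t * x * Complex.I))‖ ≤
      2 * E + 2 * P * (d₀ * G * (w⁻¹ ^ (n + 1) * (x ^ n)⁻¹)) := by
  have hP0 : 0 < P := lt_of_le_of_lt (by positivity) hP
  have hsupp : ∀ j < n + 1, ∀ t, P ≤ |t| → cutoff v w (n + 1) j t = 0 := fun j hj t ht =>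
    (isCutoff_cutoff hv hw (n + 1) hj.le).supp t (hP.trans_le ht)
  have hbd : ∀ j ≤ n + 1, ∀ t, |cutoff v w (n + 1) j t| ≤ w⁻¹ ^ j := fun j hj t =>
    (isCutoff_cutoff hv hw (n + 1) hj).bound t
  set F : ℂ → ℂ := fun s => g s * Complex.exp (s * x) with hF
  have hFd : DifferentiableOn ℂ F U :=
    hg.mul (by fun_prop)
  have hFn : ∀ (t y : ℝ), ‖F (Complex.I * t - y)‖ =
      ‖g (Complex.I * t - y)‖ * Real.exp (-(x * y)) := by
    intro t y
    rw [hF]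
    simp only [norm_mul, Complex.norm_exp]
    congr 2
    simp
    ring
  have key := integral_deform_contour hU hFd hd hd' (φ := cutoff v w (n + 1))
    (fun j hj t => hasDerivAt_cutoff hv hw (n + 1) hj t)
    (fun j => continuous_cutoff hv hw (n + 1) j) hP0.le
    (fun j hj => ⟨hsupp j hj P (le_abs_self P), hsupp j hj (-P) (by rw [abs_neg]; exact le_abs_self P)⟩)
    (fun t ht θ hθ => (hpath t ht θ hθ).1)
  have e1 : ∫ t in (-P)..P, F (Complex.I * t) * cutoff v w (n + 1) 0 t * Complex.I =
      (∫ t in (-P)..P, (cutoff v w (n + 1) 0 t : ℂ) * (g (Complex.I * t) *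
      Complex.exp (t * x * Complex.I))) * Complex.I := by
    rw [← intervalIntegral.integral_mul_const]
    congr 1
    funext t
    rw [hF]
    simp only
    rw [show Complex.I * t * x = t * x * Complex.I by ring]
    ring
  rw [e1] at key
  have hle : -P ≤ P := by linarith
  have b1 : ‖∫ t in (-P)..P, F (Complex.I * t - d t) *
      almostAnalytic (cutoff v w (n + 1)) (n + 1) t (d t) * (Complex.I - d' t)‖ ≤ 2 * E := by
    calc _ ≤ ∫ t in (-P)..P, 2 * ω t := by
          refine intervalIntegral.norm_integral_le_of_norm_le hle
            (Eventually.of_forall fun t ht => ?_) (hω.const_mul 2)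
          have ht' : t ∈ Set.Icc (-P) P := Set.Ioc_subset_Icc_self ht
          have h1 := norm_almostAnalytic_le (N := n + 1) (t := t) (inv_nonneg.2 hw.le) (hd0 t ht').1
            (fun j hj => hbd j hj.le t)
          have h2 : ‖(Complex.I - d' t : ℂ)‖ ≤ 2 := by
            refine (norm_sub_le _ _).trans ?_
            rw [Complex.norm_I, Complex.norm_real, Real.norm_eq_abs]
            linarith [hd1 t ht']
          rw [norm_mul, norm_mul, hFn]
          calc _ ≤ ‖g (Complex.I * t - d t)‖ * Real.exp (-(x * d t)) *
                Real.exp (w⁻¹ * d t) * 2 := by gcongr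
            _ = 2 * (‖g (Complex.I * t - d t)‖ * Real.exp (-((x - w⁻¹) * d t))) := by
              rw [show -((x - w⁻¹) * d t) = -(x * d t) + w⁻¹ * d t by ring, Real.exp_add]
              ring
            _ ≤ 2 * ω t := by
              gcongr
              exact hgω t ht'
      _ ≤ 2 * E := by
        rw [intervalIntegral.integral_const_mul]
        gcongr
  have b2 : ‖∫ t in (-P)..P, ∫ θ in (0 : ℝ)..1, (d t : ℂ) * F (Complex.I * t - θ * d t) *
      (cutoff v w (n + 1) (n + 1) t * ((Complex.I * (θ * d t)) ^ n / (n.factorial : ℂ)))‖ ≤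
      2 * P * (d₀ * G * (w⁻¹ ^ (n + 1) * (x ^ n)⁻¹)) := by
    have h1 : ∀ t ∈ Set.uIoc (-P) P, ‖∫ θ in (0 : ℝ)..1, (d t : ℂ) * F (Complex.I * t - θ * d t) *
      (cutoff v w (n + 1) (n + 1) t * ((Complex.I * (θ * d t)) ^ n / (n.factorial : ℂ)))‖ ≤
        d₀ * G * (w⁻¹ ^ (n + 1) * (x ^ n)⁻¹) := by
      intro t ht
      rw [Set.uIoc_of_le hle] at ht
      have ht' : t ∈ Set.Icc (-P) P := Set.Ioc_subset_Icc_self ht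
      have h2 : ∀ θ ∈ Set.uIoc (0 : ℝ) 1, ‖(d t : ℂ) * F (Complex.I * t - θ * d t) *
          (cutoff v w (n + 1) (n + 1) t * ((Complex.I * (θ * d t)) ^ n / (n.factorial : ℂ)))‖ ≤
          d₀ * G * (w⁻¹ ^ (n + 1) * (x ^ n)⁻¹) := by
        intro θ hθ
        rw [Set.uIoc_of_le zero_le_one] at hθ
        have hθ' : θ ∈ Set.Icc (0 : ℝ) 1 := Set.Ioc_subset_Icc_self hθ
        have hdt := hd0 t ht'
        have hy : 0 ≤ θ * d t := mul_nonneg hθ'.1 hdt.1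
        have h3 := hFn t (θ * d t)
        have h4 := (hpath t ht' θ hθ').2
        have h5 := pow_mul_exp_neg_le hx hy n
        have h6 := hbd (n + 1) le_rfl t
        push_cast at h3
        rw [norm_mul, norm_mul, h3, norm_mul, norm_div, norm_pow, norm_mul, Complex.norm_I, one_mul,
          ← Complex.ofReal_mul, Complex.norm_real, Complex.norm_real, Complex.norm_real,
          Complex.norm_natCast, Real.norm_of_nonneg hdt.1, Real.norm_of_nonneg hy,
          Real.norm_eq_abs]
        push_cast
        calc _ = d t * ‖g (Complex.I * t - θ * d t)‖ * (|cutoff v w (n + 1) (n + 1) t| *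
              ((θ * d t) ^ n / n.factorial * Real.exp (-(x * (θ * d t))))) := by ring
          _ ≤ _ := by
            have : 0 ≤ d₀ := hdt.1.trans hdt.2
            gcongr
            exact hdt.2
      have := intervalIntegral.norm_integral_le_of_norm_le_const h2
      simpa using this
    have := intervalIntegral.norm_integral_le_of_norm_le_const h1
    rw [show P - -P = 2 * P by ring, abs_of_pos (by positivity)] at this
    linarith
  have hnI : ∀ z : ℂ, ‖z‖ = ‖z * Complex.I‖ := fun z => by simp
  rw [hnI]
  have : (∫ t in (-P)..P, (cutoff v w (n + 1) 0 t : ℂ) * (g (Complex.I * t) *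
      Complex.exp (t * x * Complex.I))) * Complex.I =
      (∫ t in (-P)..P, F (Complex.I * t - d t) *
      almostAnalytic (cutoff v w (n + 1)) (n + 1) t (d t) * (Complex.I - d' t)) -
      ∫ t in (-P)..P, ∫ θ in (0 : ℝ)..1, (d t : ℂ) * F (Complex.I * t - θ * d t) *
      (cutoff v w (n + 1) (n + 1) t * ((Complex.I * (θ * d t)) ^ n / (n.factorial : ℂ))) := by
    rw [key]
    ring
  rw [this]
  exact (norm_sub_le _ _).trans (add_le_add b1 b2)

/-! ### Laplace transform and boundedness of the deviation. -/

/-- The deviation `e^{-u} τ(u) - A` of `τ` from `A e^u`, normalised by `e^u`. -/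
def deviation (τ : ℝ → ℝ) (A u : ℝ) : ℝ := Real.exp (-u) * τ u - A

/-- A non-decreasing `τ` such that `L{τ; s + 1} - A / s` extends continuously to a domain `D`
that contains a neighbourhood of every bounded piece of the imaginary axis. -/
structure LaplaceExtension (τ : ℝ → ℝ) (A : ℝ) (g : ℂ → ℂ) (D : Set ℂ) : Prop where
  mono : MonotoneOn τ (Set.Ici 0)
  pos : 0 < A
  cont : ContinuousOn g D
  laplace : ∀ s ∈ D, 0 < s.re → HasLaplace τ (s + 1) (g s + (A : ℂ) / s)
  strip : ∀ P : ℝ, ∃ σ₀ > 0, ∀ σ t : ℝ, |σ| ≤ σ₀ → |t| ≤ P → (σ + Complex.I * t : ℂ) ∈ D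

namespace LaplaceExtension

variable {τ : ℝ → ℝ} {A : ℝ} {g : ℂ → ℂ} {D : Set ℂ}

/-- The Laplace integral converges a priori only as an improper integral. Since τ - τ(0) ≥ 0, this
convergence is absolute after subtracting the constant. -/
theorem integrableOn_exp_mul (h : LaplaceExtension τ A g D) {σ : ℝ} (hσ : 0 < σ)
    (hD : (σ : ℂ) ∈ D) :
    IntegrableOn (fun u => Real.exp (-(σ + 1) * u) * τ u) (Set.Ioi 0) := by
  have hexp : IntegrableOn (fun u => Real.exp (-(σ + 1) * u)) (Set.Ioi 0) :=
    integrableOn_exp_mul_Ioi (by linarith) 0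
  have hloc : ∀ T : ℝ, 0 ≤ T →
      IntervalIntegrable (fun u => Real.exp (-(σ + 1) * u) * τ u) volume 0 T := by
    intro T hT
    have hm : MonotoneOn τ (Set.uIcc 0 T) := h.mono.mono (by
      rw [Set.uIcc_of_le hT]
      exact Set.Icc_subset_Ici_self)
    exact hm.intervalIntegrable.continuousOn_mul (by fun_prop)
  have hexpl : ∀ T : ℝ, IntervalIntegrable (fun u => Real.exp (-(σ + 1) * u)) volume 0 T :=
    fun T => (by fun_prop : Continuous fun u => Real.exp (-(σ + 1) * u)).intervalIntegrable _ _
  obtain ⟨l, hl⟩ : ∃ l : ℝ, Tendsto (fun T : ℝ => ∫ u in (0 : ℝ)..T,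
      Real.exp (-(σ + 1) * u) * τ u) atTop (𝓝 l) := by
    have h1 := h.laplace σ hD (by simpa using hσ)
    refine ⟨_, (Complex.continuous_re.continuousAt.tendsto.comp h1).congr fun T => ?_⟩
    have : ∀ u : ℝ, Complex.exp (-((σ : ℂ) + 1) * u) * (τ u : ℂ) =
        ((Real.exp (-(σ + 1) * u) * τ u : ℝ) : ℂ) := by
      intro u
      push_cast
      rfl
    simp only [Function.comp, this]
    rw [intervalIntegral.integral_ofReal, Complex.ofReal_re]
  have hpos : IntegrableOn (fun u => Real.exp (-(σ + 1) * u) * (τ u - τ 0)) (Set.Ioi 0) := by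
    have hlim := hl.sub ((intervalIntegral_tendsto_integral_Ioi (b := fun T : ℝ => T) 0 hexp
      tendsto_id).const_mul (τ 0))
    refine integrableOn_Ioi_of_intervalIntegral_norm_tendsto (l := atTop)
      (b := fun T : ℝ => max T 0) _ 0 (fun T => ?_) (tendsto_atTop_mono (fun T => le_max_left T 0)
        tendsto_id) (hlim.congr' ?_)
    · rw [← intervalIntegrable_iff_integrableOn_Ioc_of_le (le_max_right T 0)]
      have := (hloc _ (le_max_right T 0)).sub ((hexpl (max T 0)).mul_const (τ 0))
      refine this.congr fun u _ => ?_
      ring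
    · filter_upwards [eventually_ge_atTop 0] with T hT
      rw [max_eq_left hT, ← intervalIntegral.integral_const_mul,
        ← intervalIntegral.integral_sub (hloc T hT) ((hexpl T).const_mul _)]
      refine intervalIntegral.integral_congr fun u hu => ?_
      rw [Set.uIcc_of_le hT] at hu
      have : 0 ≤ τ u - τ 0 := sub_nonneg.2 (h.mono Set.self_mem_Ici hu.1 hu.1)
      rw [Real.norm_of_nonneg (by positivity)]
      ring
  refine (hpos.add (hexp.mul_const (τ 0))).congr (Eventually.of_forall fun u => ?_)
  simp only [Pi.add_apply]
  ring

theorem integrableOn_deviation_mul (h : LaplaceExtension τ A g D) {σ : ℝ} (hσ : 0 < σ)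
    (hD : (σ : ℂ) ∈ D) :
    IntegrableOn (fun u => deviation τ A u * Real.exp (-σ * u)) (Set.Ioi 0) := by
  have hexp : IntegrableOn (fun u => Real.exp (-σ * u)) (Set.Ioi 0) :=
    integrableOn_exp_mul_Ioi (by linarith) 0
  refine ((h.integrableOn_exp_mul hσ hD).sub (hexp.mul_const A)).congr
    (Eventually.of_forall fun u => ?_)
  simp only [Pi.sub_apply, deviation]
  rw [show -(σ + 1) * u = -u + -σ * u by ring, Real.exp_add]
  ring

theorem integral_deviation_mul_exp (h : LaplaceExtension τ A g D) {s : ℂ} (hs : s ∈ D)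
    (hre : 0 < s.re) (hD : (s.re : ℂ) ∈ D) :
    ∫ u in Set.Ioi (0 : ℝ), (deviation τ A u : ℂ) * Complex.exp (-s * u) = g s := by
  have hi := h.integrableOn_exp_mul hre hD
  have hne : s ≠ 0 := fun h0 => by simp [h0] at hre
  have hexp : IntegrableOn (fun u : ℝ => Complex.exp (-s * u)) (Set.Ioi 0) :=
    integrableOn_exp_mul_complex_Ioi (by simpa using hre) 0
  have hi' : IntegrableOn (fun u : ℝ => Complex.exp (-(s + 1) * u) * (τ u : ℂ)) (Set.Ioi 0) := by
    refine hi.norm.mono' ?_ (Eventually.of_forall fun u => le_of_eq ?_)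
    · have : AEMeasurable τ (volume.restrict (Set.Ioi 0)) :=
        aemeasurable_restrict_of_monotoneOn measurableSet_Ioi
          (h.mono.mono Set.Ioi_subset_Ici_self)
      have h2 : AEMeasurable (fun u : ℝ => Complex.exp (-(s + 1) * u) * (τ u : ℂ))
          (volume.restrict (Set.Ioi 0)) := by fun_prop
      exact h2.aestronglyMeasurable
    · rw [norm_mul, norm_mul, Complex.norm_exp, Complex.norm_real, Real.norm_of_nonneg (Real.exp_pos _).le]
      simp
  have h1 : ∫ u in Set.Ioi (0 : ℝ), Complex.exp (-(s + 1) * u) * (τ u : ℂ) = g s + (A : ℂ) / s :=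
    tendsto_nhds_unique (intervalIntegral_tendsto_integral_Ioi (b := fun T : ℝ => T) 0 hi'
      tendsto_id) (h.laplace s hs hre)
  have h2 : ∫ u in Set.Ioi (0 : ℝ), Complex.exp (-s * u) = 1 / s := by
    rw [integral_exp_mul_complex_Ioi (by simpa using hre)]
    simp
  have h3 : ∀ u : ℝ, (deviation τ A u : ℂ) * Complex.exp (-s * u) =
      Complex.exp (-(s + 1) * u) * (τ u : ℂ) - A * Complex.exp (-s * u) := by
    intro u
    rw [deviation, show -(s + 1) * u = -(u : ℂ) + -s * u by ring, Complex.exp_add]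
    push_cast
    ring
  simp only [h3]
  rw [integral_sub hi' (hexp.const_mul _), h1, integral_const_mul, h2]
  ring

theorem kernel_eq {v w P : ℝ} (hv : 0 < v) (hw : 0 < w) {N : ℕ} (hP : 4 * v + N * w ≤ P) (y : ℝ) :
    ((2 * Real.pi * kernel v w N y : ℝ) : ℂ) =
      ∫ t in (-P)..P, (cutoff v w N 0 t : ℂ) * Complex.exp (t * y * Complex.I) := by
  have hP0 : 0 ≤ P := le_trans (by positivity) hP
  rw [← fourierInt_cutoff_eq_kernel hv hw, fourierInt,
    intervalIntegral.integral_of_le (by linarith), ← integral_Icc_eq_integral_Ioc]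
  refine (setIntegral_eq_integral_of_forall_compl_eq_zero fun t ht => ?_).symm
  have : P < |t| := by
    by_contra hc
    exact ht (abs_le.1 (not_lt.1 hc))
  rw [(isCutoff_cutoff hv hw N (Nat.zero_le N)).supp t (hP.trans_lt this)]
  simp

/-- Fubini: the kernel is a Fourier integral of the cutoff, and the inner integral in u is g(σ +
it). The damping σ > 0 provides absolute convergence before the deviation is known to be bounded. -/
theorem integral_deviation_mul_kernel (h : LaplaceExtension τ A g D) {v w P σ : ℝ} (hv : 0 < v)
    (hw : 0 < w) {N : ℕ} (hP : 4 * v + N * w ≤ P) (hσ : 0 < σ)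
    (hD : ∀ t : ℝ, |t| ≤ P → (σ + Complex.I * t : ℂ) ∈ D) (x : ℝ) :
    ((2 * Real.pi * ∫ u in Set.Ioi (0 : ℝ),
      deviation τ A u * Real.exp (-σ * u) * kernel v w N (x - u) : ℝ) : ℂ) =
    ∫ t in (-P)..P, (cutoff v w N 0 t : ℂ) *
      (g (σ + Complex.I * t) * Complex.exp (t * x * Complex.I)) := by
  have hP0 : 0 ≤ P := le_trans (by positivity) hP
  have hσD : (σ : ℂ) ∈ D := by simpa using hD 0 (by simpa using hP0)
  have hle : -P ≤ P := by linarith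
  have hint := h.integrableOn_deviation_mul hσ hσD
  have hcut := isCutoff_cutoff hv hw N (Nat.zero_le N)
  have hcc := continuous_cutoff hv hw N 0
  have hprod : Integrable (fun p : ℝ × ℝ => ((deviation τ A p.1 * Real.exp (-σ * p.1) : ℝ) : ℂ) *
      ((cutoff v w N 0 p.2 : ℂ) * Complex.exp (p.2 * (x - p.1) * Complex.I)))
      ((volume.restrict (Set.Ioi 0)).prod (volume.restrict (Set.Ioc (-P) P))) := by
    have h1 := (hint.ofReal (𝕜 := ℂ)).mul_prod
      (hcut.integrable.integrableOn.ofReal (𝕜 := ℂ) : Integrable _ (volume.restrict (Set.Ioc (-P) P)))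
    have h2 : Continuous fun p : ℝ × ℝ => Complex.exp (p.2 * (x - p.1) * Complex.I) := by fun_prop
    refine (h1.mul_bdd (c := 1) h2.aestronglyMeasurable (Eventually.of_forall fun p => ?_)).congr
      (Eventually.of_forall fun p => ?_)
    · rw [show (p.2 : ℂ) * (x - p.1) = ((p.2 * (x - p.1) : ℝ) : ℂ) by push_cast; ring,
        Complex.norm_exp_ofReal_mul_I]
    · simp only [mul_assoc]
      rfl
  have h1 : ∀ u : ℝ, ((2 * Real.pi * (deviation τ A u * Real.exp (-σ * u) *
      kernel v w N (x - u)) : ℝ) : ℂ) = ∫ t in Set.Ioc (-P) P,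
      ((deviation τ A u * Real.exp (-σ * u) : ℝ) : ℂ) *
      ((cutoff v w N 0 t : ℂ) * Complex.exp (t * (x - u) * Complex.I)) := by
    intro u
    have := kernel_eq hv hw hP (x - u)
    rw [intervalIntegral.integral_of_le hle] at this
    rw [integral_const_mul]
    push_cast at this ⊢
    rw [← this]
    ring
  have h2 : ∀ t ∈ Set.Ioc (-P) P, ∫ u in Set.Ioi (0 : ℝ),
      ((deviation τ A u * Real.exp (-σ * u) : ℝ) : ℂ) *
      ((cutoff v w N 0 t : ℂ) * Complex.exp (t * (x - u) * Complex.I)) =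
      (cutoff v w N 0 t : ℂ) * (g (σ + Complex.I * t) * Complex.exp (t * x * Complex.I)) := by
    intro t ht
    have hs := h.integral_deviation_mul_exp (hD t (abs_le.2 ⟨ht.1.le, ht.2⟩))
      (by simpa using hσ) (by simpa using hσD)
    rw [← hs, ← integral_mul_const, ← integral_const_mul]
    congr 1
    funext u
    rw [show -((σ : ℂ) + Complex.I * t) * u = -σ * u + -(t * u * Complex.I) by ring,
      show (t : ℂ) * (x - u) * Complex.I = t * x * Complex.I + -(t * u * Complex.I) by ring,
      Complex.exp_add, Complex.exp_add]
    push_cast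
    ring
  rw [← integral_const_mul, ← integral_complex_ofReal]
  simp only [h1]
  rw [integral_integral_swap hprod, intervalIntegral.integral_of_le hle]
  exact setIntegral_congr_fun measurableSet_Ioc h2

theorem neg_le_deviation (h : LaplaceExtension τ A g D) {u : ℝ} (hu : 0 ≤ u) :
    -(|τ 0| + A) ≤ deviation τ A u := by
  have h1 : τ 0 ≤ τ u := h.mono Set.self_mem_Ici hu hu
  have h2 : Real.exp (-u) ≤ 1 := Real.exp_le_one_iff.2 (by linarith)
  have h3 : -|τ 0| ≤ Real.exp (-u) * τ u := by
    have h4 := neg_abs_le (τ 0)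
    nlinarith [Real.exp_pos (-u), abs_nonneg (τ 0)]
  rw [deviation]
  linarith

theorem exists_bound_strip (h : LaplaceExtension τ A g D) (P : ℝ) :
    ∃ σ₀ > 0, ∃ G : ℝ, 0 ≤ G ∧ ∀ σ t : ℝ, |σ| ≤ σ₀ → |t| ≤ P →
      (σ + Complex.I * t : ℂ) ∈ D ∧ ‖g (σ + Complex.I * t)‖ ≤ G := by
  obtain ⟨σ₀, hσ₀, hs⟩ := h.strip P
  have hK : IsCompact (Set.Icc (-σ₀) σ₀ ×ˢ Set.Icc (-P) P) := isCompact_Icc.prod isCompact_Icc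
  have hc : ContinuousOn (fun p : ℝ × ℝ => g (p.1 + Complex.I * p.2))
      (Set.Icc (-σ₀) σ₀ ×ˢ Set.Icc (-P) P) :=
    h.cont.comp (by fun_prop) fun p hp => hs p.1 p.2 (abs_le.2 hp.1) (abs_le.2 hp.2)
  obtain ⟨G, hG⟩ := hK.exists_bound_of_continuousOn hc
  refine ⟨σ₀, hσ₀, max G 0, le_max_right _ _, fun σ t hσ ht => ⟨hs σ t hσ ht, ?_⟩⟩
  exact (hG (σ, t) ⟨abs_le.1 hσ, abs_le.1 ht⟩).trans (le_max_left _ _)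

/-- A Chebyshev-type bound from one fixed kernel. Adding C₂ makes the deviation non-negative, so the
smoothed quantity may be restricted to (x, x + 1]; there monotonicity of τ bounds the integrand
below by a multiple of e^{-x} τ(x). -/
theorem exists_abs_deviation_le (h : LaplaceExtension τ A g D) :
    ∃ C : ℝ, 0 ≤ C ∧ ∀ u : ℝ, 0 ≤ u → |deviation τ A u| ≤ C := by
  obtain ⟨σ₀, hσ₀, G, hG0, hG⟩ := h.exists_bound_strip 7
  set C₂ : ℝ := |τ 0| + A with hC₂
  have hA := h.pos
  have hC₂0 : 0 ≤ C₂ := by positivity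
  set B : ℝ := 32 * Real.exp 1 * Real.exp 1 * (14 * G + 4 * C₂) with hB
  have hB0 : 0 ≤ B := by positivity
  have hP : 4 * (1 : ℝ) + (8 : ℕ) * (1 / 4 : ℝ) ≤ 7 := by norm_num
  have heven : Even 8 := by decide
  have main : ∀ x : ℝ, 0 ≤ x → Real.exp (-x) * τ x ≤ B := by
    intro x hx
    by_contra hcon
    have hy : 0 < Real.exp (-x) * τ x := hB0.trans_lt (not_le.1 hcon)
    have hτx : 0 < τ x := (mul_pos_iff_of_pos_left (Real.exp_pos _)).1 hy
    -- With this σ the damping e^{-σu} stays above e^{-1} for u ≤ x + 1, so the final bound does not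
    -- depend on x.
    set σ : ℝ := min σ₀ (1 / (x + 1)) with hσ
    have hσ0 : 0 < σ := lt_min hσ₀ (by positivity)
    have hσ1 : σ * (x + 1) ≤ 1 := by
      have : σ ≤ 1 / (x + 1) := min_le_right _ _
      rwa [le_div_iff₀ (by linarith)] at this
    have hσabs : |σ| ≤ σ₀ := by
      rw [abs_of_pos hσ0]
      exact min_le_left _ _
    have hD : ∀ t : ℝ, |t| ≤ 7 → (σ + Complex.I * t : ℂ) ∈ D := fun t ht => (hG σ t hσabs ht).1
    have hσD : (σ : ℂ) ∈ D := by simpa using hD 0 (by norm_num)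
    have hid := h.integral_deviation_mul_kernel one_pos (by norm_num : (0 : ℝ) < 1 / 4) hP hσ0 hD x
    set k : ℝ → ℝ := kernel 1 (1 / 4) 8 with hk
    have hk0 : ∀ y, 0 ≤ k y := kernel_nonneg one_pos heven
    have hkc : Continuous k := continuous_kernel _ _ _
    have hkle : ∀ y, k y ≤ 4 := fun y => by
      refine (kernel_le' one_pos y).trans ?_
      have h1 : (1 + (1 * y) ^ 2)⁻¹ ≤ 1 := inv_le_one_of_one_le₀ (by nlinarith [sq_nonneg (1 * y)])
      have h2 : 1 / Real.pi ≤ 1 := (div_le_one Real.pi_pos).2 (by linarith [Real.pi_gt_three])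
      have h3 : 0 ≤ (1 + (1 * y) ^ 2)⁻¹ := by positivity
      have h4 : 0 ≤ 1 / Real.pi := by positivity
      nlinarith
    have hup : ∫ u in Set.Ioi (0 : ℝ), deviation τ A u * Real.exp (-σ * u) * k (x - u) ≤ 14 * G := by
      have h1 : ‖∫ t in (-7 : ℝ)..7, (cutoff 1 (1 / 4) 8 0 t : ℂ) *
          (g (σ + Complex.I * t) * Complex.exp (t * x * Complex.I))‖ ≤ G * |7 - -7| := by
        refine intervalIntegral.norm_integral_le_of_norm_le_const fun t ht => ?_
        rw [Set.uIoc_of_le (by norm_num)] at ht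
        have h2 := (hG σ t hσabs (abs_le.2 ⟨ht.1.le, ht.2⟩)).2
        have h3 := (isCutoff_cutoff one_pos (by norm_num : (0 : ℝ) < 1 / 4) 8 (Nat.zero_le 8)).bound t
        rw [pow_zero] at h3
        rw [norm_mul, norm_mul, show (t : ℂ) * x = ((t * x : ℝ) : ℂ) by push_cast; ring,
          Complex.norm_exp_ofReal_mul_I, mul_one, Complex.norm_real, Real.norm_eq_abs]
        calc _ ≤ 1 * G := by gcongr
          _ = G := one_mul G
      rw [← hid, Complex.norm_real, Real.norm_eq_abs] at h1
      have h2 := (le_abs_self _).trans h1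
      rw [show |(7 : ℝ) - -7| = 14 by norm_num] at h2
      set X := ∫ u in Set.Ioi (0 : ℝ), deviation τ A u * Real.exp (-σ * u) * k (x - u)
      by_contra hX
      nlinarith [Real.pi_gt_three]
    have hint1 : IntegrableOn (fun u => deviation τ A u * Real.exp (-σ * u) * k (x - u))
        (Set.Ioi 0) := by
      refine (h.integrableOn_deviation_mul hσ0 hσD).mul_bdd (c := 4)
        (by fun_prop) (Eventually.of_forall fun u => ?_)
      rw [Real.norm_of_nonneg (hk0 _)]
      exact hkle _
    have hkint : Integrable fun u => k (x - u) :=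
      (integrable_kernel one_pos heven).comp_sub_left x
    have hint2 : IntegrableOn (fun u => C₂ * (Real.exp (-σ * u) * k (x - u))) (Set.Ioi 0) := by
      have hexp : IntegrableOn (fun u => Real.exp (-σ * u)) (Set.Ioi 0) :=
        integrableOn_exp_mul_Ioi (by linarith) 0
      refine (hexp.mul_bdd (c := 4) (by fun_prop) (Eventually.of_forall fun u => ?_)).const_mul C₂
      rw [Real.norm_of_nonneg (hk0 _)]
      exact hkle _
    have hup2 : ∫ u in Set.Ioi (0 : ℝ), C₂ * (Real.exp (-σ * u) * k (x - u)) ≤ 4 * C₂ := by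
      calc _ ≤ ∫ u in Set.Ioi (0 : ℝ), C₂ * k (x - u) := by
            refine setIntegral_mono_on hint2 (hkint.const_mul C₂).integrableOn measurableSet_Ioi
              fun u hu => ?_
            have : Real.exp (-σ * u) ≤ 1 := Real.exp_le_one_iff.2 (by
              have : 0 < σ * u := mul_pos hσ0 hu
              linarith)
            have := mul_le_mul_of_nonneg_right this (hk0 (x - u))
            rw [one_mul] at this
            gcongr
        _ ≤ ∫ u, C₂ * k (x - u) := setIntegral_le_integral (hkint.const_mul C₂)
            (Eventually.of_forall fun u => mul_nonneg hC₂0 (hk0 _))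
        _ = C₂ * ∫ u, k u := by rw [integral_const_mul, integral_sub_left_eq_self]
        _ ≤ C₂ * 4 := by
          gcongr
          exact integral_kernel_le one_pos heven
        _ = 4 * C₂ := by ring
    have hsum : ∫ u in Set.Ioi (0 : ℝ), (deviation τ A u + C₂) * (Real.exp (-σ * u) * k (x - u)) ≤
        14 * G + 4 * C₂ := by
      have : ∀ u, (deviation τ A u + C₂) * (Real.exp (-σ * u) * k (x - u)) =
          deviation τ A u * Real.exp (-σ * u) * k (x - u) +
            C₂ * (Real.exp (-σ * u) * k (x - u)) := fun u => by ring
      simp only [this]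
      rw [integral_add hint1 hint2]
      linarith
    have hlow : (Real.exp (-x) * τ x) * Real.exp (-1) * Real.exp (-1) * (1 / 32) ≤
        ∫ u in Set.Ioi (0 : ℝ), (deviation τ A u + C₂) * (Real.exp (-σ * u) * k (x - u)) := by
      have hsub : Set.Ioc x (x + 1) ⊆ Set.Ioi 0 := fun u hu => hx.trans_lt hu.1
      have hint3 : IntegrableOn (fun u => (deviation τ A u + C₂) * (Real.exp (-σ * u) * k (x - u)))
          (Set.Ioi 0) := by
        refine (hint1.add hint2).congr (Eventually.of_forall fun u => ?_)
        simp only [Pi.add_apply]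
        ring
      calc _ = ∫ u in Set.Ioc x (x + 1),
            (Real.exp (-x) * τ x) * Real.exp (-1) * Real.exp (-1) * (1 / 32) := by
            simp
        _ ≤ ∫ u in Set.Ioc x (x + 1), (deviation τ A u + C₂) * (Real.exp (-σ * u) * k (x - u)) := by
          refine setIntegral_mono_on (integrable_const _) (hint3.mono_set hsub) measurableSet_Ioc
            fun u hu => ?_
          have hu0 : 0 < u := hsub hu
          have h1 : τ x ≤ τ u := h.mono hx hu0.le hu.1.le
          have h2 : Real.exp (-x) * τ x * Real.exp (-1) ≤ deviation τ A u + C₂ := by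
            have h3 : Real.exp (-x) * Real.exp (-1) ≤ Real.exp (-u) := by
              rw [← Real.exp_add]
              exact Real.exp_le_exp.2 (by linarith [hu.2])
            have h4 : (Real.exp (-x) * Real.exp (-1)) * τ x ≤ Real.exp (-u) * τ u :=
              mul_le_mul h3 h1 hτx.le (Real.exp_pos _).le
            have h5 := abs_nonneg (τ 0)
            rw [deviation]
            linarith
          have h6 : Real.exp (-1) ≤ Real.exp (-σ * u) := by
            refine Real.exp_le_exp.2 ?_
            have : σ * u ≤ σ * (x + 1) := by
              gcongr
              exact hu.2
            linarith
          have h7 : (1 / 32 : ℝ) ≤ k (x - u) := by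
            refine le_kernel one_pos (by norm_num) (by norm_num) le_rfl ?_
            rw [one_mul, abs_le]
            constructor <;> linarith [hu.1, hu.2]
          calc _ = (Real.exp (-x) * τ x * Real.exp (-1)) * (Real.exp (-1) * (1 / 32)) := by ring
            _ ≤ _ := by
              have : 0 ≤ deviation τ A u + C₂ := le_trans (by positivity) h2
              gcongr
        _ ≤ _ := setIntegral_mono_set hint3 (by
            filter_upwards [ae_restrict_mem measurableSet_Ioi] with u hu
            have h1 := h.neg_le_deviation (le_of_lt hu)
            have h2 := hk0 (x - u)
            have : 0 ≤ deviation τ A u + C₂ := by linarith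
            simp only [Pi.zero_apply]
            positivity) hsub.eventuallyLE
    apply hcon
    have h1 := hlow.trans hsum
    rw [Real.exp_neg 1] at h1
    have he := Real.exp_pos 1
    rw [hB]
    have h2 : Real.exp (-x) * τ x = 32 * Real.exp 1 * Real.exp 1 * (Real.exp (-x) * τ x *
        (Real.exp 1)⁻¹ * (Real.exp 1)⁻¹ * (1 / 32)) := by
      field_simp
    rw [h2]
    gcongr
  refine ⟨B + C₂, by positivity, fun u hu => abs_le.2 ⟨?_, ?_⟩⟩
  · have := h.neg_le_deviation hu
    linarith
  · have := main u hu
    rw [deviation]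
    linarith

theorem aestronglyMeasurable_deviation (h : LaplaceExtension τ A g D) :
    AEStronglyMeasurable (deviation τ A) (volume.restrict (Set.Ioi 0)) := by
  have h1 : AEMeasurable τ (volume.restrict (Set.Ioi 0)) :=
    aemeasurable_restrict_of_monotoneOn measurableSet_Ioi (h.mono.mono Set.Ioi_subset_Ici_self)
  have : AEMeasurable (deviation τ A) (volume.restrict (Set.Ioi 0)) := by
    unfold deviation
    fun_prop
  exact this.aestronglyMeasurable

/-- The limit σ → 0+. Boundedness of the deviation gives the majorant `C * kernel` on the left, and
boundedness of g on a compact strip gives the one on the right. -/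
theorem integral_deviation_mul_kernel_zero (h : LaplaceExtension τ A g D) {v w P : ℝ} (hv : 0 < v)
    (hw : 0 < w) {N : ℕ} (hN : Even N) (hP : 4 * v + N * w ≤ P) (x : ℝ) :
    ((2 * Real.pi * ∫ u in Set.Ioi (0 : ℝ), deviation τ A u * kernel v w N (x - u) : ℝ) : ℂ) =
    ∫ t in (-P)..P, (cutoff v w N 0 t : ℂ) *
      (g (Complex.I * t) * Complex.exp (t * x * Complex.I)) := by
  have hP0 : 0 ≤ P := le_trans (by positivity) hP
  obtain ⟨C, hC0, hC⟩ := h.exists_abs_deviation_le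
  obtain ⟨σ₀, hσ₀, G, hG0, hG⟩ := h.exists_bound_strip P
  have hk0 : ∀ y, 0 ≤ kernel v w N y := kernel_nonneg hv hN
  have hkc := continuous_kernel v w N
  have hkint : Integrable fun u => kernel v w N (x - u) := (integrable_kernel hv hN).comp_sub_left x
  have hnear : ∀ᶠ σ in 𝓝[>] (0 : ℝ), 0 < σ ∧ |σ| ≤ σ₀ := by
    filter_upwards [Ioc_mem_nhdsGT hσ₀] with σ hσ
    exact ⟨hσ.1, (abs_of_pos hσ.1).le.trans hσ.2⟩
  have hmeas := h.aestronglyMeasurable_deviation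
  have hL : Tendsto (fun σ : ℝ => ∫ u in Set.Ioi (0 : ℝ),
      deviation τ A u * Real.exp (-σ * u) * kernel v w N (x - u)) (𝓝[>] 0)
      (𝓝 (∫ u in Set.Ioi (0 : ℝ), deviation τ A u * kernel v w N (x - u))) := by
    refine tendsto_integral_filter_of_dominated_convergence (fun u => C * kernel v w N (x - u))
      ?_ ?_ (hkint.const_mul C).integrableOn ?_
    · refine Eventually.of_forall fun σ => (hmeas.mul ?_).mul ?_
      · exact (by fun_prop : Continuous fun u => Real.exp (-σ * u)).aestronglyMeasurable
      · exact (by fun_prop : Continuous fun u => kernel v w N (x - u)).aestronglyMeasurable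
    · filter_upwards [hnear] with σ hσ
      filter_upwards [ae_restrict_mem measurableSet_Ioi] with u hu
      have h1 : Real.exp (-σ * u) ≤ 1 := Real.exp_le_one_iff.2 (by
        have : 0 < σ * u := mul_pos hσ.1 hu
        linarith)
      rw [norm_mul, norm_mul, Real.norm_of_nonneg (Real.exp_pos _).le, Real.norm_of_nonneg (hk0 _),
        Real.norm_eq_abs]
      have h2 := hC u (le_of_lt hu)
      have h3 := hk0 (x - u)
      calc _ ≤ C * 1 * kernel v w N (x - u) := by gcongr
        _ = _ := by ring
    · refine Eventually.of_forall fun u => ?_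
      have : Continuous fun σ : ℝ => deviation τ A u * Real.exp (-σ * u) * kernel v w N (x - u) := by
        fun_prop
      have := (this.tendsto 0).mono_left (nhdsWithin_le_nhds (s := Set.Ioi 0))
      simpa using this
  have hcc := continuous_cutoff hv hw N 0
  have hR : Tendsto (fun σ : ℝ => ∫ t in (-P)..P, (cutoff v w N 0 t : ℂ) *
      (g (σ + Complex.I * t) * Complex.exp (t * x * Complex.I))) (𝓝[>] 0)
      (𝓝 (∫ t in (-P)..P, (cutoff v w N 0 t : ℂ) *
      (g (Complex.I * t) * Complex.exp (t * x * Complex.I)))) := by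
    refine intervalIntegral.tendsto_integral_filter_of_dominated_convergence (fun _ => G) ?_ ?_
      intervalIntegrable_const ?_
    · filter_upwards [hnear] with σ hσ
      rw [Set.uIoc_of_le (by linarith)]
      refine ContinuousOn.aestronglyMeasurable ?_ measurableSet_Ioc
      have hgc : ContinuousOn (fun t : ℝ => g (σ + Complex.I * t)) (Set.Ioc (-P) P) :=
        h.cont.comp (by fun_prop) fun t ht => (hG σ t hσ.2 (abs_le.2 ⟨ht.1.le, ht.2⟩)).1
      exact ContinuousOn.mul (by fun_prop) (hgc.mul (by fun_prop))
    · filter_upwards [hnear] with σ hσ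
      refine Eventually.of_forall fun t ht => ?_
      rw [Set.uIoc_of_le (by linarith)] at ht
      have h2 := (hG σ t hσ.2 (abs_le.2 ⟨ht.1.le, ht.2⟩)).2
      have h3 := (isCutoff_cutoff hv hw N (Nat.zero_le N)).bound t
      rw [pow_zero] at h3
      rw [norm_mul, norm_mul, show (t : ℂ) * x = ((t * x : ℝ) : ℂ) by push_cast; ring,
        Complex.norm_exp_ofReal_mul_I, mul_one, Complex.norm_real, Real.norm_eq_abs]
      calc _ ≤ 1 * G := by gcongr
        _ = G := one_mul G
    · refine Eventually.of_forall fun t ht => ?_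
      rw [Set.uIoc_of_le (by linarith)] at ht
      have ht' : |t| ≤ P := abs_le.2 ⟨ht.1.le, ht.2⟩
      have h0 : (Complex.I * t : ℂ) ∈ D := by
        simpa using (hG 0 t (by simpa using hσ₀.le) ht').1
      have hgt : Tendsto (fun σ : ℝ => g (σ + Complex.I * t)) (𝓝[>] 0) (𝓝 (g (Complex.I * t))) := by
        refine (h.cont _ h0).tendsto.comp (tendsto_nhdsWithin_iff.2 ⟨?_, ?_⟩)
        · have : Continuous fun σ : ℝ => (σ + Complex.I * t : ℂ) := by fun_prop
          have := (this.tendsto 0).mono_left (nhdsWithin_le_nhds (s := Set.Ioi 0))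
          simpa using this
        · filter_upwards [hnear] with σ hσ
          exact (hG σ t hσ.2 ht').1
      exact (hgt.mul_const _).const_mul _
  refine tendsto_nhds_unique ?_ hR
  have hL' := (Complex.continuous_ofReal.tendsto _).comp (hL.const_mul (2 * Real.pi))
  refine hL'.congr' ?_
  filter_upwards [hnear] with σ hσ
  exact h.integral_deviation_mul_kernel hv hw hP hσ.1 (fun t ht => (hG σ t hσ.2 ht).1) x

end LaplaceExtension

/-! ### Unsmoothing: from the convolution back to the deviation. -/

theorem integral_Ioi_comp_add_right (f : ℝ → ℝ) (η : ℝ) :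
    ∫ u in Set.Ioi (0 : ℝ), f (u + η) = ∫ u in Set.Ioi η, f u := by
  rw [← integral_indicator measurableSet_Ioi, ← integral_indicator measurableSet_Ioi,
    ← integral_add_right_eq_self (Set.indicator (Set.Ioi η) f) η]
  congr 1
  funext u
  simp [Set.indicator_apply]

theorem kernel_le_of_one_le_abs {v w : ℝ} {N : ℕ} (hv : 1 ≤ v) {y : ℝ} (hy : 1 ≤ |y|) :
    kernel v w N y ≤ 2 := by
  have hv0 : 0 < v := by linarith
  refine (kernel_le' hv0 y).trans ?_
  have h1 : v ≤ 1 + (v * y) ^ 2 := by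
    have : (v * y) ^ 2 = v ^ 2 * |y| ^ 2 := by rw [mul_pow, sq_abs]
    have h2 : 1 ≤ |y| ^ 2 := one_le_pow₀ hy
    nlinarith [sq_nonneg v]
  have h2 : v * (1 + (v * y) ^ 2)⁻¹ ≤ 1 := by
    rw [← div_eq_mul_inv]
    exact (div_le_one (by positivity)).2 h1
  calc v / Real.pi * (4 * (1 + (v * y) ^ 2)⁻¹) = 4 / Real.pi * (v * (1 + (v * y) ^ 2)⁻¹) := by ring
    _ ≤ 4 / Real.pi * 1 := by gcongr
    _ ≤ 2 := by
      rw [mul_one, div_le_iff₀ Real.pi_pos]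
      linarith [Real.pi_gt_three]

namespace LaplaceExtension

variable {τ : ℝ → ℝ} {A : ℝ} {g : ℂ → ℂ} {D : Set ℂ}

theorem integrableOn_deviation_mul_kernel (h : LaplaceExtension τ A g D) {v w : ℝ} (hv : 0 < v)
    {N : ℕ} (hN : Even N) (y : ℝ) :
    IntegrableOn (fun u => deviation τ A u * kernel v w N (y - u)) (Set.Ioi 0) := by
  obtain ⟨C, -, hC⟩ := h.exists_abs_deviation_le
  have hkint : Integrable fun u => kernel v w N (y - u) := (integrable_kernel hv hN).comp_sub_left y
  refine hkint.integrableOn.bdd_mul (c := C) h.aestronglyMeasurable_deviation ?_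
  filter_upwards [ae_restrict_mem measurableSet_Ioi] with u hu
  exact hC u (le_of_lt hu)

/-- A bound for the smoothed deviation controls the growth of `τ` on intervals of length `1 / v`. -/
theorem exp_neg_mul_sub_le (h : LaplaceExtension τ A g D) {C : ℝ} (hC0 : 0 ≤ C)
    (hC : ∀ u : ℝ, 0 ≤ u → |deviation τ A u| ≤ C) {v w : ℝ} {N : ℕ} (hv : 1 ≤ v) (hw : 0 < w)
    (hN : Even N) (hN8 : 8 ≤ N) (hwv : w * N = 2 * v) {y ε : ℝ} (hy : 2 ≤ y) (hε : 1 / v ≤ ε)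
    (hk : ∀ z, |z - y| ≤ 1 →
      |∫ u in Set.Ioi (0 : ℝ), deviation τ A u * kernel v w N (z - u)| ≤ ε) :
    Real.exp (-y) * (τ y - τ (y - 1 / v / 2)) ≤ 64 * (4 + 6 * C + 8 * A) * ε := by
  have hv0 : 0 < v := by linarith
  set η : ℝ := 1 / v with hη
  have hη0 : 0 < η := by positivity
  have hη1 : η ≤ 1 := by rw [hη, div_le_one hv0]; exact hv
  have hA := h.pos
  set k := kernel v w N with hkdef
  have hk0 : ∀ y, 0 ≤ k y := kernel_nonneg hv0 hN
  have hkc : Continuous k := continuous_kernel v w N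
  have hkint : ∀ y, Integrable fun u => k (y - u) := fun y =>
    (integrable_kernel hv0 hN).comp_sub_left y
  set J : ℝ → ℝ := fun z => ∫ u in Set.Ioi (0 : ℝ), deviation τ A u * k (z - u) with hJ
  have hint := fun z => h.integrableOn_deviation_mul_kernel (w := w) hv0 hN z
  -- Translation by η loses only the piece over (0, η], where the kernel is evaluated at distance at
  -- least 1 from 0 and is at most 2.
  have hshift : ∫ u in Set.Ioi (0 : ℝ), deviation τ A (u + η) * k (y - u) =
      J (y + η) - ∫ u in Set.Ioc 0 η, deviation τ A u * k (y + η - u) := by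
    have h1 := integral_Ioi_comp_add_right (fun u => deviation τ A u * k (y + η - u)) η
    have h2 : ∀ u, y + η - (u + η) = y - u := fun u => by ring
    simp only [h2] at h1
    rw [h1, hJ]
    simp only
    rw [← Set.Ioc_union_Ioi_eq_Ioi hη0.le, setIntegral_union (Set.Ioc_disjoint_Ioi le_rfl)
      measurableSet_Ioi ((hint (y + η)).mono_set Set.Ioc_subset_Ioi_self)
      ((hint (y + η)).mono_set (Set.Ioi_subset_Ioi hη0.le))]
    ring
  have hsmall : |∫ u in Set.Ioc 0 η, deviation τ A u * k (y + η - u)| ≤ 2 * C * η := by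
    have h1 : ∀ u ∈ Set.Ioc 0 η, ‖deviation τ A u * k (y + η - u)‖ ≤ C * 2 := by
      intro u hu
      rw [norm_mul, Real.norm_of_nonneg (hk0 _), Real.norm_eq_abs]
      have h2 := hC u hu.1.le
      have h3 : k (y + η - u) ≤ 2 := kernel_le_of_one_le_abs hv (le_abs.2 (Or.inl (by
        linarith [hu.2])))
      have h4 := hk0 (y + η - u)
      gcongr
    have := norm_setIntegral_le_of_norm_le_const (μ := volume) (s := Set.Ioc 0 η)
      (by simp) h1
    rw [Real.norm_eq_abs] at this
    simp only [Measure.real, Real.volume_Ioc, sub_zero, ENNReal.toReal_ofReal hη0.le] at this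
    linarith
  have hintS : IntegrableOn (fun u => deviation τ A (u + η) * k (y - u)) (Set.Ioi 0) := by
    have h1 : IntegrableOn (fun u => deviation τ A u * k (y + η - u)) (Set.Ioi (0 + η)) :=
      (hint (y + η)).mono_set (Set.Ioi_subset_Ioi (by linarith))
    have h2 := (measurePreserving_add_right volume η).integrableOn_comp_preimage
      (measurableEmbedding_addRight η) (f := fun u => deviation τ A u * k (y + η - u))
      (s := Set.Ioi (0 + η))
    have h3 := h2.2 h1
    have h4 : (fun x => x + η) ⁻¹' Set.Ioi (0 + η) = Set.Ioi 0 := by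
      ext u
      simp
    rw [h4] at h3
    refine h3.congr (Eventually.of_forall fun u => ?_)
    simp only [Function.comp]
    rw [show y + η - (u + η) = y - u by ring]
  -- The increment of τ is expressed through the deviation at u + η and at u. The leftover A(e^η -
  -- 1) is O(1/v), hence O(ε).
  have hDeq : ∀ u, Real.exp (-u) * (τ (u + η) - τ u) * k (y - u) =
      Real.exp η * (deviation τ A (u + η) * k (y - u)) - deviation τ A u * k (y - u) +
        A * (Real.exp η - 1) * k (y - u) := by
    intro u
    have : Real.exp (-u) = Real.exp η * Real.exp (-(u + η)) := by
      rw [← Real.exp_add]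
      congr 1
      ring
    have e : Real.exp (-u) * τ (u + η) = Real.exp η * (Real.exp (-(u + η)) * τ (u + η)) := by
      rw [← mul_assoc, ← this]
    simp only [deviation]
    linear_combination k (y - u) * e
  have hI1 : IntegrableOn (fun u => Real.exp η * (deviation τ A (u + η) * k (y - u)) -
      deviation τ A u * k (y - u)) (Set.Ioi 0) := (hintS.const_mul _).sub (hint y)
  have hI2 : IntegrableOn (fun u => A * (Real.exp η - 1) * k (y - u)) (Set.Ioi 0) :=
    ((hkint y).const_mul _).integrableOn
  have hI : IntegrableOn (fun u => Real.exp (-u) * (τ (u + η) - τ u) * k (y - u)) (Set.Ioi 0) := by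
    simp only [hDeq]
    exact hI1.add hI2
  have he1 : Real.exp η - 1 ≤ 2 * η := by
    have := Real.abs_exp_sub_one_le (x := η) (by rwa [abs_of_pos hη0])
    rw [abs_of_pos hη0] at this
    exact (le_abs_self _).trans this
  have he0 : 0 ≤ Real.exp η - 1 := by linarith [Real.add_one_le_exp η]
  have hup : ∫ u in Set.Ioi (0 : ℝ), Real.exp (-u) * (τ (u + η) - τ u) * k (y - u) ≤
      (4 + 6 * C + 8 * A) * ε := by
    simp only [hDeq]
    rw [integral_add hI1 hI2, integral_sub (hintS.const_mul _) (hint y), integral_const_mul,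
      integral_const_mul, hshift]
    have h1 : |J (y + η)| ≤ ε := hk _ (by rw [add_sub_cancel_left, abs_of_pos hη0]; exact hη1)
    have h2 : |J y| ≤ ε := hk _ (by simp)
    have h3 : ∫ u in Set.Ioi (0 : ℝ), k (y - u) ≤ 4 := by
      calc _ ≤ ∫ u, k (y - u) := setIntegral_le_integral (hkint y)
            (Eventually.of_forall fun u => hk0 _)
        _ = ∫ u, k u := integral_sub_left_eq_self _ _ _
        _ ≤ 4 := integral_kernel_le hv0 hN
    have h4 : J (y + η) - ∫ u in Set.Ioc 0 η, deviation τ A u * k (y + η - u) ≤ ε + 2 * C * η := by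
      have := (abs_le.1 hsmall).1
      have := (abs_le.1 h1).2
      linarith
    have h5 : -J y ≤ ε := by linarith [(abs_le.1 h2).1]
    have hε0 : 0 ≤ ε := hη0.le.trans hε
    have h6 : Real.exp η * (J (y + η) - ∫ u in Set.Ioc 0 η, deviation τ A u * k (y + η - u)) ≤
        3 * (ε + 2 * C * η) :=
      (mul_le_mul_of_nonneg_left h4 (Real.exp_pos η).le).trans
        (mul_le_mul_of_nonneg_right (by linarith) (by positivity))
    have h7 : A * (Real.exp η - 1) * ∫ u in Set.Ioi (0 : ℝ), k (y - u) ≤ A * (2 * η) * 4 := by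
      have : 0 ≤ ∫ u in Set.Ioi (0 : ℝ), k (y - u) := integral_nonneg fun u => hk0 _
      gcongr
    have h8 : C * η ≤ C * ε := by gcongr
    have h9 : A * η ≤ A * ε := by gcongr
    change _ - J y + _ ≤ _
    nlinarith
  -- For u in (y - η, y - η/2] the interval from u to u + η covers that from y - η/2 to y. The range
  -- of u has length η/2 and the kernel is at least v/32 there, whence 1/64.
  have hlow : Real.exp (-y) * (τ y - τ (y - η / 2)) * (1 / 64) ≤
      ∫ u in Set.Ioi (0 : ℝ), Real.exp (-u) * (τ (u + η) - τ u) * k (y - u) := by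
    have hsub : Set.Ioc (y - η) (y - η / 2) ⊆ Set.Ioi 0 := fun u hu => by
      have := hu.1
      simp only [Set.mem_Ioi]
      linarith
    have hτ0 : 0 ≤ τ y - τ (y - η / 2) := sub_nonneg.2 (h.mono (Set.mem_Ici.2 (by linarith))
      (Set.mem_Ici.2 (by linarith)) (by linarith))
    calc _ = ∫ u in Set.Ioc (y - η) (y - η / 2),
          Real.exp (-y) * (τ y - τ (y - η / 2)) * (v / 32) := by
          rw [setIntegral_const, smul_eq_mul]
          simp only [Measure.real, Real.volume_Ioc]
          rw [ENNReal.toReal_ofReal (by linarith), hη]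
          field_simp
          ring
      _ ≤ ∫ u in Set.Ioc (y - η) (y - η / 2), Real.exp (-u) * (τ (u + η) - τ u) * k (y - u) := by
        refine setIntegral_mono_on (integrable_const _) (hI.mono_set hsub) measurableSet_Ioc
          fun u hu => ?_
        have hu0 : 0 < u := hsub hu
        have h1 : τ y ≤ τ (u + η) := h.mono (Set.mem_Ici.2 (by linarith))
          (Set.mem_Ici.2 (by linarith)) (by linarith [hu.1])
        have h2 : τ u ≤ τ (y - η / 2) := h.mono (Set.mem_Ici.2 (by linarith))
          (Set.mem_Ici.2 (by linarith)) hu.2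
        have h3 : v / 32 ≤ k (y - u) := by
          refine le_kernel hv0 hw hwv hN8 ?_
          rw [abs_of_nonneg (by linarith [hu.2])]
          calc v * (y - u) ≤ v * η := by gcongr; linarith [hu.1]
            _ = 1 := by rw [hη]; field_simp
        have h4 : Real.exp (-y) ≤ Real.exp (-u) := Real.exp_le_exp.2 (by linarith [hu.2])
        have h5 : τ y - τ (y - η / 2) ≤ τ (u + η) - τ u := by linarith
        have h6 : 0 ≤ τ (u + η) - τ u := hτ0.trans h5
        gcongr
      _ ≤ _ := setIntegral_mono_set hI (by
        filter_upwards [ae_restrict_mem measurableSet_Ioi] with u hu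
        have h1 : 0 ≤ τ (u + η) - τ u := sub_nonneg.2 (h.mono (Set.mem_Ici.2 (le_of_lt hu))
          (Set.mem_Ici.2 (by have : (0 : ℝ) < u := hu; linarith)) (by linarith))
        have h2 := hk0 (y - u)
        simp only [Pi.zero_apply]
        positivity) hsub.eventuallyLE
  linarith

theorem _root_.sub_le_nat_mul {τ : ℝ → ℝ} {a η B x : ℝ} (hη : 0 < η)
    (hB : ∀ y, a ≤ y → y ≤ x → τ y - τ (y - η) ≤ B) (n : ℕ) {b : ℝ} (hbx : b ≤ x)
    (hb : a ≤ b - (n - 1) * η) : τ b - τ (b - n * η) ≤ n * B := by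
  induction n with
  | zero => simp
  | succ n ih =>
    push_cast at hb ⊢
    rw [add_sub_cancel_right] at hb
    have h1 := ih (by linarith)
    have h2 := hB (b - n * η) hb (by
      have : 0 ≤ n * η := by positivity
      linarith)
    rw [show b - (n + 1) * η = b - n * η - η by ring]
    linarith

theorem sub_le_of_steps (h : LaplaceExtension τ A g D) {a η B x : ℝ} (hη : 0 < η) (ha : η ≤ a)
    (hB0 : 0 ≤ B) (hB : ∀ y, a ≤ y → y ≤ x → τ y - τ (y - η) ≤ B) {b c : ℝ} (hac : a ≤ c)
    (hcb : c ≤ b) (hbx : b ≤ x) : τ b - τ c ≤ ((b - c) / η + 1) * B := by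
  set n : ℕ := ⌈(b - c) / η⌉₊ with hn
  have h0 : 0 ≤ (b - c) / η := div_nonneg (by linarith) hη.le
  have h1 : (b - c) / η ≤ n := Nat.le_ceil _
  have h2 : (n : ℝ) < (b - c) / η + 1 := Nat.ceil_lt_add_one h0
  have h3 : (n - 1) * η ≤ b - c := by
    rw [← le_div_iff₀ hη]
    linarith
  have h4 := sub_le_nat_mul hη hB n hbx (by linarith)
  have h5 : b - n * η ≤ c := by
    rw [div_le_iff₀ hη] at h1
    linarith
  have h6 : 0 ≤ b - n * η := by nlinarith
  have h7 : τ (b - n * η) ≤ τ c := h.mono h6 (h6.trans h5) h5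
  nlinarith

/-- Unsmoothing: a bound for the smoothed deviation near `x` gives one for the deviation at `x`. -/
theorem exists_abs_deviation_le_of_kernel (h : LaplaceExtension τ A g D) :
    ∃ C : ℝ, 0 ≤ C ∧ ∀ (v w : ℝ) (N : ℕ) (x ε : ℝ), 1 ≤ v → 0 < w → Even N → 8 ≤ N →
      w * N = 2 * v → 3 ≤ x → 1 / v ≤ ε →
      (∀ z, |z - x| ≤ 2 →
        |∫ u in Set.Ioi (0 : ℝ), deviation τ A u * kernel v w N (z - u)| ≤ ε) →
      |deviation τ A x| ≤ C * ε := by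
  obtain ⟨C, hC0, hC⟩ := h.exists_abs_deviation_le
  have hA := h.pos
  set C₁ : ℝ := 64 * (4 + 6 * C + 8 * A) with hC₁
  have hC₁0 : 0 ≤ C₁ := by positivity
  set C₃ : ℝ := 2 * Real.exp 2 * C₁ + 2 * (C + A) with hC₃
  have hC₃0 : 0 ≤ C₃ := by positivity
  refine ⟨32 * (1 + 8 * C₃), by positivity, fun v w N x ε hv hw hN hN8 hwv hx hε hk => ?_⟩
  have hv0 : 0 < v := by linarith
  have hε0 : 0 < ε := lt_of_lt_of_le (by positivity) hε
  have hεv : 1 ≤ ε * v := by rwa [div_le_iff₀ hv0] at hε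
  set η : ℝ := 1 / v / 2 with hη
  have hη0 : 0 < η := by positivity
  have hη1 : η ≤ 1 := by
    rw [hη, div_div, div_le_one (by positivity)]
    linarith
  set k := kernel v w N with hkdef
  have hk0 : ∀ y, 0 ≤ k y := kernel_nonneg hv0 hN
  have hkint : ∀ y, Integrable fun u => k (y - u) := fun y =>
    (integrable_kernel hv0 hN).comp_sub_left y
  have hstep : ∀ y, x - 1 ≤ y → y ≤ x + 1 → τ y - τ (y - η) ≤ Real.exp (x + 1) * (C₁ * ε) := by
    intro y hy1 hy2
    have h1 := h.exp_neg_mul_sub_le hC0 hC hv hw hN hN8 hwv (y := y) (by linarith) hε fun z hz =>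
      hk z (by
        rw [abs_le] at hz ⊢
        constructor <;> linarith [hz.1, hz.2])
    have h2 : τ y - τ (y - η) = Real.exp y * (Real.exp (-y) * (τ y - τ (y - η))) := by
      rw [← mul_assoc, ← Real.exp_add]
      simp
    rw [h2]
    have h3 : Real.exp y ≤ Real.exp (x + 1) := Real.exp_le_exp.2 hy2
    calc _ ≤ Real.exp y * (C₁ * ε) := by gcongr
      _ ≤ _ := by gcongr
  have hinc : ∀ c b, x - 1 ≤ c → c ≤ b → b ≤ x + 1 →
      τ b - τ c ≤ (2 * v * (b - c) + 1) * (Real.exp (x + 1) * (C₁ * ε)) := by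
    intro c b hc hcb hb
    have := h.sub_le_of_steps hη0 (by linarith) (by positivity) hstep hc hcb hb
    rwa [show (b - c) / η = 2 * v * (b - c) by rw [hη]; field_simp] at this
  -- Within distance 1 this follows from the increments of τ; beyond it, ε v ≥ 1 makes the trivial
  -- bound 2C sufficient. The linear growth in v|x - u| is then integrated against the first moment
  -- 2/v of the kernel.
  have hdiff : ∀ u, 0 ≤ u →
      |deviation τ A x - deviation τ A u| ≤ C₃ * ε * (1 + v * |x - u|) := by
    intro u hu
    have habs := abs_nonneg (x - u)
    rcases le_or_gt |x - u| 1 with h1 | h1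
    · have h2 := abs_le.1 h1
      have hτ : |τ x - τ u| ≤ (2 * v * |x - u| + 1) * (Real.exp (x + 1) * (C₁ * ε)) := by
        rcases le_total u x with h3 | h3
        · rw [abs_of_nonneg (sub_nonneg.2 (h.mono hu (hu.trans h3) h3)),
            abs_of_nonneg (sub_nonneg.2 h3)]
          exact hinc u x (by linarith) h3 (by linarith)
        · rw [abs_sub_comm, abs_sub_comm x, abs_of_nonneg (sub_nonneg.2 (h.mono
            (Set.mem_Ici.2 (by linarith)) hu h3)), abs_of_nonneg (sub_nonneg.2 h3)]
          exact hinc x u (by linarith) h3 (by linarith)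
      have hid : deviation τ A x - deviation τ A u = Real.exp (-x) * (τ x - τ u) +
          (Real.exp (u - x) - 1) * (deviation τ A u + A) := by
        have : Real.exp (-x) = Real.exp (u - x) * Real.exp (-u) := by
          rw [← Real.exp_add]
          congr 1
          ring
        simp only [deviation]
        rw [mul_sub]
        nth_rewrite 3 [this]
        ring
      have h3 : |Real.exp (u - x) - 1| ≤ 2 * |x - u| := by
        rw [abs_sub_comm x u]
        exact Real.abs_exp_sub_one_le (by rwa [abs_sub_comm])
      have h4 : |deviation τ A u + A| ≤ C + A :=
        (abs_add_le _ _).trans (by rw [abs_of_pos hA]; linarith [hC u hu])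
      have h5 : Real.exp (-x) * Real.exp (x + 1) ≤ Real.exp 2 := by
        rw [← Real.exp_add]
        exact Real.exp_le_exp.2 (by linarith)
      rw [hid]
      calc _ ≤ |Real.exp (-x) * (τ x - τ u)| + |(Real.exp (u - x) - 1) * (deviation τ A u + A)| :=
            abs_add_le _ _
        _ = Real.exp (-x) * |τ x - τ u| + |Real.exp (u - x) - 1| * |deviation τ A u + A| := by
          rw [abs_mul, abs_mul, abs_of_pos (Real.exp_pos _)]
        _ ≤ Real.exp (-x) * ((2 * v * |x - u| + 1) * (Real.exp (x + 1) * (C₁ * ε))) +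
            2 * |x - u| * (C + A) := by gcongr
        _ = (Real.exp (-x) * Real.exp (x + 1)) * ((2 * v * |x - u| + 1) * (C₁ * ε)) +
            2 * (C + A) * |x - u| * 1 := by ring
        _ ≤ Real.exp 2 * ((2 * v * |x - u| + 1) * (C₁ * ε)) +
            2 * (C + A) * |x - u| * (ε * v) := by gcongr
        _ ≤ Real.exp 2 * ((2 * v * |x - u| + 2) * (C₁ * ε)) +
            2 * (C + A) * (ε * (1 + v * |x - u|)) := by
          have e1 : 2 * (C + A) * |x - u| * (ε * v) = 2 * (C + A) * (ε * (v * |x - u|)) := by ring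
          rw [e1]
          gcongr <;> linarith
        _ = C₃ * ε * (1 + v * |x - u|) := by
          rw [hC₃]
          ring
    · have h2 : |deviation τ A x - deviation τ A u| ≤ 2 * C :=
        (abs_sub _ _).trans (by linarith [hC u hu, hC x (by linarith)])
      have h3 : 1 ≤ ε * (1 + v * |x - u|) := by
        have : ε * v * 1 ≤ ε * v * |x - u| := by gcongr
        nlinarith
      have h4 : 2 * C ≤ C₃ := by
        have : 0 ≤ 2 * Real.exp 2 * C₁ := by positivity
        rw [hC₃]
        linarith
      calc _ ≤ 2 * C * 1 := by linarith
        _ ≤ C₃ * (ε * (1 + v * |x - u|)) := by gcongr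
        _ = _ := by ring
  have hintk := h.integrableOn_deviation_mul_kernel (w := w) hv0 hN x
  have hkx : IntegrableOn (fun u => k (x - u)) (Set.Ioi 0) := (hkint x).integrableOn
  have hmaj : Integrable fun u => C₃ * ε * (1 + v * |x - u|) * k (x - u) := by
    have h1 : Integrable fun u => |x - u| * k (x - u) :=
      (integrable_abs_mul_kernel hv0 hN).comp_sub_left x
    refine (((hkint x).add (h1.const_mul v)).const_mul (C₃ * ε)).congr
      (Eventually.of_forall fun u => ?_)
    simp only [Pi.add_apply]
    ring
  have hmajI : ∫ u, C₃ * ε * (1 + v * |x - u|) * k (x - u) ≤ C₃ * ε * 8 := by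
    have h1 : Integrable fun u => |u| * k u := integrable_abs_mul_kernel hv0 hN
    have h2 := integral_abs_mul_kernel_le (w := w) hv0 hN
    have h3 := integral_kernel_le (w := w) hv0 hN
    rw [integral_sub_left_eq_self (fun u => C₃ * ε * (1 + v * |u|) * k u)]
    have h4 : ∀ u, C₃ * ε * (1 + v * |u|) * k u = C₃ * ε * (k u + v * (|u| * k u)) := fun u => by
      ring
    simp only [h4]
    rw [integral_const_mul, integral_add (integrable_kernel hv0 hN) (h1.const_mul v),
      integral_const_mul]
    have h5 : v * ∫ u, |u| * k u ≤ v * (2 / v) := by gcongr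
    rw [mul_div_cancel₀ _ hv0.ne'] at h5
    gcongr
    linarith
  have hid : deviation τ A x * ∫ u in Set.Ioi (0 : ℝ), k (x - u) =
      (∫ u in Set.Ioi (0 : ℝ), deviation τ A u * k (x - u)) +
      ∫ u in Set.Ioi (0 : ℝ), (deviation τ A x - deviation τ A u) * k (x - u) := by
    have h1 : ∀ u, (deviation τ A x - deviation τ A u) * k (x - u) =
        deviation τ A x * k (x - u) - deviation τ A u * k (x - u) := fun u => by ring
    simp only [h1]
    rw [integral_sub (hkx.const_mul _) hintk, integral_const_mul]
    ring
  have hrest : |∫ u in Set.Ioi (0 : ℝ), (deviation τ A x - deviation τ A u) * k (x - u)| ≤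
      C₃ * ε * 8 := by
    calc _ ≤ ∫ u in Set.Ioi (0 : ℝ), C₃ * ε * (1 + v * |x - u|) * k (x - u) := by
          rw [← Real.norm_eq_abs]
          refine norm_integral_le_of_norm_le hmaj.integrableOn ?_
          filter_upwards [ae_restrict_mem measurableSet_Ioi] with u hu
          rw [norm_mul, Real.norm_of_nonneg (hk0 _)]
          exact mul_le_mul_of_nonneg_right (hdiff u (le_of_lt hu)) (hk0 _)
      _ ≤ ∫ u, C₃ * ε * (1 + v * |x - u|) * k (x - u) := setIntegral_le_integral hmaj
          (Eventually.of_forall fun u => mul_nonneg (by positivity) (hk0 _))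
      _ ≤ _ := hmajI
  have hmass : 1 / 32 ≤ ∫ u in Set.Ioi (0 : ℝ), k (x - u) := by
    have hinv : 1 / v ≤ 1 := (div_le_one hv0).2 hv
    have hsub : Set.Ioc (x - 1 / v) x ⊆ Set.Ioi 0 := fun u hu => by
      have := hu.1
      simp only [Set.mem_Ioi]
      linarith
    calc (1 / 32 : ℝ) = ∫ u in Set.Ioc (x - 1 / v) x, v / 32 := by
          rw [setIntegral_const, smul_eq_mul]
          simp only [Measure.real, Real.volume_Ioc]
          rw [sub_sub_cancel, ENNReal.toReal_ofReal (by positivity)]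
          field_simp
      _ ≤ ∫ u in Set.Ioc (x - 1 / v) x, k (x - u) := by
        refine setIntegral_mono_on (integrable_const _) (hkx.mono_set hsub) measurableSet_Ioc
          fun u hu => le_kernel hv0 hw hwv hN8 ?_
        rw [abs_of_nonneg (by linarith [hu.2])]
        calc v * (x - u) ≤ v * (1 / v) := by gcongr; linarith [hu.1]
          _ = 1 := by field_simp
      _ ≤ _ := setIntegral_mono_set hkx (Eventually.of_forall fun u => hk0 _) hsub.eventuallyLE
  have h1 : |deviation τ A x| * ∫ u in Set.Ioi (0 : ℝ), k (x - u) ≤ ε + C₃ * ε * 8 := by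
    have h2 : |deviation τ A x * ∫ u in Set.Ioi (0 : ℝ), k (x - u)| ≤ ε + C₃ * ε * 8 := by
      rw [hid]
      exact (abs_add_le _ _).trans (add_le_add (hk x (by simp)) hrest)
    rwa [abs_mul, abs_of_nonneg (le_trans (by norm_num) hmass)] at h2
  have h2 : |deviation τ A x| * (1 / 32) ≤ ε + C₃ * ε * 8 :=
    (mul_le_mul_of_nonneg_left hmass (abs_nonneg _)).trans h1
  linarith

end LaplaceExtension

/-! ### The region Ω_M and the contour estimate. -/

/-- The standing assumptions on `M`. -/
structure IsWidth (M : ℝ → ℝ) : Prop where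
  cont : ContinuousOn M (Set.Ici 0)
  mono : MonotoneOn M (Set.Ici 0)
  pos : ∀ t ≥ 0, 0 < M t

namespace IsWidth

variable {M : ℝ → ℝ}

theorem continuous_comp_abs (hM : IsWidth M) : Continuous fun t => M |t| :=
  hM.cont.comp_continuous continuous_abs fun t => abs_nonneg t

theorem pos_abs (hM : IsWidth M) (t : ℝ) : 0 < M |t| := hM.pos _ (abs_nonneg t)

theorem one_div_le (hM : IsWidth M) {a b : ℝ} (ha : 0 ≤ a) (hab : a ≤ b) : 1 / M b ≤ 1 / M a :=
  one_div_le_one_div_of_le (hM.pos a ha) (hM.mono ha (ha.trans hab) hab)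

theorem isOpen (hM : IsWidth M) : IsOpen {s : ℂ | |s.re| < 1 / M |s.im|} := by
  have h1 : Continuous fun s : ℂ => 1 / M |s.im| := by
    have := hM.continuous_comp_abs.comp Complex.continuous_im
    exact continuous_const.div this fun s => (hM.pos_abs s.im).ne'
  exact isOpen_lt (by fun_prop) h1

theorem isClosed_Omega (hM : IsWidth M) : IsClosed (Omega M) := by
  have h1 : Continuous fun s : ℂ => 1 / M |s.im| := by
    have := hM.continuous_comp_abs.comp Complex.continuous_im
    exact continuous_const.div this fun s => (hM.pos_abs s.im).ne'
  exact isClosed_le (by fun_prop) h1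

theorem subset_interior (hM : IsWidth M) :
    {s : ℂ | |s.re| < 1 / M |s.im|} ⊆ interior (Omega M) :=
  interior_maximal (fun s (hs : |s.re| < 1 / M |s.im|) =>
    show |s.re| ≤ 1 / M |s.im| from hs.le) hM.isOpen

theorem strip (hM : IsWidth M) (P : ℝ) : ∃ σ₀ > 0, ∀ σ t : ℝ, |σ| ≤ σ₀ → |t| ≤ P →
    (σ + Complex.I * t : ℂ) ∈ Omega M := by
  refine ⟨1 / M |P|, one_div_pos.2 (hM.pos_abs P), fun σ t hσ ht => ?_⟩
  have h1 : 1 / M |P| ≤ 1 / M |t| := hM.one_div_le (abs_nonneg t) (ht.trans (le_abs_self P))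
  simpa [Omega] using hσ.trans (by simpa using h1)

end IsWidth

/-- Supplies the number N = n + 1 of averages: even for a non-negative kernel, at least 8 for its
lower bound near 0. -/
theorem exists_even_nat_near {y : ℝ} (hy : 8 ≤ y) :
    ∃ n : ℕ, Even (n + 1) ∧ 8 ≤ n + 1 ∧ y ≤ (n + 1 : ℕ) ∧ ((n + 1 : ℕ) : ℝ) ≤ y + 2 := by
  have h1 : y / 2 ≤ ⌈y / 2⌉₊ := Nat.le_ceil _
  have h2 : (⌈y / 2⌉₊ : ℝ) < y / 2 + 1 := Nat.ceil_lt_add_one (by linarith)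
  have h3 : 4 ≤ ⌈y / 2⌉₊ := by
    have : (4 : ℝ) ≤ ⌈y / 2⌉₊ := by linarith
    exact_mod_cast this
  refine ⟨2 * ⌈y / 2⌉₊ - 1, ?_⟩
  rw [Nat.sub_add_cancel (by omega)]
  refine ⟨even_two_mul _, by omega, ?_, ?_⟩ <;> push_cast <;> linarith

theorem nat_mul_exp_le {n : ℕ} (hn : 8 ≤ n + 1) :
    ((n + 1 : ℕ) : ℝ) * Real.exp (-4) ^ n ≤ Real.exp (-2 * (n + 1 : ℕ)) := by
  have h1 : ((n + 1 : ℕ) : ℝ) ≤ Real.exp (n + 1 : ℕ) := by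
    linarith [Real.add_one_le_exp ((n + 1 : ℕ) : ℝ)]
  have hn' : (7 : ℝ) ≤ n := by
    have : 7 ≤ n := by omega
    exact_mod_cast this
  rw [← Real.exp_nat_mul]
  calc _ ≤ Real.exp (n + 1 : ℕ) * Real.exp (n * -4) := by gcongr
    _ = Real.exp ((n + 1 : ℕ) + n * -4) := by rw [Real.exp_add]
    _ ≤ _ := by
      refine Real.exp_le_exp.2 ?_
      push_cast
      linarith

/-- With N = n + 1 the left side is a constant times κN (8N/(Rz))^n. Since 8N ≤ 10xδ and z ≥ x/3,
the base is at most 30δ/R ≤ e^{-4}. Then N e^{-4n} ≤ e^{-2N}, and N ≥ xδ ≥ log(Rκ). -/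
theorem area_term_le {x z δ R κ d₀ B : ℝ} {n : ℕ} (hn : 8 ≤ n + 1) (hR : 0 < R) (hκ : 0 < κ)
    (hd₀ : 0 ≤ d₀) (hB : 0 ≤ B) (hδ : 0 < δ) (hx : 3 ≤ x) (hz : |z - x| ≤ 2) (hxδ : 8 ≤ x * δ)
    (hn1 : x * δ ≤ (n + 1 : ℕ)) (hn2 : ((n + 1 : ℕ) : ℝ) ≤ x * δ + 2)
    (hRδ : 30 * δ / R ≤ Real.exp (-4)) (hexp : Real.log R + Real.log κ ≤ x * δ) :
    2 * (R / 2) * (d₀ * (B * κ) * ((R / (8 * (n + 1 : ℕ)))⁻¹ ^ (n + 1) * (z ^ n)⁻¹)) ≤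
      8 * d₀ * B / R := by
  have hz3 : x / 3 ≤ z := by linarith [(abs_le.1 hz).1]
  have hz0 : 0 < z := by linarith
  have hN0 : (0 : ℝ) < (n + 1 : ℕ) := by positivity
  have hq : 8 * ((n + 1 : ℕ) : ℝ) / R / z ≤ Real.exp (-4) := by
    refine le_trans ?_ hRδ
    rw [div_div, div_le_div_iff₀ (by positivity) hR]
    have h1 : 8 * ((n + 1 : ℕ) : ℝ) ≤ 10 * (x * δ) := by linarith
    have h2 : 10 * (x * δ) ≤ 30 * δ * z := by nlinarith
    nlinarith
  have hNe := nat_mul_exp_le hn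
  have hκR : Real.exp (-2 * (n + 1 : ℕ)) ≤ (R * κ)⁻¹ := by
    rw [← Real.exp_log (mul_pos hR hκ), ← Real.exp_neg, Real.log_mul hR.ne' hκ.ne']
    exact Real.exp_le_exp.2 (by linarith)
  have hinv : (R / (8 * ((n + 1 : ℕ) : ℝ)))⁻¹ = 8 * ((n + 1 : ℕ) : ℝ) / R := inv_div _ _
  have hpow : (R / (8 * ((n + 1 : ℕ) : ℝ)))⁻¹ ^ (n + 1) * (z ^ n)⁻¹ =
      (8 * ((n + 1 : ℕ) : ℝ) / R) * (8 * ((n + 1 : ℕ) : ℝ) / R / z) ^ n := by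
    rw [hinv, div_pow _ z, pow_succ]
    ring
  rw [hpow]
  calc _ ≤ 2 * (R / 2) * (d₀ * (B * κ) * ((8 * ((n + 1 : ℕ) : ℝ) / R) * Real.exp (-4) ^ n)) := by
        gcongr
    _ = 8 * d₀ * B * κ * (((n + 1 : ℕ) : ℝ) * Real.exp (-4) ^ n) := by
        field_simp
    _ ≤ 8 * d₀ * B * κ * (R * κ)⁻¹ := by
        gcongr
        exact hNe.trans hκR
    _ = 8 * d₀ * B / R := by
        field_simp

/-- Deforming the contour to `Re s = -d(Im s)` bounds the deviation at `x`. -/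
theorem exists_deviation_le_of_contour {τ M : ℝ → ℝ} {A : ℝ} {g : ℂ → ℂ} (hM : IsWidth M)
    (h : LaplaceExtension τ A g (Omega M)) (hg : DifferentiableOn ℂ g (interior (Omega M)))
    {B : ℝ} (hB : 0 ≤ B) (C₁ : ℝ) :
    ∃ C R₀ : ℝ, ∀ (R x κ : ℝ) (d d' d'' ω : ℝ → ℝ), R₀ ≤ R → 3 ≤ x → 0 < κ →
      8 ≤ x * (1 / M R) → Real.log R + Real.log κ ≤ x * (1 / M R) →
      (∀ s ∈ Omega M, ‖s‖ ≤ R → ‖g s‖ ≤ B * κ) →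
      (∀ t, HasDerivAt d (d' t) t) → (∀ t, HasDerivAt d' (d'' t) t) →
      (∀ t ∈ Set.Icc (-(R / 2)) (R / 2), 0 ≤ d t ∧ d t < 1 / M |t| ∧ |d' t| ≤ 1 ∧
        ‖g (Complex.I * t - d t)‖ * Real.exp (-(x * (1 - 8 * (1 / M R) / R) * d t)) ≤ ω t) →
      IntervalIntegrable ω volume (-(R / 2)) (R / 2) →
      ∫ t in (-(R / 2))..(R / 2), ω t ≤ C₁ / R →
      |deviation τ A x| ≤ C / R := by
  obtain ⟨C, hC0, hC⟩ := h.exists_abs_deviation_le_of_kernel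
  set d₀ : ℝ := 1 / M 0 with hd₀
  have hM0 := hM.pos 0 le_rfl
  have hd₀0 : 0 < d₀ := one_div_pos.2 hM0
  set c : ℝ := Real.exp (18 * d₀) with hc
  refine ⟨C * (16 + |2 * (c * C₁)| + 8 * d₀ * B), max 16 (max (2 * d₀) (30 * d₀ * Real.exp 4)), ?_⟩
  intro R x κ d d' d'' ω hR hx hκ hxδ hexp hgb hd hd' hcont hω hωI
  have hR16 : 16 ≤ R := (le_max_left _ _).trans hR
  have hRd : 2 * d₀ ≤ R := ((le_max_left _ _).trans (le_max_right _ _)).trans hR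
  have hRe : 30 * d₀ * Real.exp 4 ≤ R := ((le_max_right _ _).trans (le_max_right _ _)).trans hR
  have hR0 : 0 < R := by linarith
  set δ : ℝ := 1 / M R with hδ
  have hδ0 : 0 < δ := one_div_pos.2 (hM.pos R hR0.le)
  have hδd : δ ≤ d₀ := hM.one_div_le le_rfl hR0.le
  obtain ⟨n, hev, hn8, hn1, hn2⟩ := exists_even_nat_near hxδ
  have hN0 : (0 : ℝ) < (n + 1 : ℕ) := by positivity
  have hv : 1 ≤ R / 16 := by linarith
  -- With v = R/16 and wN = R/8 = 2v the cutoff is supported in |t| ≤ 4v + wN = 3R/8 < R/2.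
  set w : ℝ := R / (8 * (n + 1 : ℕ)) with hw
  have hw0 : 0 < w := by positivity
  have hwN : w * (n + 1 : ℕ) = R / 8 := by
    rw [hw]
    field_simp
  have hRδ : 30 * δ / R ≤ Real.exp (-4) := by
    rw [Real.exp_neg, div_le_iff₀ hR0, inv_mul_eq_div, le_div_iff₀ (Real.exp_pos _)]
    calc _ ≤ 30 * d₀ * Real.exp 4 := by gcongr
      _ ≤ R := hRe
  have hP : 4 * (R / 16) + ((n + 1 : ℕ) : ℝ) * w < R / 2 := by
    rw [mul_comm ((n + 1 : ℕ) : ℝ), hwN]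
    linarith
  have hU := hM.isOpen
  have hgU : DifferentiableOn ℂ g {s : ℂ | |s.re| < 1 / M |s.im|} := hg.mono hM.subset_interior
  have hdle : ∀ t ∈ Set.Icc (-(R / 2)) (R / 2), d t ≤ d₀ := fun t ht =>
    (hcont t ht).2.1.le.trans (hM.one_div_le le_rfl (abs_nonneg t))
  refine (hC (R / 16) w (n + 1) x ((16 + |2 * (c * C₁)| + 8 * d₀ * B) / R) hv hw0 hev hn8
    (by rw [hwN]; ring) hx ?_ ?_).trans_eq (by ring)
  · rw [one_div_div]
    gcongr
    have := abs_nonneg (2 * (c * C₁))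
    have : 0 ≤ 8 * d₀ * B := by positivity
    linarith
  · intro z hz
    have hz0 : 0 < z := by linarith [(abs_le.1 hz).1]
    have hbound := norm_integral_cutoff_le hU hgU hd hd' (v := R / 16) (w := w) (P := R / 2) (x := z)
      (G := B * κ) (d₀ := d₀) (E := c * C₁ / R) (by linarith) hw0 (n := n) hP hz0 (by positivity)
      (fun t ht => ⟨(hcont t ht).1, hdle t ht⟩) (fun t ht => (hcont t ht).2.2.1)
      (fun t ht θ hθ => by
        have h1 := hcont t ht
        have h2 : 0 ≤ θ * d t := mul_nonneg hθ.1 h1.1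
        have h3 : θ * d t ≤ d t := mul_le_of_le_one_left h1.1 hθ.2
        have hU' : (Complex.I * t - θ * d t : ℂ) ∈ {s : ℂ | |s.re| < 1 / M |s.im|} := by
          simp only [Set.mem_ofPred_eq]
          simp only [Complex.sub_re, Complex.sub_im, Complex.mul_re, Complex.mul_im, Complex.I_re,
            Complex.I_im, Complex.ofReal_re, Complex.ofReal_im]
          simp only [zero_mul, one_mul, mul_zero, sub_zero, zero_sub, zero_add, add_zero, abs_neg]
          rw [abs_of_nonneg h2]
          exact h3.trans_lt h1.2.1
        refine ⟨hU', hgb _ (interior_subset (hM.subset_interior hU')) ?_⟩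
        refine (norm_sub_le _ _).trans ?_
        rw [norm_mul, Complex.norm_I, one_mul, Complex.norm_real, ← Complex.ofReal_mul,
          Complex.norm_real, Real.norm_of_nonneg h2, Real.norm_eq_abs]
        have := abs_le.2 ht
        have := hdle t ht
        linarith)
      (hω.const_mul c)
      (fun t ht => by
        have h1 := hcont t ht
        have h2 := hdle t ht
        -- Here 1/w = 8N/R equals 8xδ/R up to a bounded error and |z - x| ≤ 2. The bounded
        -- discrepancy, multiplied by d ≤ d₀, goes into the constant `c`.
        have h3 : -((z - w⁻¹) * d t) ≤ 18 * d₀ + -(x * (1 - 8 * δ / R) * d t) := by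
          have hwi : w⁻¹ ≤ 8 * (x * δ) / R + 1 := by
            rw [hw, inv_div, div_add_one hR0.ne']
            gcongr
            linarith
          have h4 : x - z + w⁻¹ - 8 * (x * δ) / R ≤ 18 := by linarith [(abs_le.1 hz).1]
          have h5 : (x - z + w⁻¹ - 8 * (x * δ) / R) * d t ≤ 18 * d₀ :=
            (mul_le_mul_of_nonneg_right h4 h1.1).trans (mul_le_mul_of_nonneg_left h2 (by norm_num))
          have h6 : x * (1 - 8 * δ / R) = x - 8 * (x * δ) / R := by ring
          rw [h6]
          linarith
        calc _ ≤ ‖g (Complex.I * t - d t)‖ *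
              Real.exp (18 * d₀ + -(x * (1 - 8 * δ / R) * d t)) := by gcongr
          _ = c * (‖g (Complex.I * t - d t)‖ * Real.exp (-(x * (1 - 8 * δ / R) * d t))) := by
            rw [Real.exp_add, hc]
            ring
          _ ≤ c * ω t := by
            gcongr
            exact h1.2.2.2)
      (by
        rw [intervalIntegral.integral_const_mul, mul_div_assoc]
        gcongr)
    have harea := area_term_le hn8 hR0 hκ hd₀0.le hB hδ0 hx hz hxδ hn1 hn2 hRδ hexp
    have hid := h.integral_deviation_mul_kernel_zero (v := R / 16) (w := w) (P := R / 2)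
      (by linarith) hw0 hev hP.le z
    rw [← hid, Complex.norm_real, Real.norm_eq_abs, abs_mul, abs_of_pos (by positivity)] at hbound
    set X := |∫ u in Set.Ioi (0 : ℝ), deviation τ A u * kernel (R / 16) w (n + 1) (z - u)|
    have hX : 0 ≤ X := abs_nonneg _
    have h1 : X ≤ 2 * Real.pi * X := by nlinarith [Real.pi_gt_three]
    have h2 : 2 * (c * C₁ / R) ≤ |2 * (c * C₁)| / R := by
      rw [← mul_div_assoc]
      gcongr
      exact le_abs_self _
    rw [add_div, add_div]
    have h3 : 0 ≤ 16 / R := by positivity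
    linarith

/-! ### Contours with a logarithmic profile. -/

theorem abs_le_sq_add {b t : ℝ} (hb : 1 ≤ b) : |t| ≤ t ^ 2 + b := by
  rw [← sq_abs]
  nlinarith [sq_nonneg (|t| - 1), abs_nonneg t]

/-- The profile `1 + β (1 - ½ log(t² + b) / log R)` of the deformed contour. -/
def profile (β b R t : ℝ) : ℝ := 1 + β * (1 - Real.log (t ^ 2 + b) / 2 / Real.log R)

theorem one_le_profile {β b R t : ℝ} (hβ : 0 ≤ β) (hb : 1 ≤ b) (hR : 1 < R)
    (ht : t ^ 2 + b ≤ R ^ 2) : 1 ≤ profile β b R t := by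
  have hL : 0 < Real.log R := Real.log_pos hR
  have h1 : Real.log (t ^ 2 + b) ≤ 2 * Real.log R := by
    have : Real.log (t ^ 2 + b) ≤ Real.log (R ^ 2) := Real.log_le_log (by positivity) ht
    rwa [Real.log_pow] at this
  have h2 : Real.log (t ^ 2 + b) / 2 / Real.log R ≤ 1 := by
    rw [div_le_one hL]
    linarith
  have : 0 ≤ β * (1 - Real.log (t ^ 2 + b) / 2 / Real.log R) := mul_nonneg hβ (by linarith)
  rw [profile]
  linarith

theorem hasDerivAt_profile (β R t : ℝ) {b : ℝ} (hb : 1 ≤ b) :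
    HasDerivAt (profile β b R) (-(β / Real.log R) * (t / (t ^ 2 + b))) t := by
  have h0 : t ^ 2 + b ≠ 0 := by positivity
  have h1 : HasDerivAt (fun t => t ^ 2 + b) (2 * t) t := by
    simpa using (hasDerivAt_pow 2 t).add_const b
  have h2 := (((h1.log h0).div_const 2).div_const (Real.log R)).const_sub 1
  refine ((h2.const_mul β).const_add 1).congr_deriv ?_
  ring

theorem hasDerivAt_deriv_profile (c t : ℝ) {b : ℝ} (hb : 1 ≤ b) :
    HasDerivAt (fun t => c * (t / (t ^ 2 + b)))
      (c * ((t ^ 2 + b - t * (2 * t)) / (t ^ 2 + b) ^ 2)) t := by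
  have h0 : t ^ 2 + b ≠ 0 := by positivity
  have h1 : HasDerivAt (fun t => t ^ 2 + b) (2 * t) t := by
    simpa using (hasDerivAt_pow 2 t).add_const b
  refine (((hasDerivAt_id t).div h1 h0).const_mul c).congr_deriv ?_
  simp

/-- The contour estimate for the contour `Re s = -(1 - δ / R) δ · profile`, `δ = 1 / M(R)`. -/
theorem exists_deviation_le_of_profile {τ M : ℝ → ℝ} {A : ℝ} {g : ℂ → ℂ} (hM : IsWidth M)
    (h : LaplaceExtension τ A g (Omega M)) (hg : DifferentiableOn ℂ g (interior (Omega M)))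
    {B : ℝ} (hB : 0 ≤ B) (C₁ : ℝ) {β b : ℝ} (hβ : 0 ≤ β) (hb : 1 ≤ b) :
    ∃ C R₀ : ℝ, ∀ (R x κ ℓ : ℝ) (ω : ℝ → ℝ), R₀ ≤ R → 3 ≤ x → 0 < κ →
      8 ≤ ℓ → Real.log R + Real.log κ ≤ ℓ → M R * ℓ ≤ x * (1 - 9 * (1 / M R) / R) →
      (∀ s ∈ Omega M, ‖s‖ ≤ R → ‖g s‖ ≤ B * κ) →
      (∀ t, |t| ≤ R / 2 → 1 / M R * profile β b R t ≤ 1 / M |t|) →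
      (∀ t y : ℝ, |t| ≤ R / 2 → 0 ≤ y → (Complex.I * t - y : ℂ) ∈ Omega M →
        ‖(Complex.I * t - y : ℂ)‖ ≤ R →
        ‖g (Complex.I * t - y)‖ * Real.exp (-(ℓ * profile β b R t)) ≤ ω t) →
      IntervalIntegrable ω volume (-(R / 2)) (R / 2) →
      ∫ t in (-(R / 2))..(R / 2), ω t ≤ C₁ / R →
      |deviation τ A x| ≤ C / R := by
  obtain ⟨C, R₀, hC⟩ := exists_deviation_le_of_contour hM h hg hB C₁
  set d₀ : ℝ := 1 / M 0 with hd₀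
  have hd₀0 : 0 < d₀ := one_div_pos.2 (hM.pos 0 le_rfl)
  refine ⟨C, max R₀ (max (16 + 2 * b) (max (10 * d₀) (Real.exp (β * d₀)))), ?_⟩
  intro R x κ ℓ ω hR hx hκ hℓ8 hℓκ hℓx hgb hwidth hgω hω hωI
  have hR1 : R₀ ≤ R := (le_max_left _ _).trans hR
  have hR2 : 16 + 2 * b ≤ R := ((le_max_left _ _).trans (le_max_right _ _)).trans hR
  have hR3 : 10 * d₀ ≤ R :=
    ((le_max_left _ _).trans ((le_max_right _ _).trans (le_max_right _ _))).trans hR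
  have hR4 : Real.exp (β * d₀) ≤ R :=
    ((le_max_right _ _).trans ((le_max_right _ _).trans (le_max_right _ _))).trans hR
  have hR16 : 16 ≤ R := by linarith
  have hR0 : 0 < R := by linarith
  have hMR := hM.pos R hR0.le
  set δ : ℝ := 1 / M R with hδ
  have hδ0 : 0 < δ := one_div_pos.2 hMR
  have hδM : δ * M R = 1 := by rw [hδ]; field_simp
  have hδd : δ ≤ d₀ := hM.one_div_le le_rfl hR0.le
  have hlog : β * d₀ ≤ Real.log R := (Real.le_log_iff_exp_le hR0).2 hR4
  have hL : 0 < Real.log R := Real.log_pos (by linarith)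
  set q : ℝ := δ / R with hq
  have hq0 : 0 < q := by positivity
  have hq1 : 10 * q ≤ 1 := by
    rw [hq, ← mul_div_assoc, div_le_one hR0]
    linarith
  have hqe : 9 * δ / R = 9 * q := by rw [hq]; ring
  have hqe' : 8 * δ / R = 8 * q := by rw [hq]; ring
  rw [hqe] at hℓx
  have hℓδ : ℓ ≤ x * (1 - 9 * q) * δ := by
    calc ℓ = δ * M R * ℓ := by rw [hδM, one_mul]
      _ = δ * (M R * ℓ) := by ring
      _ ≤ δ * (x * (1 - 9 * q)) := by gcongr
      _ = _ := by ring
  have hℓδ' : ℓ ≤ x * δ := by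
    refine hℓδ.trans ?_
    have : x * (1 - 9 * q) ≤ x := by nlinarith
    gcongr
  -- The factor 1 - q keeps the contour strictly inside Ω_M, where g is holomorphic. Its price turns
  -- 8 into 9, by 1 - 9q ≤ (1 - 8q)(1 - q).
  set m : ℝ := δ * (1 - q) with hm
  have hm0 : 0 < m := mul_pos hδ0 (by linarith)
  have hmδ : m ≤ δ := mul_le_of_le_one_right hδ0.le (by linarith)
  have hprof : ∀ t ∈ Set.Icc (-(R / 2)) (R / 2), 1 ≤ profile β b R t := by
    intro t ht
    refine one_le_profile hβ hb (by linarith) ?_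
    have h1 : |t| ≤ R / 2 := abs_le.2 ht
    have h2 : t ^ 2 ≤ (R / 2) ^ 2 := by
      rw [← sq_abs]
      gcongr
    nlinarith
  refine hC R x κ (fun t => m * profile β b R t)
    (fun t => (m * (-(β / Real.log R))) * (t / (t ^ 2 + b)))
    (fun t => (m * (-(β / Real.log R))) * ((t ^ 2 + b - t * (2 * t)) / (t ^ 2 + b) ^ 2)) ω hR1 hx hκ
    (by linarith) (by linarith) hgb
    (fun t => ((hasDerivAt_profile β R t hb).const_mul m).congr_deriv (by ring))
    (fun t => hasDerivAt_deriv_profile _ t hb) ?_ hω hωI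
  intro t ht
  have ht' : |t| ≤ R / 2 := abs_le.2 ht
  have hp := hprof t ht
  have hd0 : 0 ≤ m * profile β b R t := by positivity
  have hdlt : m * profile β b R t < 1 / M |t| := by
    refine lt_of_lt_of_le ?_ (hwidth t ht')
    have : m < δ := by
      rw [hm]
      nlinarith
    gcongr
  have hdd : m * profile β b R t ≤ d₀ := hdlt.le.trans (hM.one_div_le le_rfl (abs_nonneg t))
  refine ⟨hd0, hdlt, ?_, ?_⟩
  · rw [abs_mul, abs_mul, abs_neg, abs_of_pos hm0, abs_of_nonneg (div_nonneg hβ hL.le), abs_div,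
      abs_of_pos (a := t ^ 2 + b) (by positivity)]
    have h1 : |t| / (t ^ 2 + b) ≤ 1 := (div_le_one (by positivity)).2 (abs_le_sq_add hb)
    have h2 : m * (β / Real.log R) ≤ 1 := by
      rw [← mul_div_assoc, div_le_one hL]
      calc m * β ≤ d₀ * β := by
            gcongr
            exact hmδ.trans hδd
        _ ≤ Real.log R := by linarith
    exact mul_le_one₀ h2 (by positivity) h1
  · have hmem : (Complex.I * t - (m * profile β b R t : ℝ) : ℂ) ∈ Omega M := by
      change |(Complex.I * t - (m * profile β b R t : ℝ) : ℂ).re| ≤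
        1 / M |(Complex.I * t - (m * profile β b R t : ℝ) : ℂ).im|
      rw [Complex.sub_re, Complex.sub_im, Complex.mul_re, Complex.mul_im, Complex.I_re, Complex.I_im,
        Complex.ofReal_re, Complex.ofReal_im, Complex.ofReal_re, Complex.ofReal_im]
      simp only [zero_mul, one_mul, sub_zero, zero_sub, zero_add, abs_neg]
      rw [abs_of_nonneg hd0]
      exact hdlt.le
    have hnorm : ‖(Complex.I * t - (m * profile β b R t : ℝ) : ℂ)‖ ≤ R := by
      refine (norm_sub_le _ _).trans ?_
      rw [norm_mul, Complex.norm_I, one_mul, Complex.norm_real, Complex.norm_real,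
        Real.norm_of_nonneg hd0, Real.norm_eq_abs]
      linarith
    refine le_trans ?_ (hgω t _ ht' hd0 hmem hnorm)
    have hle : ℓ * profile β b R t ≤ x * (1 - 8 * δ / R) * (m * profile β b R t) := by
      have h1 : x * (1 - 9 * q) * δ ≤ x * (1 - 8 * q) * m := by
        have : 1 - 9 * q ≤ (1 - 8 * q) * (1 - q) := by nlinarith
        calc x * (1 - 9 * q) * δ = x * δ * (1 - 9 * q) := by ring
          _ ≤ x * δ * ((1 - 8 * q) * (1 - q)) := by gcongr
          _ = _ := by rw [hm]; ring
      rw [hqe', ← mul_assoc]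
      exact mul_le_mul_of_nonneg_right (hℓδ.trans h1) (by linarith)
    gcongr

/-! ### Bounds for g and the three resulting estimates of the deviation. -/

theorem integral_rpow_sub_one_le {a R : ℝ} (ha : 0 < a) (hR : 2 ≤ R) :
    ∫ t in (-(R / 2))..(R / 2), (1 + |t|) ^ (a - 1) ≤ 2 / a * R ^ a := by
  have hc : Continuous fun t : ℝ => (1 + |t|) ^ (a - 1) :=
    (by fun_prop : Continuous fun t : ℝ => 1 + |t|).rpow_const fun t => Or.inl (by positivity)
  have hpos : ∫ t in (0 : ℝ)..(R / 2), (1 + |t|) ^ (a - 1) ≤ 1 / a * R ^ a := by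
    have h1 : ∫ t in (0 : ℝ)..(R / 2), (1 + |t|) ^ (a - 1) =
        ∫ t in (0 : ℝ)..(R / 2), (t + 1) ^ (a - 1) := by
      refine intervalIntegral.integral_congr fun t ht => ?_
      rw [Set.uIcc_of_le (by linarith)] at ht
      rw [abs_of_nonneg ht.1, add_comm]
    rw [h1, intervalIntegral.integral_comp_add_right (fun t => t ^ (a - 1)),
      integral_rpow (Or.inl (by linarith)), sub_add_cancel, zero_add, Real.one_rpow, one_div,
      inv_mul_eq_div]
    gcongr
    have : (R / 2 + 1) ^ a ≤ R ^ a := by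
      gcongr
      linarith
    linarith
  have hneg : ∫ t in (-(R / 2))..(0 : ℝ), (1 + |t|) ^ (a - 1) =
      ∫ t in (0 : ℝ)..(R / 2), (1 + |t|) ^ (a - 1) := by
    have := intervalIntegral.integral_comp_neg (a := 0) (b := R / 2)
      (fun t : ℝ => (1 + |t|) ^ (a - 1))
    rw [neg_zero] at this
    rw [← this]
    simp
  rw [← intervalIntegral.integral_add_adjacent_intervals (hc.intervalIntegrable _ 0)
    (hc.intervalIntegrable _ _), hneg]
  calc _ ≤ 1 / a * R ^ a + 1 / a * R ^ a := add_le_add hpos hpos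
    _ = _ := by ring

theorem integral_inv_one_add_abs_le {R : ℝ} (hR : 2 ≤ R) :
    ∫ t in (-(R / 2))..(R / 2), (1 + |t|)⁻¹ ≤ 2 * Real.log R := by
  have hc : Continuous fun t : ℝ => (1 + |t|)⁻¹ :=
    (by fun_prop : Continuous fun t : ℝ => 1 + |t|).inv₀ fun t => by positivity
  have hpos : ∫ t in (0 : ℝ)..(R / 2), (1 + |t|)⁻¹ ≤ Real.log R := by
    have h1 : ∫ t in (0 : ℝ)..(R / 2), (1 + |t|)⁻¹ = ∫ t in (0 : ℝ)..(R / 2), (t + 1)⁻¹ := by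
      refine intervalIntegral.integral_congr fun t ht => ?_
      rw [Set.uIcc_of_le (by linarith)] at ht
      rw [abs_of_nonneg ht.1, add_comm]
    rw [h1, intervalIntegral.integral_comp_add_right (fun t => t⁻¹),
      integral_inv_of_pos (by norm_num) (by linarith), zero_add, div_one]
    exact Real.log_le_log (by linarith) (by linarith)
  have hneg : ∫ t in (-(R / 2))..(0 : ℝ), (1 + |t|)⁻¹ = ∫ t in (0 : ℝ)..(R / 2), (1 + |t|)⁻¹ := by
    have := intervalIntegral.integral_comp_neg (a := 0) (b := R / 2) (fun t : ℝ => (1 + |t|)⁻¹)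
    rw [neg_zero] at this
    rw [← this]
    simp
  rw [← intervalIntegral.integral_add_adjacent_intervals (hc.intervalIntegrable _ 0)
    (hc.intervalIntegrable _ _), hneg]
  linarith

/-- The standing assumptions on `K`. -/
structure IsGrowth (K : ℝ → ℝ) : Prop where
  cont : ContinuousOn K (Set.Ici 0)
  mono : MonotoneOn K (Set.Ici 0)
  nonneg : ∀ t ≥ 0, 0 ≤ K t
  ne_zero : ∃ t ≥ 0, 0 < K t

theorem IsGrowth.exists_pos {K : ℝ → ℝ} (hK : IsGrowth K) :
    ∃ T : ℝ, 1 < T ∧ ∀ t, T ≤ t → 0 < K t := by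
  obtain ⟨T, hT, hKT⟩ := hK.ne_zero
  refine ⟨max T 2, lt_of_lt_of_le (by norm_num) (le_max_right _ _), fun t ht => ?_⟩
  have h1 : T ≤ t := (le_max_left _ _).trans ht
  exact hKT.trans_le (hK.mono hT (hT.le.trans h1) h1)

/-- Makes the bound on g uniform over |s| ≤ R. For large |s| the increase condition passes from
K(|s|) to K(R). For small |s| compactness bounds g, and the condition between `r` and R keeps K(R)
R^{-a} bounded below. The case `a = 0` is monotonicity of K. -/
theorem exists_norm_le_of_increase {M K : ℝ → ℝ} {g : ℂ → ℂ} (hM : IsWidth M) (hK : IsGrowth K)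
    (hg : ContinuousOn g (Omega M))
    (hbound : ∃ B R : ℝ, ∀ s ∈ Omega M, R ≤ ‖s‖ → ‖g s‖ ≤ B * (K ‖s‖ / ‖s‖))
    {a t₀ B₂ : ℝ} (ha : 0 ≤ a) (hinc : ∀ R t : ℝ, t₀ ≤ t → t ≤ R →
      t ^ (-a) * K t ≤ B₂ * (R ^ (-a) * K R)) :
    ∃ B R₁ : ℝ, 0 ≤ B ∧ 1 ≤ R₁ ∧ 0 < K R₁ ∧ ∀ R, R₁ ≤ R → ∀ s ∈ Omega M, ‖s‖ ≤ R →
      ‖g s‖ ≤ B * (K R * R ^ (-a) * (1 + ‖s‖) ^ (a - 1)) := by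
  obtain ⟨B₀, r₀, hB₀⟩ := hbound
  obtain ⟨T, hT1, hTK⟩ := hK.exists_pos
  set r : ℝ := max r₀ (max t₀ T) with hr
  have hr0 : r₀ ≤ r := le_max_left _ _
  have hrt : t₀ ≤ r := (le_max_left _ _).trans (le_max_right _ _)
  have hrT : T ≤ r := (le_max_right _ _).trans (le_max_right _ _)
  have hr1 : 1 < r := hT1.trans_le hrT
  have hKr : 0 < K r := hTK r hrT
  have hcpt : IsCompact (Omega M ∩ Metric.closedBall 0 r) :=
    (isCompact_closedBall 0 r).inter_left hM.isClosed_Omega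
  obtain ⟨G, hG⟩ := hcpt.exists_bound_of_continuousOn (hg.mono Set.inter_subset_left)
  have hB₂ : 0 < B₂ := by
    have h1 := hinc r r hrt le_rfl
    have h2 : 0 < r ^ (-a) * K r := by positivity
    by_contra hc
    nlinarith
  have hr2 : 0 < r ^ (-a) * K r := by positivity
  refine ⟨max (2 * |B₀| * B₂) (|G| * (1 + r) * B₂ / (r ^ (-a) * K r)), r,
    le_trans (by positivity) (le_max_left _ _), hr1.le, hKr, fun R hR s hs hsR => ?_⟩
  have hR0 : 0 < R := by linarith
  have hKR : 0 < K R := hTK R (hrT.trans hR)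
  have hs1 : 0 < 1 + ‖s‖ := by positivity
  have hpos : 0 ≤ K R * R ^ (-a) * (1 + ‖s‖) ^ (a - 1) := by positivity
  rcases le_total r ‖s‖ with h1 | h1
  · have hs0 : 0 < ‖s‖ := by linarith
    refine le_trans ?_ (mul_le_mul_of_nonneg_right (le_max_left _ _) hpos)
    have h2 := hB₀ s hs (hr0.trans h1)
    have h3 := hinc R ‖s‖ (hrt.trans h1) hsR
    have hKs : 0 < K ‖s‖ := hTK _ (hrT.trans h1)
    have h4 : K ‖s‖ ≤ B₂ * (R ^ (-a) * K R) * ‖s‖ ^ a := by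
      have : K ‖s‖ = ‖s‖ ^ (-a) * K ‖s‖ * ‖s‖ ^ a := by
        rw [Real.rpow_neg hs0.le]
        field_simp
      rw [this]
      gcongr
    have h5 : ‖s‖ ^ a / ‖s‖ ≤ 2 * (1 + ‖s‖) ^ (a - 1) := by
      rw [Real.rpow_sub_one hs1.ne', ← mul_div_assoc, div_le_div_iff₀ hs0 hs1]
      have h6 : ‖s‖ ^ a ≤ (1 + ‖s‖) ^ a := by
        gcongr
        linarith
      calc ‖s‖ ^ a * (1 + ‖s‖) ≤ (1 + ‖s‖) ^ a * (2 * ‖s‖) := by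
            gcongr
            linarith
        _ = _ := by ring
    calc ‖g s‖ ≤ B₀ * (K ‖s‖ / ‖s‖) := h2
      _ ≤ |B₀| * (K ‖s‖ / ‖s‖) := by
        gcongr
        exact le_abs_self _
      _ ≤ |B₀| * (B₂ * (R ^ (-a) * K R) * ‖s‖ ^ a / ‖s‖) := by gcongr
      _ = |B₀| * (B₂ * (R ^ (-a) * K R)) * (‖s‖ ^ a / ‖s‖) := by ring
      _ ≤ |B₀| * (B₂ * (R ^ (-a) * K R)) * (2 * (1 + ‖s‖) ^ (a - 1)) := by gcongr
      _ = _ := by ring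
  · refine le_trans ?_ (mul_le_mul_of_nonneg_right (le_max_right _ _) hpos)
    have h2 : ‖g s‖ ≤ |G| := (hG s ⟨hs, by simpa using h1⟩).trans (le_abs_self _)
    have h3 := hinc R r hrt hR
    have h4 : 1 ≤ (1 + r) * (1 + ‖s‖) ^ (a - 1) := by
      have h5 : (1 + r) * (1 + ‖s‖) ^ (a - 1) = (1 + r) / (1 + ‖s‖) * (1 + ‖s‖) ^ a := by
        rw [Real.rpow_sub_one hs1.ne']
        ring
      rw [h5]
      exact one_le_mul_of_one_le_of_one_le ((one_le_div hs1).2 (by linarith))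
        (Real.one_le_rpow (by linarith [norm_nonneg s]) ha)
    calc ‖g s‖ ≤ |G| * 1 * 1 := by linarith
      _ ≤ |G| * (B₂ * (R ^ (-a) * K R) / (r ^ (-a) * K r)) * ((1 + r) * (1 + ‖s‖) ^ (a - 1)) := by
        gcongr
        exact (one_le_div hr2).2 h3
      _ = _ := by ring

theorem IsGrowth.trivial_increase {K : ℝ → ℝ} (hK : IsGrowth K) (R t : ℝ) (ht : 0 ≤ t)
    (htR : t ≤ R) : t ^ (-(0 : ℝ)) * K t ≤ 1 * (R ^ (-(0 : ℝ)) * K R) := by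
  simpa using hK.mono ht (ht.trans htR) htR

theorem abs_le_norm_I_mul_sub (t y : ℝ) : |t| ≤ ‖(Complex.I * t - y : ℂ)‖ := by
  have := Complex.abs_im_le_norm (Complex.I * t - y : ℂ)
  simpa using this

section

variable {τ M K : ℝ → ℝ} {A : ℝ} {g : ℂ → ℂ}

/-- For `R ≥ exp (8 + 2 |log K(R₁)|)` and `R ≥ R₁`, the logarithm of `R K(R)` is large. -/
theorem IsGrowth.log_bounds (hK : IsGrowth K) {R₁ R : ℝ} (hR₁ : 1 ≤ R₁) (hKR₁ : 0 < K R₁)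
    (hR : R₁ ≤ R) (hR' : Real.exp (8 + 2 * |Real.log (K R₁)|) ≤ R) :
    0 < K R ∧ 8 ≤ Real.log R ∧ 8 ≤ Real.log R + Real.log (K R) ∧
      Real.log R / 2 ≤ Real.log R + Real.log (K R) := by
  have h1 : K R₁ ≤ K R := hK.mono (Set.mem_Ici.2 (by linarith)) (Set.mem_Ici.2 (by linarith)) hR
  have h2 : Real.log (K R₁) ≤ Real.log (K R) := Real.log_le_log hKR₁ h1
  have h3 : 8 + 2 * |Real.log (K R₁)| ≤ Real.log R := (Real.le_log_iff_exp_le (by linarith)).2 hR'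
  have h4 := neg_abs_le (Real.log (K R₁))
  have h5 := abs_nonneg (Real.log (K R₁))
  refine ⟨hKR₁.trans_le h1, ?_, ?_, ?_⟩ <;> linarith

theorem exp_neg_log_add_log {R κ : ℝ} (hR : 0 < R) (hκ : 0 < κ) :
    Real.exp (-(Real.log R + Real.log κ)) = (R * κ)⁻¹ := by
  rw [Real.exp_neg, Real.exp_add, Real.exp_log hR, Real.exp_log hκ]

/-- The contour is a vertical segment (β = 0). The bound K(R)/(1 + |t|) integrates to O(K(R) log R),
and log log R in M_{K,log} cancels the logarithm. -/
theorem exists_deviation_le_MKlog (hM : IsWidth M) (hK : IsGrowth K)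
    (h : LaplaceExtension τ A g (Omega M)) (hg : DifferentiableOn ℂ g (interior (Omega M)))
    (hbound : ∃ B R : ℝ, ∀ s ∈ Omega M, R ≤ ‖s‖ → ‖g s‖ ≤ B * (K ‖s‖ / ‖s‖)) :
    ∃ C R₀ : ℝ, ∀ R x : ℝ, R₀ ≤ R → 3 ≤ x → MKlog M K R ≤ x * (1 - 9 * (1 / M R) / R) →
      |deviation τ A x| ≤ C / R := by
  obtain ⟨B, R₁, hB, hR₁, hKR₁, hgB⟩ := exists_norm_le_of_increase hM hK h.cont hbound le_rfl
    (fun R t => hK.trivial_increase R t)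
  obtain ⟨C, R₀, hC⟩ := exists_deviation_le_of_profile hM h hg hB (2 * B) le_rfl le_rfl
  refine ⟨C, max R₀ (max R₁ (Real.exp (8 + 2 * |Real.log (K R₁)|))), fun R x hR hx hMK => ?_⟩
  have hR0 : R₁ ≤ R := ((le_max_left _ _).trans (le_max_right _ _)).trans hR
  obtain ⟨hκ, hlog, hℓ, -⟩ := hK.log_bounds hR₁ hKR₁ hR0
    (((le_max_right _ _).trans (le_max_right _ _)).trans hR)
  have hRpos : 0 < R := by linarith
  have hR2 : 2 ≤ R := by linarith [Real.log_le_sub_one_of_pos hRpos]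
  have hloglog : 0 ≤ Real.log (Real.log R) := Real.log_nonneg (by linarith)
  set ℓ : ℝ := Real.log R + Real.log (Real.log R) + Real.log (K R) with hℓdef
  have hgs : ∀ s ∈ Omega M, ‖s‖ ≤ R → ‖g s‖ ≤ B * K R * (1 + ‖s‖)⁻¹ := by
    intro s hs hsR
    have := hgB R hR0 s hs hsR
    rw [neg_zero, Real.rpow_zero, zero_sub, Real.rpow_neg_one, mul_one] at this
    linarith
  have hexp : Real.exp (-ℓ) = (R * K R)⁻¹ * (Real.log R)⁻¹ := by
    have : -ℓ = -(Real.log R + Real.log (K R)) + -Real.log (Real.log R) := by rw [hℓdef]; ring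
    rw [this, Real.exp_add, exp_neg_log_add_log hRpos hκ, Real.exp_neg, Real.exp_log (by linarith)]
  have hprof : ∀ t, profile 0 1 R t = 1 := fun t => by simp [profile]
  have hcω : Continuous fun t : ℝ => B / (R * Real.log R) * (1 + |t|)⁻¹ :=
    continuous_const.mul ((by fun_prop : Continuous fun t : ℝ => 1 + |t|).inv₀
      fun t => by positivity)
  refine hC R x (K R) ℓ (fun t => B / (R * Real.log R) * (1 + |t|)⁻¹) ((le_max_left _ _).trans hR)
    hx hκ (by linarith) (by linarith) hMK ?_ ?_ ?_ (hcω.intervalIntegrable _ _) ?_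
  · intro s hs hsR
    refine (hgs s hs hsR).trans (mul_le_of_le_one_right (by positivity) ?_)
    exact inv_le_one_of_one_le₀ (by linarith [norm_nonneg s])
  · intro t ht
    rw [hprof, mul_one]
    exact hM.one_div_le (abs_nonneg t) (by linarith)
  · intro t y ht hy hmem hnorm
    rw [hprof, mul_one, hexp]
    have h1 := hgs _ hmem hnorm
    have h2 := abs_le_norm_I_mul_sub t y
    calc _ ≤ B * K R * (1 + ‖(Complex.I * t - y : ℂ)‖)⁻¹ * ((R * K R)⁻¹ * (Real.log R)⁻¹) := by
          gcongr
      _ ≤ B * K R * (1 + |t|)⁻¹ * ((R * K R)⁻¹ * (Real.log R)⁻¹) := by gcongr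
      _ = _ := by field_simp
  · rw [intervalIntegral.integral_const_mul]
    calc _ ≤ B / (R * Real.log R) * (2 * Real.log R) := by
          gcongr
          exact integral_inv_one_add_abs_le hR2
      _ = 2 * B / R := by field_simp

/-- The contour is again vertical, but K(R) R^{-a} (1 + |t|)^{a-1} integrates to O(K(R)), without a
logarithm. -/
theorem exists_deviation_le_MK_of_positiveIncrease (hM : IsWidth M) (hK : IsGrowth K)
    (h : LaplaceExtension τ A g (Omega M)) (hg : DifferentiableOn ℂ g (interior (Omega M)))
    (hbound : ∃ B R : ℝ, ∀ s ∈ Omega M, R ≤ ‖s‖ → ‖g s‖ ≤ B * (K ‖s‖ / ‖s‖))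
    (hinc : IsOfPositiveIncrease K) :
    ∃ C R₀ : ℝ, ∀ R x : ℝ, R₀ ≤ R → 3 ≤ x → MK M K R ≤ x * (1 - 9 * (1 / M R) / R) →
      |deviation τ A x| ≤ C / R := by
  obtain ⟨a', ha', t₀, ht₀, B₂, hB₂⟩ := hinc
  -- Capping the exponent at 1 makes `(1 + ‖s‖) ^ (a - 1)` non-increasing in ‖s‖, so that ‖s‖ may be
  -- replaced by |Im s|.
  set a : ℝ := min a' 1 with ha
  have ha0 : 0 < a := lt_min ha' one_pos
  have ha1 : a ≤ 1 := min_le_right _ _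
  have haa : a ≤ a' := min_le_left _ _
  have hincr : ∀ R t : ℝ, t₀ ≤ t → t ≤ R → t ^ (-a) * K t ≤ B₂ * (R ^ (-a) * K R) := by
    intro R t ht htR
    have h0 : 0 < t := ht₀.trans_le ht
    have h1 := hB₂ R t ht htR
    have h2 : ∀ r : ℝ, 0 < r → r ^ (-a) = r ^ (a' - a) * r ^ (-a') := fun r hr => by
      rw [← Real.rpow_add hr]
      congr 1
      ring
    have h3 : t ^ (a' - a) ≤ R ^ (a' - a) := Real.rpow_le_rpow h0.le htR (by linarith)
    have h4 := hK.nonneg t h0.le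
    rw [h2 t h0, h2 R (h0.trans_le htR)]
    calc t ^ (a' - a) * t ^ (-a') * K t = t ^ (a' - a) * (t ^ (-a') * K t) := by ring
      _ ≤ R ^ (a' - a) * (t ^ (-a') * K t) := by gcongr
      _ ≤ R ^ (a' - a) * (B₂ * (R ^ (-a') * K R)) :=
        mul_le_mul_of_nonneg_left h1 (Real.rpow_nonneg (h0.le.trans htR) _)
      _ = _ := by ring
  obtain ⟨B, R₁, hB, hR₁, hKR₁, hgB⟩ := exists_norm_le_of_increase hM hK h.cont hbound le_rfl
    (fun R t => hK.trivial_increase R t)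
  obtain ⟨B', R₁', hB', -, -, hgB'⟩ := exists_norm_le_of_increase hM hK h.cont hbound ha0.le hincr
  obtain ⟨C, R₀, hC⟩ := exists_deviation_le_of_profile hM h hg hB (B' * (2 / a)) le_rfl le_rfl
  refine ⟨C, max R₀ (max R₁ (max R₁' (Real.exp (8 + 2 * |Real.log (K R₁)|)))),
    fun R x hR hx hMK => ?_⟩
  have hR0 : R₁ ≤ R := ((le_max_left _ _).trans (le_max_right _ _)).trans hR
  have hR0' : R₁' ≤ R :=
    ((le_max_left _ _).trans ((le_max_right _ _).trans (le_max_right _ _))).trans hR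
  obtain ⟨hκ, hlog, hℓ, -⟩ := hK.log_bounds hR₁ hKR₁ hR0
    (((le_max_right _ _).trans ((le_max_right _ _).trans (le_max_right _ _))).trans hR)
  have hRpos : 0 < R := by linarith
  have hR2 : 2 ≤ R := by linarith [Real.log_le_sub_one_of_pos hRpos]
  have hprof : ∀ t, profile 0 1 R t = 1 := fun t => by simp [profile]
  have hcω : Continuous fun t : ℝ => B' / R * R ^ (-a) * (1 + |t|) ^ (a - 1) :=
    continuous_const.mul ((by fun_prop : Continuous fun t : ℝ => 1 + |t|).rpow_const
      fun t => Or.inl (by positivity))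
  refine hC R x (K R) (Real.log R + Real.log (K R))
    (fun t => B' / R * R ^ (-a) * (1 + |t|) ^ (a - 1)) ((le_max_left _ _).trans hR)
    hx hκ hℓ le_rfl hMK ?_ ?_ ?_ (hcω.intervalIntegrable _ _) ?_
  · intro s hs hsR
    have := hgB R hR0 s hs hsR
    rw [neg_zero, Real.rpow_zero, zero_sub, Real.rpow_neg_one, mul_one, ← mul_assoc] at this
    refine this.trans (mul_le_of_le_one_right (by positivity) ?_)
    exact inv_le_one_of_one_le₀ (by linarith [norm_nonneg s])
  · intro t ht
    rw [hprof, mul_one]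
    exact hM.one_div_le (abs_nonneg t) (by linarith)
  · intro t y ht hy hmem hnorm
    rw [hprof, mul_one, exp_neg_log_add_log hRpos hκ]
    have h1 := hgB' R hR0' _ hmem hnorm
    have h2 := abs_le_norm_I_mul_sub t y
    have h3 : (1 + ‖(Complex.I * t - y : ℂ)‖) ^ (a - 1) ≤ (1 + |t|) ^ (a - 1) :=
      Real.rpow_le_rpow_of_nonpos (by positivity) (by linarith) (by linarith)
    calc _ ≤ B' * (K R * R ^ (-a) * (1 + ‖(Complex.I * t - y : ℂ)‖) ^ (a - 1)) * (R * K R)⁻¹ := by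
          gcongr
      _ ≤ B' * (K R * R ^ (-a) * (1 + |t|) ^ (a - 1)) * (R * K R)⁻¹ := by gcongr
      _ = _ := by field_simp
  · rw [intervalIntegral.integral_const_mul]
    calc _ ≤ B' / R * R ^ (-a) * (2 / a * R ^ a) := by
          gcongr
          exact integral_rpow_sub_one_le ha0 hR2
      _ = B' * (2 / a) / R * (R ^ (-a) * R ^ a) := by ring
      _ = B' * (2 / a) / R := by
        rw [← Real.rpow_add hRpos, neg_add_cancel, Real.rpow_zero, mul_one]

theorem one_add_mul_le_rpow {u β : ℝ} (hu : 0 < u) (hβ : 0 ≤ β) :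
    1 + β * (1 - u) ≤ u⁻¹ ^ β := by
  rw [Real.rpow_def_of_pos (by positivity), Real.log_inv]
  have h1 := Real.log_le_sub_one_of_pos hu
  have h2 := Real.add_one_le_exp (-Real.log u * β)
  nlinarith

/-- With T = max(|t|, t₁), the hypothesis lets the contour at height t lie farther left than 1/M(R)
by the factor (log R / log T)^β. The profile is a smooth minorant of this power by
`one_add_mul_le_rpow`; b = t₁² works because (t² + t₁²)^{1/2} ≥ T. -/
theorem profile_le_of_monotoneOn (hM : IsWidth M) {β t₁ R t : ℝ} (hβ : 0 ≤ β) (ht₁ : 1 < t₁)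
    (hmono : MonotoneOn (fun t : ℝ => M t / Real.log t ^ β) (Set.Ici t₁)) (hR : t₁ ≤ R)
    (ht : |t| ≤ R) : 1 / M R * profile β (t₁ ^ 2) R t ≤ 1 / M |t| := by
  set T : ℝ := max |t| t₁ with hT
  have hT1 : t₁ ≤ T := le_max_right _ _
  have hTt : |t| ≤ T := le_max_left _ _
  have hTR : T ≤ R := max_le ht hR
  have hT0 : 0 < T := by linarith
  have hL : 0 < Real.log R := Real.log_pos (by linarith)
  have hLT : 0 < Real.log T := Real.log_pos (by linarith)
  have hMT := hM.pos T hT0.le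
  have hMR := hM.pos R (by linarith)
  refine le_trans ?_ (hM.one_div_le (abs_nonneg t) hTt)
  have h1 : Real.log T ≤ Real.log (t ^ 2 + t₁ ^ 2) / 2 := by
    have h2 : T ^ 2 ≤ t ^ 2 + t₁ ^ 2 := by
      rcases le_total |t| t₁ with h3 | h3
      · rw [hT, max_eq_right h3]
        nlinarith [sq_nonneg t]
      · rw [hT, max_eq_left h3, sq_abs]
        nlinarith [sq_nonneg t₁]
    have h3 := Real.log_le_log (by positivity) h2
    rw [Real.log_pow] at h3
    push_cast at h3
    linarith
  have h2 : profile β (t₁ ^ 2) R t ≤ (Real.log T / Real.log R)⁻¹ ^ β := by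
    refine le_trans ?_ (one_add_mul_le_rpow (by positivity) hβ)
    rw [profile]
    gcongr
  have h3 := hmono (Set.mem_Ici.2 hT1) (Set.mem_Ici.2 (hT1.trans hTR)) hTR
  simp only at h3
  rw [div_le_div_iff₀ (by positivity) (by positivity)] at h3
  have h4 : (Real.log T / Real.log R)⁻¹ ^ β = Real.log R ^ β / Real.log T ^ β := by
    rw [inv_div, Real.div_rpow hL.le hLT.le]
  calc _ ≤ 1 / M R * (Real.log R ^ β / Real.log T ^ β) := by
        rw [← h4]
        gcongr
    _ ≤ 1 / M T := by
      rw [div_mul_div_comm, one_mul, div_le_div_iff₀ (by positivity) hMT]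
      linarith

/-- The bent contour gains e^{-ℓ(profile - 1)}. As ℓ ≥ (log R)/2, this is at most ((t² +
t₁²)^{1/2}/R)^{β/2}. It improves K(R)/(1 + |t|) to a multiple of K(R) R^{-a} (1 + |t|)^{a-1} with a
= β/2, whose integral has no logarithm. -/
theorem exists_deviation_le_MK_of_monotoneOverLogPow (hM : IsWidth M) (hK : IsGrowth K)
    (h : LaplaceExtension τ A g (Omega M)) (hg : DifferentiableOn ℂ g (interior (Omega M)))
    (hbound : ∃ B R : ℝ, ∀ s ∈ Omega M, R ≤ ‖s‖ → ‖g s‖ ≤ B * (K ‖s‖ / ‖s‖))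
    (hpow : EventuallyMonotoneOverLogPow M) :
    ∃ C R₀ : ℝ, ∀ R x : ℝ, R₀ ≤ R → 3 ≤ x → MK M K R ≤ x * (1 - 9 * (1 / M R) / R) →
      |deviation τ A x| ≤ C / R := by
  obtain ⟨β, hβ, t₁, ht₁, hmono⟩ := hpow
  set a : ℝ := β / 2 with ha
  have ha0 : 0 < a := by positivity
  have hb1 : 1 ≤ t₁ ^ 2 := one_le_pow₀ ht₁.le
  obtain ⟨B, R₁, hB, hR₁, hKR₁, hgB⟩ := exists_norm_le_of_increase hM hK h.cont hbound le_rfl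
    (fun R t => hK.trivial_increase R t)
  obtain ⟨C, R₀, hC⟩ := exists_deviation_le_of_profile hM h hg hB (B * t₁ ^ a * (2 / a)) hβ.le hb1
  refine ⟨C, max R₀ (max R₁ (max (2 * t₁) (Real.exp (8 + 2 * |Real.log (K R₁)|)))),
    fun R x hR hx hMK => ?_⟩
  have hR0 : R₁ ≤ R := ((le_max_left _ _).trans (le_max_right _ _)).trans hR
  have hRt : 2 * t₁ ≤ R :=
    ((le_max_left _ _).trans ((le_max_right _ _).trans (le_max_right _ _))).trans hR
  obtain ⟨hκ, hlog, hℓ, hℓ2⟩ := hK.log_bounds hR₁ hKR₁ hR0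
    (((le_max_right _ _).trans ((le_max_right _ _).trans (le_max_right _ _))).trans hR)
  have hRpos : 0 < R := by linarith
  have hR2 : 2 ≤ R := by linarith [Real.log_le_sub_one_of_pos hRpos]
  set ℓ : ℝ := Real.log R + Real.log (K R) with hℓdef
  have hgs : ∀ s ∈ Omega M, ‖s‖ ≤ R → ‖g s‖ ≤ B * K R * (1 + ‖s‖)⁻¹ := by
    intro s hs hsR
    have := hgB R hR0 s hs hsR
    rw [neg_zero, Real.rpow_zero, zero_sub, Real.rpow_neg_one, mul_one] at this
    linarith
  have hcω : Continuous fun t : ℝ => B * t₁ ^ a / R * R ^ (-a) * (1 + |t|) ^ (a - 1) :=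
    continuous_const.mul ((by fun_prop : Continuous fun t : ℝ => 1 + |t|).rpow_const
      fun t => Or.inl (by positivity))
  refine hC R x (K R) ℓ
    (fun t => B * t₁ ^ a / R * R ^ (-a) * (1 + |t|) ^ (a - 1)) ((le_max_left _ _).trans hR)
    hx hκ hℓ le_rfl hMK ?_ ?_ ?_ (hcω.intervalIntegrable _ _) ?_
  · intro s hs hsR
    refine (hgs s hs hsR).trans (mul_le_of_le_one_right (by positivity) ?_)
    exact inv_le_one_of_one_le₀ (by linarith [norm_nonneg s])
  · intro t ht
    exact profile_le_of_monotoneOn hM hβ.le ht₁ hmono (by linarith) (by linarith)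
  · intro t y ht hy hmem hnorm
    have h1 := hgs _ hmem hnorm
    have h2 := abs_le_norm_I_mul_sub t y
    have ht0 := abs_nonneg t
    have hprof : 1 ≤ profile β (t₁ ^ 2) R t := by
      refine one_le_profile hβ.le hb1 (by linarith) ?_
      have h3 : t ^ 2 ≤ (R / 2) ^ 2 := by
        rw [← sq_abs]
        gcongr
      nlinarith
    have hlogt : Real.log (t ^ 2 + t₁ ^ 2) / 2 ≤ Real.log t₁ + Real.log (1 + |t|) := by
      have h3 : t ^ 2 + t₁ ^ 2 ≤ (t₁ * (1 + |t|)) ^ 2 := by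
        rw [← sq_abs t, mul_pow]
        nlinarith [mul_nonneg (sub_nonneg.2 hb1) (sq_nonneg |t|), mul_nonneg ht0 (sq_nonneg t₁)]
      have h4 := Real.log_le_log (by positivity) h3
      rw [Real.log_pow, Real.log_mul (by positivity) (by positivity)] at h4
      push_cast at h4
      linarith
    have hexp : Real.exp (-(ℓ * profile β (t₁ ^ 2) R t)) ≤
        (R * K R)⁻¹ * (R ^ (-a) * (t₁ ^ a * (1 + |t|) ^ a)) := by
      rw [← exp_neg_log_add_log hRpos hκ, Real.rpow_def_of_pos hRpos,
        Real.rpow_def_of_pos (by linarith : 0 < t₁), Real.rpow_def_of_pos (by positivity : 0 < 1 + |t|),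
        ← Real.exp_add, ← Real.exp_add, ← Real.exp_add]
      refine Real.exp_le_exp.2 ?_
      have h5 : Real.log R / 2 * (profile β (t₁ ^ 2) R t - 1) ≤
          ℓ * (profile β (t₁ ^ 2) R t - 1) := by
        have : 0 ≤ profile β (t₁ ^ 2) R t - 1 := by linarith
        gcongr
      have h6 : Real.log R / 2 * (profile β (t₁ ^ 2) R t - 1) =
          a * (Real.log R - Real.log (t ^ 2 + t₁ ^ 2) / 2) := by
        rw [profile, ha]
        field_simp
        ring
      have h7 : a * (Real.log (t ^ 2 + t₁ ^ 2) / 2) ≤ a * (Real.log t₁ + Real.log (1 + |t|)) := by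
        gcongr
      change -(ℓ * profile β (t₁ ^ 2) R t) ≤ -ℓ + _
      linarith
    calc _ ≤ B * K R * (1 + ‖(Complex.I * t - y : ℂ)‖)⁻¹ *
          ((R * K R)⁻¹ * (R ^ (-a) * (t₁ ^ a * (1 + |t|) ^ a))) := by gcongr
      _ ≤ B * K R * (1 + |t|)⁻¹ * ((R * K R)⁻¹ * (R ^ (-a) * (t₁ ^ a * (1 + |t|) ^ a))) := by
        gcongr
      _ = _ := by
        rw [Real.rpow_sub_one (by positivity : 1 + |t| ≠ 0)]
        field_simp
  · rw [intervalIntegral.integral_const_mul]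
    calc _ ≤ B * t₁ ^ a / R * R ^ (-a) * (2 / a * R ^ a) := by
          gcongr
          exact integral_rpow_sub_one_le ha0 hR2
      _ = B * t₁ ^ a * (2 / a) / R * (R ^ (-a) * R ^ a) := by ring
      _ = _ := by
        rw [← Real.rpow_add hRpos, neg_add_cancel, Real.rpow_zero, mul_one]

end

/-! ### The inverse functions at large arguments. -/

/-- Injectivity is not needed: the intermediate value theorem gives a preimage, and whichever one
`invFunOn` picks exceeds B, because V is bounded above on the part of `s` below B. -/
theorem invFunOn_eventually {V : ℝ → ℝ} {s : Set ℝ} {T : ℝ} (hT : Set.Ici T ⊆ s)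
    (hc : ContinuousOn V (Set.Ici T)) (htop : Tendsto V atTop atTop)
    (hbd : ∀ B : ℝ, ∃ C : ℝ, ∀ t ∈ s, t ≤ B → V t ≤ C) (B : ℝ) :
    ∀ᶠ x in atTop, V (Function.invFunOn V s x) = x ∧ B < Function.invFunOn V s x := by
  obtain ⟨C, hC⟩ := hbd B
  filter_upwards [eventually_ge_atTop (V T), eventually_gt_atTop C] with x hxT hxC
  obtain ⟨t₁, ht₁, hxt₁⟩ := ((htop.eventually_ge_atTop x).and (eventually_ge_atTop T)).exists
  obtain ⟨t, ht, hVt⟩ := intermediate_value_Icc hxt₁ (hc.mono Set.Icc_subset_Ici_self)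
    ⟨hxT, ht₁⟩
  have hex : ∃ a ∈ s, V a = x := ⟨t, hT ht.1, hVt⟩
  have h1 := Function.invFunOn_eq hex
  have h2 := Function.invFunOn_mem hex
  refine ⟨h1, ?_⟩
  by_contra hle
  have := hC _ h2 (not_lt.1 hle)
  linarith

section

variable {M K : ℝ → ℝ}

theorem IsGrowth.log_le_abs (hK : IsGrowth K) {t B : ℝ} (ht : 0 ≤ t) (htB : t ≤ B) :
    Real.log (K t) ≤ |Real.log (K B)| := by
  rcases (hK.nonneg t ht).eq_or_lt with h0 | h0
  -- K may vanish at t, where `Real.log` takes the default value 0; hence the absolute value on the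
  -- right.
  · rw [← h0, Real.log_zero]
    exact abs_nonneg _
  · exact (Real.log_le_log h0 (hK.mono ht (ht.trans htB) htB)).trans (le_abs_self _)

theorem IsWidth.mul_le_mul (hM : IsWidth M) {t B y Y : ℝ} (ht : 0 ≤ t) (htB : t ≤ B) (hy : y ≤ Y)
    (hY : 0 ≤ Y) : M t * y ≤ M B * Y :=
  (mul_le_mul_of_nonneg_left hy (hM.pos t ht).le).trans
    (mul_le_mul_of_nonneg_right (hM.mono ht (ht.trans htB) htB) hY)

theorem MKInv_eventually (hM : IsWidth M) (hK : IsGrowth K) (B : ℝ) :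
    ∀ᶠ x in atTop, MK M K (MKInv M K x) = x ∧ B < MKInv M K x := by
  obtain ⟨T, hT1, hTK⟩ := hK.exists_pos
  refine invFunOn_eventually (T := T) (fun t ht => lt_of_lt_of_le (show (0:ℝ) < T by linarith) ht) ?_ ?_ ?_ B
  · have hsub : Set.Ici T ⊆ Set.Ici 0 := Set.Ici_subset_Ici.2 (by linarith)
    refine (hM.cont.mono hsub).mul (ContinuousOn.add ?_ ?_)
    · exact Real.continuousOn_log.mono fun t ht => (lt_of_lt_of_le (by linarith) ht : 0 < t).ne'
    · exact (hK.cont.mono hsub).log fun t ht => (hTK t ht).ne'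
  · have h1 : Tendsto (fun t => M 0 * (Real.log t + Real.log (K T))) atTop atTop :=
      (tendsto_atTop_add_const_right _ _ Real.tendsto_log_atTop).const_mul_atTop (hM.pos 0 le_rfl)
    refine tendsto_atTop_mono' _ ?_ h1
    filter_upwards [eventually_ge_atTop T, h1.eventually_ge_atTop 0] with t ht ht0
    have h2 := Real.log_le_log (hTK T le_rfl) (hK.mono (Set.mem_Ici.2 (by linarith))
      (Set.mem_Ici.2 (by linarith)) ht)
    refine hM.mul_le_mul le_rfl (by linarith) (by linarith) ?_
    have := (mul_nonneg_iff_of_pos_left (hM.pos 0 le_rfl)).1 ht0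
    linarith
  · intro B
    refine ⟨M B * (|Real.log B| + |Real.log (K B)|), fun t ht htB => ?_⟩
    have ht0 : 0 < t := ht
    refine hM.mul_le_mul ht0.le htB ?_ (by positivity)
    have h1 := hK.log_le_abs ht0.le htB
    have h2 := (Real.log_le_log ht0 htB).trans (le_abs_self _)
    linarith

theorem MKlogInv_eventually (hM : IsWidth M) (hK : IsGrowth K) (B : ℝ) :
    ∀ᶠ x in atTop, MKlog M K (MKlogInv M K x) = x ∧ B < MKlogInv M K x := by
  obtain ⟨T, hT1, hTK⟩ := hK.exists_pos
  refine invFunOn_eventually (T := T) (fun t ht => lt_of_lt_of_le hT1 ht) ?_ ?_ ?_ B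
  · have hsub : Set.Ici T ⊆ Set.Ici 0 := Set.Ici_subset_Ici.2 (by linarith)
    have hlog : ContinuousOn Real.log (Set.Ici T) :=
      Real.continuousOn_log.mono fun t ht => (lt_of_lt_of_le (by linarith) ht : 0 < t).ne'
    refine (hM.cont.mono hsub).mul ((hlog.add ?_).add ?_)
    · exact hlog.log fun t ht => (Real.log_pos (lt_of_lt_of_le hT1 ht)).ne'
    · exact (hK.cont.mono hsub).log fun t ht => (hTK t ht).ne'
  · have h1 : Tendsto (fun t => M 0 * (Real.log t + Real.log (K T))) atTop atTop :=
      (tendsto_atTop_add_const_right _ _ Real.tendsto_log_atTop).const_mul_atTop (hM.pos 0 le_rfl)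
    refine tendsto_atTop_mono' _ ?_ h1
    filter_upwards [eventually_ge_atTop T, h1.eventually_ge_atTop 0,
      Real.tendsto_log_atTop.eventually_ge_atTop 1] with t ht ht0 hlog
    have h2 := Real.log_le_log (hTK T le_rfl) (hK.mono (Set.mem_Ici.2 (by linarith))
      (Set.mem_Ici.2 (by linarith)) ht)
    have h3 := Real.log_nonneg hlog
    refine hM.mul_le_mul le_rfl (by linarith) (by linarith) ?_
    have := (mul_nonneg_iff_of_pos_left (hM.pos 0 le_rfl)).1 ht0
    linarith
  · intro B
    refine ⟨M B * (|Real.log B| + |Real.log (Real.log B)| + |Real.log (K B)|), fun t ht htB => ?_⟩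
    have ht1 : 1 < t := ht
    refine hM.mul_le_mul (by linarith) htB ?_ (by positivity)
    have h1 := hK.log_le_abs (by linarith) htB
    have h2 := Real.log_le_log (by linarith) htB
    have h3 := (Real.log_le_log (Real.log_pos ht1) h2).trans (le_abs_self _)
    have h4 := h2.trans (le_abs_self _)
    linarith

/-! ### Consequences of regular growth. -/

/-- Multiplicative growth of `V` by a factor `1 + 16 / (t M(t))` over a bounded ratio. -/
def HasGrowth (M V : ℝ → ℝ) : Prop :=
  ∃ C : ℝ, 0 < C ∧ ∀ᶠ t in atTop, 0 ≤ V t ∧ V t * (1 + 16 / (t * M t)) ≤ V (C * t)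

theorem IsGrowth.eventually_log (hK : IsGrowth K) (B : ℝ) :
    ∀ᶠ t in atTop, 0 < K t ∧ 1 ≤ Real.log t ∧ B ≤ Real.log t + Real.log (K t) := by
  obtain ⟨T, hT1, hTK⟩ := hK.exists_pos
  filter_upwards [eventually_ge_atTop T, Real.tendsto_log_atTop.eventually_ge_atTop 1,
    Real.tendsto_log_atTop.eventually_ge_atTop (B - Real.log (K T))] with t ht hlog hB
  have h2 := Real.log_le_log (hTK T le_rfl) (hK.mono (Set.mem_Ici.2 (by linarith))
      (Set.mem_Ici.2 (by linarith)) ht)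
  exact ⟨hTK t ht, hlog, by linarith⟩

theorem IsWidth.eventually_le_mul (hM : IsWidth M) (B : ℝ) : ∀ᶠ t in atTop, B ≤ t * M t := by
  have h1 : Tendsto (fun t => t * M 0) atTop atTop :=
    tendsto_id.atTop_mul_const (hM.pos 0 le_rfl)
  filter_upwards [h1.eventually_ge_atTop B, eventually_ge_atTop 0] with t ht h0
  have := hM.mono Set.self_mem_Ici h0 h0
  exact ht.trans (mul_le_mul_of_nonneg_left this h0)

theorem IsOfRegularGrowth.eventually_mul_le (hM : IsWidth M) (hK : IsGrowth K) {c : ℝ}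
    (hc : 675 ≤ c) (h : IsOfRegularGrowth (fun t => t * M t / c) (MKlog M K)) :
    ∃ C : ℝ, 0 < C ∧ ∀ᶠ t in atTop,
      MKlog M K t * (1 + 675 / (t * M t)) ≤ MKlog M K (C * t) := by
  obtain ⟨C, hC, t₀, ht₀, h⟩ := h
  refine ⟨C, hC, ?_⟩
  filter_upwards [eventually_ge_atTop t₀, hK.eventually_log 1] with t ht ⟨hKt, hlog, hℓ⟩
  have ht0 : 0 < t := ht₀.trans_le ht
  have hMt := hM.pos t ht0.le
  have hV : 0 < MKlog M K t := by
    have := Real.log_nonneg hlog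
    exact mul_pos hMt (by linarith)
  have h1 := h t ht
  rw [le_div_iff₀ hV, one_div_div] at h1
  refine le_trans ?_ h1
  rw [mul_comm]
  gcongr

theorem hasGrowth_MKlog (hM : IsWidth M) (hK : IsGrowth K) {c : ℝ} (hc : 675 ≤ c)
    (h : IsOfRegularGrowth (fun t => t * M t / c) (MKlog M K)) : HasGrowth M (MKlog M K) := by
  obtain ⟨C, hC, h⟩ := h.eventually_mul_le hM hK hc
  refine ⟨C, hC, ?_⟩
  filter_upwards [h, hK.eventually_log 1, eventually_gt_atTop 0] with t ht ⟨hKt, hlog, hℓ⟩ ht0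
  have hMt := hM.pos t ht0.le
  have hV : 0 ≤ MKlog M K t := by
    have := Real.log_nonneg hlog
    exact mul_nonneg hMt.le (by linarith)
  refine ⟨hV, le_trans ?_ ht⟩
  gcongr
  norm_num

theorem log_add_le {a b : ℝ} (ha : 0 < a) (hb : 0 ≤ b) :
    Real.log (a + b) ≤ Real.log a + b / a := by
  have h1 : a + b = a * (1 + b / a) := by field_simp
  have h2 : 0 ≤ b / a := by positivity
  rw [h1, Real.log_mul ha.ne' (by positivity)]
  have := Real.log_le_sub_one_of_pos (x := 1 + b / a) (by positivity)
  linarith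

/-- Removes the double logarithm from the growth condition: m, ℓ, u stand for M(t), log t + log
K(t), log log t, the primes for the values at C't, and q = t M(t). If ℓ ≤ q, the additive gain L ≥
16 suffices. If m' ≥ m(1 + 16/q), the growth of M suffices. Otherwise m' is close to m and u' ≤ u +
1, so the double logarithm accounts for little of the growth, and ℓ/q > 1 lets 675 absorb the loss.
-/
theorem growth_of_log_growth {m m' ℓ ℓ' u u' q L : ℝ} (hm : 0 < m) (hmm : m ≤ m') (hq : 16 ≤ q)
    (hℓ : 0 ≤ ℓ) (hu : 0 ≤ u) (hL : 16 ≤ L) (hℓ' : ℓ + L ≤ ℓ') (hu' : u' ≤ u + 1)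
    (h : m * (ℓ + u) * (1 + 675 / q) ≤ m' * (ℓ' + u')) : m * ℓ * (1 + 16 / q) ≤ m' * ℓ' := by
  have hq0 : 0 < q := by linarith
  have hm' : 0 < m' := hm.trans_le hmm
  rcases le_or_gt ℓ q with hℓq | hℓq
  · have h1 : ℓ * (16 / q) ≤ 16 := by
      rw [← mul_div_assoc, div_le_iff₀ hq0]
      linarith
    calc m * ℓ * (1 + 16 / q) = m * (ℓ + ℓ * (16 / q)) := by ring
      _ ≤ m * ℓ' := by
        gcongr
        linarith
      _ ≤ m' * ℓ' := by
        have : 0 ≤ ℓ' := by linarith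
        gcongr
  · rcases le_or_gt (m * (1 + 16 / q)) m' with h1 | h1
    · calc m * ℓ * (1 + 16 / q) = m * (1 + 16 / q) * ℓ := by ring
        _ ≤ m' * ℓ' := by
          have : ℓ ≤ ℓ' := by linarith
          gcongr
    · set r : ℝ := 1 / q with hr
      have hr0 : 0 < r := by positivity
      have e1 : 675 / q = 675 * r := by rw [hr]; ring
      have e2 : 16 / q = 16 * r := by rw [hr]; ring
      rw [e2] at h1 ⊢
      rw [e1] at h
      have hr1 : 16 * r ≤ 1 := by
        rw [← e2, div_le_one hq0]
        exact hq
      have hℓr : 1 ≤ ℓ * r := by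
        rw [hr, mul_one_div, one_le_div hq0]
        exact hℓq.le
      have h2 : m' * u' ≤ m * (1 + 16 * r) * (u + 1) := by
        calc m' * u' ≤ m' * (u + 1) := by gcongr
          _ ≤ _ := by gcongr
      have hur : 0 ≤ u * r := by positivity
      have h3 : ℓ * (1 + 16 * r) ≤ (ℓ + u) * (1 + 675 * r) - (1 + 16 * r) * (u + 1) := by
        nlinarith
      have h4 : m * (ℓ * (1 + 16 * r)) ≤ m * ((ℓ + u) * (1 + 675 * r) - (1 + 16 * r) * (u + 1)) := by
        gcongr
      nlinarith

theorem hasGrowth_MK (hM : IsWidth M) (hK : IsGrowth K) {c : ℝ} (hc : 675 ≤ c)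
    (h : IsOfRegularGrowth (fun t => t * M t / c) (MKlog M K)) : HasGrowth M (MK M K) := by
  obtain ⟨C, hC, h⟩ := h.eventually_mul_le hM hK hc
  -- Then log C' ≥ 16 is the additive gain in log t, while log log grows by at most 1 once log t ≥
  -- log C'.
  set C' : ℝ := max C (Real.exp 16) with hC'
  have hCC : C ≤ C' := le_max_left _ _
  have hC'e : Real.exp 16 ≤ C' := le_max_right _ _
  have hC'0 : 0 < C' := hC.trans_le hCC
  have hlogC : 16 ≤ Real.log C' := (Real.le_log_iff_exp_le hC'0).2 hC'e
  have hC'1 : 1 ≤ C' := le_trans (by linarith [Real.add_one_le_exp (16 : ℝ)]) hC'e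
  have hCt : Tendsto (fun t => C * t) atTop atTop := tendsto_id.const_mul_atTop hC
  refine ⟨C', hC'0, ?_⟩
  filter_upwards [h, hK.eventually_log 1, hCt.eventually (hK.eventually_log 1),
    eventually_gt_atTop 0, Real.tendsto_log_atTop.eventually_ge_atTop (Real.log C'),
    hM.eventually_le_mul 16] with t ht ⟨hKt, hlog, hℓ⟩ ⟨hKs, hlogs, hℓs⟩ ht0 hlogt hq
  have hMt := hM.pos t ht0.le
  have hs0 : 0 < C * t := by positivity
  have hss : C * t ≤ C' * t := by gcongr
  have hts : t ≤ C' * t := le_mul_of_one_le_left ht0.le hC'1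
  have hmono : MKlog M K (C * t) ≤ MKlog M K (C' * t) := by
    have h1 := Real.log_le_log hs0 hss
    have h2 := Real.log_le_log (by linarith) h1
    have h3 := Real.log_le_log hKs (hK.mono hs0.le (hs0.le.trans hss) hss)
    have h4 := Real.log_nonneg hlogs
    exact hM.mul_le_mul hs0.le hss (by linarith) (by linarith)
  have hlogmul : Real.log (C' * t) = Real.log t + Real.log C' := by
    rw [Real.log_mul hC'0.ne' ht0.ne', add_comm]
  have hKmono := Real.log_le_log hKt (hK.mono ht0.le (ht0.le.trans hts) hts)
  refine ⟨mul_nonneg hMt.le (by linarith), ?_⟩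
  refine growth_of_log_growth (u := Real.log (Real.log t)) (u' := Real.log (Real.log (C' * t)))
    (L := Real.log C') hMt (hM.mono ht0.le (ht0.le.trans hts) hts) hq (by linarith)
    (Real.log_nonneg hlog) hlogC (by linarith) ?_ ?_
  · rw [hlogmul]
    refine (log_add_le (by linarith) (by linarith)).trans ?_
    have : Real.log C' / Real.log t ≤ 1 := (div_le_one (by linarith)).2 hlogt
    linarith
  · have h1 := ht.trans hmono
    simp only [MKlog] at h1
    calc _ = M t * (Real.log t + Real.log (Real.log t) + Real.log (K t)) *
          (1 + 675 / (t * M t)) := by ring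
      _ ≤ _ := h1
      _ = _ := by ring

end

/-! ### Choice of R and the final estimates. -/

section

variable {τ M K V I : ℝ → ℝ} {A : ℝ}

theorem isBigO_of_deviation {C : ℝ}
    (h : ∀ᶠ x in atTop, 0 < I x ∧ |deviation τ A x| ≤ C / I x) :
    (fun x : ℝ => τ x - A * Real.exp x) =O[atTop] (fun x : ℝ => Real.exp x / I x) := by
  refine IsBigO.of_bound C ?_
  filter_upwards [h] with x ⟨hI, hx⟩
  have h1 : τ x - A * Real.exp x = Real.exp x * deviation τ A x := by
    rw [deviation, mul_sub, ← mul_assoc, ← Real.exp_add]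
    simp
    ring
  rw [h1, norm_mul, norm_div, Real.norm_of_nonneg (Real.exp_pos x).le, Real.norm_of_nonneg hI.le,
    Real.norm_eq_abs]
  calc _ ≤ Real.exp x * (C / I x) := by gcongr
    _ = _ := by ring

/-- Take R = I(cx), so that V(R) = cx; the room 1 - c absorbs 9δ/R once R is large. -/
theorem isBigO_of_lt_one (hM : IsWidth M) (hI : ∀ B : ℝ, ∀ᶠ x in atTop, V (I x) = x ∧ B < I x)
    (hV : ∃ C R₀ : ℝ, ∀ R x : ℝ, R₀ ≤ R → 3 ≤ x → V R ≤ x * (1 - 9 * (1 / M R) / R) →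
      |deviation τ A x| ≤ C / R) {c : ℝ} (hc0 : 0 < c) (hc1 : c < 1) :
    (fun x : ℝ => τ x - A * Real.exp x) =O[atTop] (fun x : ℝ => Real.exp x / I (c * x)) := by
  obtain ⟨C, R₀, hV⟩ := hV
  refine isBigO_of_deviation (I := fun x => I (c * x)) (C := C) ?_
  have hcx : Tendsto (fun x => c * x) atTop atTop := tendsto_id.const_mul_atTop hc0
  filter_upwards [hcx.eventually (hI (max 0 (max R₀ (9 * (1 / M 0) / (1 - c))))),
    eventually_ge_atTop 3] with x ⟨hVI, hlt⟩ hx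
  have h0 : 0 < I (c * x) := (le_max_left _ _).trans_lt hlt
  have h1 : R₀ ≤ I (c * x) := ((le_max_left _ _).trans (le_max_right _ _)).trans hlt.le
  have h2 : 9 * (1 / M 0) / (1 - c) ≤ I (c * x) :=
    ((le_max_right _ _).trans (le_max_right _ _)).trans hlt.le
  refine ⟨h0, hV _ _ h1 hx ?_⟩
  rw [hVI]
  have h3 : 9 * (1 / M (I (c * x))) / I (c * x) ≤ 1 - c := by
    rw [div_le_iff₀ (by linarith)] at h2
    rw [div_le_iff₀ h0]
    have := hM.one_div_le le_rfl h0.le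
    linarith
  nlinarith

/-- Take R = I(x)/C'. Then V(R)(1 + 16q) ≤ V(C'R) = x with q = 1/(R M(R)), and (1 + 16q)(1 - 9q) ≥ 1
for q ≤ 1/30. Replacing R by I(x) only changes the constant. -/
theorem isBigO_of_hasGrowth (hM : IsWidth M)
    (hI : ∀ B : ℝ, ∀ᶠ x in atTop, V (I x) = x ∧ B < I x)
    (hV : ∃ C R₀ : ℝ, ∀ R x : ℝ, R₀ ≤ R → 3 ≤ x → V R ≤ x * (1 - 9 * (1 / M R) / R) →
      |deviation τ A x| ≤ C / R) (hgrow : HasGrowth M V) :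
    (fun x : ℝ => τ x - A * Real.exp x) =O[atTop] (fun x : ℝ => Real.exp x / I x) := by
  obtain ⟨C, R₀, hV⟩ := hV
  obtain ⟨C', hC', hgrow⟩ := hgrow
  obtain ⟨t₀, ht₀⟩ := eventually_atTop.1 (hgrow.and (hM.eventually_le_mul 30))
  refine isBigO_of_deviation (C := C * C') ?_
  filter_upwards [hI (C' * max 1 (max R₀ t₀)), eventually_ge_atTop 3] with x ⟨hVI, hlt⟩ hx
  set R : ℝ := I x / C' with hR
  have hIR : C' * R = I x := by rw [hR]; field_simp
  rw [← hIR] at hlt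
  have hlt' : max 1 (max R₀ t₀) < R := lt_of_mul_lt_mul_left hlt hC'.le
  have hR1 : 1 < R := (le_max_left _ _).trans_lt hlt'
  have hR0 : R₀ ≤ R := ((le_max_left _ _).trans (le_max_right _ _)).trans hlt'.le
  obtain ⟨⟨hVR, hVC⟩, h30⟩ := ht₀ R (((le_max_right _ _).trans (le_max_right _ _)).trans hlt'.le)
  rw [hIR, hVI] at hVC
  have hMR := hM.pos R (by linarith)
  set q : ℝ := 1 / (R * M R) with hq
  have hq0 : 0 < q := by positivity
  have hq1 : 30 * q ≤ 1 := by
    rw [hq, mul_one_div, div_le_one (by positivity)]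
    exact h30
  have e1 : 16 / (R * M R) = 16 * q := by rw [hq]; ring
  have e2 : 9 * (1 / M R) / R = 9 * q := by rw [hq]; field_simp
  rw [e1] at hVC
  have hdev := hV R x hR0 hx (by
    rw [e2]
    have h1 : 1 ≤ (1 + 16 * q) * (1 - 9 * q) := by nlinarith
    calc V R = V R * 1 := (mul_one _).symm
      _ ≤ V R * ((1 + 16 * q) * (1 - 9 * q)) := by gcongr
      _ = V R * (1 + 16 * q) * (1 - 9 * q) := by ring
      _ ≤ x * (1 - 9 * q) := by
        have : 0 ≤ 1 - 9 * q := by linarith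
        gcongr)
  refine ⟨by rw [← hIR]; positivity, hdev.trans_eq ?_⟩
  rw [← hIR]
  field_simp

end

end

theorem theorem1p4
    (τ M K : ℝ → ℝ) (A : ℝ) (g : ℂ → ℂ)
    -- `M : [0,∞) → (0,∞)` and `K : [0,∞) → [0,∞)`, continuous and non-decreasing, `K ≢ 0`
    (hMcont : ContinuousOn M (Set.Ici 0)) (hMmono : MonotoneOn M (Set.Ici 0))
    (hMpos : ∀ t ≥ 0, 0 < M t)
    (hKcont : ContinuousOn K (Set.Ici 0)) (hKmono : MonotoneOn K (Set.Ici 0))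
    (hKnonneg : ∀ t ≥ 0, 0 ≤ K t) (hKne : ∃ t ≥ 0, 0 < K t)
    -- `τ` is non-decreasing on `[0,∞)` and its Laplace transform converges on `Re s > 1`
    (hτ : MonotoneOn τ (Set.Ici 0))
    (hconv : ∀ s : ℂ, 1 < s.re → ∃ l : ℂ, HasLaplace τ s l)
    (hA : 0 < A)
    -- `g` is the analytic extension of `L{τ; s + 1} - A / s` to `Ω_M`
    (hg : AnalyticOnClosedDomain g (Omega M))
    (hext : ∀ s ∈ Omega M, 0 < s.re → HasLaplace τ (s + 1) (g s + (A : ℂ) / s))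
    -- the bound `g(s) ≪ K(|s|) / |s|` as `|s| → ∞` in `Ω_M`
    (hbound : ∃ B R : ℝ, ∀ s ∈ Omega M, R ≤ ‖s‖ → ‖g s‖ ≤ B * (K ‖s‖ / ‖s‖)) :
    (∀ c : ℝ, 0 < c → c < 1 →
      (fun x : ℝ => τ x - A * Real.exp x) =O[atTop]
        (fun x : ℝ => Real.exp x / MKlogInv M K (c * x))) ∧
    (IsOfRegularGrowth (fun t => t * M t / 675) (MKlog M K) →
      (fun x : ℝ => τ x - A * Real.exp x) =O[atTop]
        (fun x : ℝ => Real.exp x / MKlogInv M K x)) ∧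
    (((IsOfRegularGrowth (fun t => t * M t / 675) (MKlog M K) ∧ IsOfPositiveIncrease K) ∨
      (EventuallyMonotoneOverLogPow M ∧
        IsOfRegularGrowth (fun t => t * M t / 1350) (MKlog M K))) →
      (fun x : ℝ => τ x - A * Real.exp x) =O[atTop]
        (fun x : ℝ => Real.exp x / MKInv M K x)) := by 
  have hM : IsWidth M := ⟨hMcont, hMmono, hMpos⟩
  have hK : IsGrowth K := ⟨hKcont, hKmono, hKnonneg, hKne⟩
  have h : LaplaceExtension τ A g (Omega M) := ⟨hτ, hA, hg.2, hext, hM.strip⟩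
  have hlog := exists_deviation_le_MKlog hM hK h hg.1 hbound
  refine ⟨fun c hc0 hc1 => isBigO_of_lt_one hM (MKlogInv_eventually hM hK) hlog hc0 hc1,
    fun hreg => isBigO_of_hasGrowth hM (MKlogInv_eventually hM hK) hlog
      (hasGrowth_MKlog hM hK le_rfl hreg), ?_⟩
  rintro (⟨hreg, hinc⟩ | ⟨hpow, hreg⟩)
  · exact isBigO_of_hasGrowth hM (MKInv_eventually hM hK)
      (exists_deviation_le_MK_of_positiveIncrease hM hK h hg.1 hbound hinc)
      (hasGrowth_MK hM hK le_rfl hreg)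
  · exact isBigO_of_hasGrowth hM (MKInv_eventually hM hK)
      (exists_deviation_le_MK_of_monotoneOverLogPow hM hK h hg.1 hbound hpow)
      (hasGrowth_MK hM hK (by norm_num) hreg)
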